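/- Let $k$ be a field and let $(H,\Delta,\varepsilon,\Phi,S,\alpha,\beta)$ be a finite dimensional quasi-Hopf algebra over $k$. That is, $H$ is an associative unital $k$-algebra, $\Delta:H\to H\otimes H$ and $\varepsilon:H\to k$ are algebra maps, $\Phi\in H^{\otimes 3}$ is invertible, and for all $h\in H$: $(id\otimes\Delta)\Delta(h)=\Phi\,(\Delta\otimes id)\Delta(h)\,\Phi^{-1}$; $(id\otimes\varepsilon)\Delta(h)=h=(\varepsilon\otimes id)\Delta(h)$; $(1\otimes\Phi)(id\otimes\Delta\otimes id)(\Phi)(\Phi\otimes1)=(id\otimes id\otimes\Delta)(\Phi)(\Delta\otimes id\otimes id)(\Phi)$; $(id\otimes\varepsilon\otimes id)(\Phi)=1\otimes 1$. Moreover $S$ is an anti-automorphism of the algebra $H$ and $\alpha,\beta\in H$ satisfy $S(h_1)\alpha h_2=\varepsilon(h)\alpha$, $h_1\beta S(h_2)=\varepsilon(h)\beta$, $X^1\beta S(X^2)\alpha X^3=1$, $S(x^1)\alpha x^2\beta S(x^3)=1$, with the normalization $\varepsilon(\alpha)=\varepsilon(\beta)=1$. Here and below $\Delta(h)=h_1\otimes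 h_2$, $\Phi=X^1\otimes X^2\otimes X^3=Y^1\otimes Y^2\otimes Y^3$ and $\Phi^{-1}=x^1\otimes x^2\otimes x^3=y^1\otimes y^2\otimes y^3$ (summation understood; repeated use of $\Phi^{\pm1}$ means independent copies). Let $R=R^1\otimes R^2\in H\otimes H$ be an $R$-matrix, i.e. $R$ is invertible and $(\Delta\otimes id)(R)=\Phi_{312}R_{13}\Phi^{-1}_{132}R_{23}\Phi$, $(id\otimes\Delta)(R)=\Phi^{-1}_{231}R_{13}\Phi_{213}R_{12}\Phi^{-1}$ (with $\Phi_{\sigma(1)\sigma(2)\sigma(3)}=X^{\sigma^{-1}(1)}\otimes X^{\sigma^{-1}(2)}\otimes X^{\sigma^{-1}(3)}$, and likewise for $\Phi^{-1}$), $\Delta^{op}(h)R=R\Delta(h)$, $(\varepsilon\otimes id)(R)=(id\otimes\varepsilon)(R)=1$. Assume that $(H,R)$ is triangular: $R^{-1}=R^2\otimes R^1$. Write $R^{-1}=\overline R^1\otimes\overline R^2$. Let $A^1\otimes A^2\otimes A^3\otimes A^4=(\Phi\otimes1)(\Delta\otimes id\otimes id)(\Phi^{-1})$ and $B^1\otimes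 B^2\otimes B^3\otimes B^4=(\Delta\otimes id\otimes id)(\Phi)(\Phi^{-1}\otimes1)$, and put $\gamma=S(A^2)\alpha A^3\otimes S(A^1)\alpha A^4$, $\delta=B^1\beta S(B^4)\otimes B^2\beta S(B^3)$, $$f=f^1\otimes f^2=(S\otimes S)(\Delta^{op}(x^1))\,\gamma\,\Delta(x^2\beta S(x^3)),\qquad f^{-1}=g^1\otimes g^2=\Delta(S(x^1)\alpha x^2)\,\delta\,(S\otimes S)(\Delta^{op}(x^3)),$$ $$p^1\otimes p^2=x^1\otimes x^2\beta S(x^3),\qquad q^1\otimes q^2=X^1\otimes S^{-1}(\alpha X^3)X^2,\qquad u=S(R^2p^2)\alpha R^1p^1 .$$ A left Yetter–Drinfeld module is a left $H$-module $M$ with a linear map $m\mapsto m_{(-1)}\otimes m_{(0)}\in H\otimes M$ such that $\varepsilon(m_{(-1)})m_{(0)}=m$, $h_1m_{(-1)}\otimes h_2\cdot m_{(0)}=(h_1\cdot m)_{(-1)}h_2\otimes(h_1\cdot m)_{(0)}$, and $X^1m_{(-1)}\otimes(X^2\cdot m_{(0)})_{(-1)}X^3\otimes(X^2\cdot m_{(0)})_{(0)}=X^1(Y^1\cdot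 m)_{(-1)_1}Y^2\otimes X^2(Y^1\cdot m)_{(-1)_2}Y^3\otimes X^3\cdot(Y^1\cdot m)_{(0)}$. These form a braided monoidal category: $H$ acts on tensor products through $\Delta$ and on $k$ through $\varepsilon$, $k$ has the coaction $1\mapsto 1_H\otimes 1$, the associativity constraint is $a((u\otimes v)\otimes w)=X^1\cdot u\otimes(X^2\cdot v\otimes X^3\cdot w)$, the braiding is $c(m\otimes n)=m_{(-1)}\cdot n\otimes m_{(0)}$, and the coaction on $M\otimes N$ is $m\otimes n\mapsto X^1(x^1Y^1\cdot m)_{(-1)}x^2(Y^2\cdot n)_{(-1)}Y^3\otimes X^2\cdot(x^1Y^1\cdot m)_{(0)}\otimes X^3x^3\cdot(Y^2\cdot n)_{(0)}$. A braided Hopf algebra is a Hopf algebra in this category. An isomorphism of braided Hopf algebras is a bijective linear map that commutes with the actions, coactions, multiplications, units, comultiplications, counits and antipodes. Let $H_0$ be the space $H$ with action $h\triangleright h'=h_1h'S(h_2)$, coaction $h\mapsto R^2\otimes R^1\triangleright h$, multiplication $h\circ h'=X^1hS(x^1X^2)\alpha x^2X^3_1h'S(x^3X^3_2)$, unit $\beta$,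 counit $\varepsilon$, and $$\underline\Delta(h)=h_{\underline1}\otimes h_{\underline2}=x^1X^1h_1g^1S(x^2R^2y^3X^3_2)\otimes x^3R^1\triangleright y^1X^2h_2g^2S(y^2X^3_1),$$ $$\underline S(h)=X^1R^2p^2S\big(q^1(X^2R^1p^1\triangleright h)S(q^2)X^3\big)$$ (with two independent copies of $\Phi^{-1}$ in $\underline\Delta$). Let $\{{}_ie\}$ be a basis of $H$ with dual basis $\{{}^ie\}$. The left dual $H_0^*$ is $H^*=\mathrm{Hom}_k(H,k)$ with action $(h\mapsto\varphi)(h')=\varphi(S(h)\triangleright h')$, coaction $\varphi\mapsto R^2\otimes(R^1\mapsto\varphi)$, unit $\varepsilon$, counit $\varphi\mapsto\varphi(\beta)$, antipode $\varphi\mapsto\varphi\circ\underline S$, and $$(\varphi\,\underline\circ\,\psi)(h)=\varphi(f^2\overline R^2\triangleright h_{\underline1})\,\psi(f^1\overline R^1\triangleright h_{\underline2}),\qquad \Delta_{H_0^*}(\varphi)=\varphi\big((R^2g^2\triangleright{}_ie)\circ(R^1g^1\triangleright{}_je)\big)\,{}^ie\otimes{}^je .$$ The right dual ${}^*H_0$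 is $H^*$ with action $(h\succ\varphi)(h')=\varphi(S^{-1}(h)\triangleright h')$, coaction $\varphi\mapsto R^2\otimes(R^1\succ\varphi)$, unit $\varepsilon$, counit $\varphi\mapsto\varphi(\beta)$, antipode $\varphi\mapsto\varphi\circ\underline S$, and $$(\varphi\,\overline\circ\,\psi)(h)=\varphi(S^{-1}(f^2\overline R^2)\triangleright h_{\underline1})\,\psi(S^{-1}(f^1\overline R^1)\triangleright h_{\underline2}),$$ $$\Delta_{{}^*H_0}(\varphi)=\varphi\big((S^{-1}(R^2g^2)\triangleright{}_ie)\circ(S^{-1}(R^1g^1)\triangleright{}_je)\big)\,{}^ie\otimes{}^je .$$ With $\mathrm{coev}'(1)={}^ie\otimes S^{-1}(\beta)\triangleright{}_ie\in{}^*H_0\otimes H_0$ and $\mathrm{ev}(\varphi\otimes h)=\varphi(\alpha\triangleright h)$, let $\Theta_{H_0}:H_0^*\to{}^*H_0$ be the canonical map $$\Theta_{H_0}=({}^*H_0\otimes\mathrm{ev})\circ a_{{}^*H_0,H_0^*,H_0}\circ(c_{H_0^*,{}^*H_0}\otimes H_0)\circ a^{-1}_{H_0^*,{}^*H_0,H_0}\circ(H_0^*\otimes\mathrm{coev}').$$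 **Proposition 5.2.** $H_0^*$ and ${}^*H_0$ are braided Hopf algebras, $u$ is invertible in $H$, $\Theta_{H_0}(\varphi)=u^{-1}\succ\varphi$ for all $\varphi\in H_0^*$, and $\Theta_{H_0}$ is an isomorphism of braided Hopf algebras from $H_0^*$ to ${}^*H_0$. -/

import Mathlib

open scoped TensorProduct

namespace QuasiHopf

noncomputable section

/-! ### Sweedler notation -/

/-- Sweedler contraction: for `t = ∑ a ⊗ b`, the value `∑ F a b`.  It is computed by expanding `t`
in a basis, so it is linear in `t` for every `F`, and for a bilinear `F` (the only case in which it
is used) it is the map induced by `F` on the tensor product, see `sw_tmul`. -/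
def sw {k A B M : Type*} [Field k] [AddCommGroup A] [Module k A] [AddCommGroup B] [Module k B]
    [AddCommGroup M] [Module k M] (t : A ⊗[k] B) (F : A → B → M) : M :=
  ((Module.Basis.ofVectorSpace k A).tensorProduct (Module.Basis.ofVectorSpace k B)).constr k
    (fun ij => F (Module.Basis.ofVectorSpace k A ij.1) (Module.Basis.ofVectorSpace k B ij.2)) t

/-- Sweedler contraction for threefold tensors: for `t = ∑ a ⊗ b ⊗ c`, the value `∑ F a b c`. -/
def sw3 {k A B C M : Type*} [Field k] [AddCommGroup A] [Module k A] [AddCommGroup B] [Module k B]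
    [AddCommGroup C] [Module k C] [AddCommGroup M] [Module k M]
    (t : A ⊗[k] (B ⊗[k] C)) (F : A → B → C → M) : M :=
  sw t fun a s => sw s fun b c => F a b c

/-- Sweedler contraction for fourfold tensors. -/
def sw4 {k A B C D M : Type*} [Field k] [AddCommGroup A] [Module k A] [AddCommGroup B] [Module k B]
    [AddCommGroup C] [Module k C] [AddCommGroup D] [Module k D] [AddCommGroup M] [Module k M]
    (t : A ⊗[k] (B ⊗[k] (C ⊗[k] D))) (F : A → B → C → D → M) : M :=
  sw t fun a s => sw3 s fun b c d => F a b c d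

section
variable {k A B C M : Type*} [Field k] [AddCommGroup A] [Module k A] [AddCommGroup B] [Module k B]
  [AddCommGroup C] [Module k C] [AddCommGroup M] [Module k M]

theorem sw_add_left (s t : A ⊗[k] B) (F : A → B → M) : sw (s + t) F = sw s F + sw t F :=
  map_add _ s t

theorem sw_smul_left (c : k) (t : A ⊗[k] B) (F : A → B → M) : sw (c • t) F = c • sw t F :=
  map_smul _ c t

theorem sw_add_right (t : A ⊗[k] B) (F G : A → B → M) :
    sw t (fun a b => F a b + G a b) = sw t F + sw t G := by
  simp only [sw, Module.Basis.constr_apply, Finsupp.sum, smul_add, Finset.sum_add_distrib]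

theorem sw_smul_right (c : k) (t : A ⊗[k] B) (F : A → B → M) :
    sw t (fun a b => c • F a b) = c • sw t F := by
  simp only [sw, Module.Basis.constr_apply, Finsupp.sum, Finset.smul_sum]
  exact Finset.sum_congr rfl fun i _ => smul_comm _ _ _

/-- For a bilinear `F`, the contraction is the one induced by the universal property. -/
theorem sw_eq_lift (t : A ⊗[k] B) (F : A →ₗ[k] B →ₗ[k] M) :
    sw t (fun a b => F a b) = TensorProduct.lift F t := by
  unfold sw
  congr 1
  refine ((Module.Basis.ofVectorSpace k A).tensorProduct
    (Module.Basis.ofVectorSpace k B)).ext fun i => ?_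
  rw [Module.Basis.constr_basis, Module.Basis.tensorProduct_apply, TensorProduct.lift.tmul]

theorem sw_tmul (a : A) (b : B) (F : A → B → M) (h₁ : ∀ b, IsLinearMap k fun a => F a b)
    (h₂ : ∀ a, IsLinearMap k (F a)) : sw (a ⊗ₜ[k] b) F = F a b :=
  sw_eq_lift (a ⊗ₜ[k] b) (LinearMap.mk₂ k F (fun x y b => (h₁ b).map_add x y)
    (fun c x b => (h₁ b).map_smul c x) (fun a => (h₂ a).map_add) (fun c a => (h₂ a).map_smul c))

theorem sw3_add_right (t : A ⊗[k] (B ⊗[k] C)) (F G : A → B → C → M) :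
    sw3 t (fun a b c => F a b c + G a b c) = sw3 t F + sw3 t G := by
  simp only [sw3, sw_add_right]

theorem sw3_smul_right (r : k) (t : A ⊗[k] (B ⊗[k] C)) (F : A → B → C → M) :
    sw3 t (fun a b c => r • F a b c) = r • sw3 t F := by
  simp only [sw3, sw_smul_right]

end

/-! ### Quasi-Hopf algebras -/

/-- A quasi-Hopf algebra structure `(Δ, ε, Φ, S, α, β)` on a `k`-algebra `H`, with the usual
normalization `ε(α) = ε(β) = 1`. -/
structure QuasiHopfAlgebra (k H : Type*) [Field k] [Ring H] [Algebra k H] where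
  /-- comultiplication -/
  Δ : H →ₐ[k] H ⊗[k] H
  /-- counit -/
  ε : H →ₐ[k] k
  /-- reassociator -/
  Φ : (H ⊗[k] (H ⊗[k] H))ˣ
  /-- the antipode, an anti-automorphism of the algebra `H` -/
  S : H ≃ₗ[k] H
  /-- the element `α` -/
  α : H
  /-- the element `β` -/
  β : H
  /-- `(id ⊗ Δ)(Δ(h)) = Φ (Δ ⊗ id)(Δ(h)) Φ⁻¹` -/
  coassoc : ∀ h, Algebra.TensorProduct.map (AlgHom.id k H) Δ (Δ h) =
    Φ.val * TensorProduct.assoc k H H H (Algebra.TensorProduct.map Δ (AlgHom.id k H) (Δ h))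
      * Φ⁻¹.val
  /-- `(id ⊗ ε)(Δ(h)) = h` -/
  counit_right : ∀ h, sw (Δ h) (fun h₁ h₂ => ε h₂ • h₁) = h
  /-- `(ε ⊗ id)(Δ(h)) = h` -/
  counit_left : ∀ h, sw (Δ h) (fun h₁ h₂ => ε h₁ • h₂) = h
  /-- `(1 ⊗ Φ)(id ⊗ Δ ⊗ id)(Φ)(Φ ⊗ 1) = (id ⊗ id ⊗ Δ)(Φ)(Δ ⊗ id ⊗ id)(Φ)` -/
  cocycle :
    ((1 : H) ⊗ₜ[k] Φ.val) *
      sw3 Φ.val (fun X₁ X₂ X₃ => X₁ ⊗ₜ[k] TensorProduct.assoc k H H H (Δ X₂ ⊗ₜ[k] X₃)) *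
      sw3 Φ.val (fun X₁ X₂ X₃ => X₁ ⊗ₜ[k] (X₂ ⊗ₜ[k] (X₃ ⊗ₜ[k] (1 : H)))) =
    sw3 Φ.val (fun X₁ X₂ X₃ => X₁ ⊗ₜ[k] (X₂ ⊗ₜ[k] Δ X₃)) *
      sw3 Φ.val (fun X₁ X₂ X₃ => TensorProduct.assoc k H H (H ⊗[k] H) (Δ X₁ ⊗ₜ[k] (X₂ ⊗ₜ[k] X₃)))
  /-- `(id ⊗ ε ⊗ id)(Φ) = 1 ⊗ 1` -/
  cocycle_counit : sw3 Φ.val (fun X₁ X₂ X₃ => ε X₂ • (X₁ ⊗ₜ[k] X₃)) = 1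
  S_mul : ∀ a b, S (a * b) = S b * S a
  /-- `S(h₁) α h₂ = ε(h) α` -/
  S_α : ∀ h, sw (Δ h) (fun h₁ h₂ => S h₁ * α * h₂) = ε h • α
  /-- `h₁ β S(h₂) = ε(h) β` -/
  S_β : ∀ h, sw (Δ h) (fun h₁ h₂ => h₁ * β * S h₂) = ε h • β
  /-- `X¹ β S(X²) α X³ = 1` -/
  Φ_β_α : sw3 Φ.val (fun X₁ X₂ X₃ => X₁ * β * S X₂ * α * X₃) = 1
  /-- `S(x¹) α x² β S(x³) = 1`, where `Φ⁻¹ = x¹ ⊗ x² ⊗ x³` -/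
  Φ_α_β : sw3 Φ⁻¹.val (fun x₁ x₂ x₃ => S x₁ * α * x₂ * β * S x₃) = 1
  ε_α : ε α = 1
  ε_β : ε β = 1

section
variable {k H : Type*} [Field k] [Ring H] [Algebra k H]

namespace QuasiHopfAlgebra

variable (Q : QuasiHopfAlgebra k H)

/-- `γ = S(A²) α A³ ⊗ S(A¹) α A⁴`, where `A = (Φ ⊗ 1)(Δ ⊗ id ⊗ id)(Φ⁻¹)`. -/
def γ : H ⊗[k] H :=
  sw4 (sw3 Q.Φ.val (fun X₁ X₂ X₃ => X₁ ⊗ₜ[k] (X₂ ⊗ₜ[k] (X₃ ⊗ₜ[k] (1 : H)))) *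
      sw3 Q.Φ⁻¹.val (fun x₁ x₂ x₃ =>
        TensorProduct.assoc k H H (H ⊗[k] H) (Q.Δ x₁ ⊗ₜ[k] (x₂ ⊗ₜ[k] x₃))))
    fun A₁ A₂ A₃ A₄ => (Q.S A₂ * Q.α * A₃) ⊗ₜ[k] (Q.S A₁ * Q.α * A₄)

/-- `δ = B¹ β S(B⁴) ⊗ B² β S(B³)`, where `B = (Δ ⊗ id ⊗ id)(Φ)(Φ⁻¹ ⊗ 1)`. -/
def δ : H ⊗[k] H :=
  sw4 (sw3 Q.Φ.val (fun X₁ X₂ X₃ =>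
        TensorProduct.assoc k H H (H ⊗[k] H) (Q.Δ X₁ ⊗ₜ[k] (X₂ ⊗ₜ[k] X₃))) *
      sw3 Q.Φ⁻¹.val (fun x₁ x₂ x₃ => x₁ ⊗ₜ[k] (x₂ ⊗ₜ[k] (x₃ ⊗ₜ[k] (1 : H)))))
    fun B₁ B₂ B₃ B₄ => (B₁ * Q.β * Q.S B₄) ⊗ₜ[k] (B₂ * Q.β * Q.S B₃)

/-- `(S ⊗ S)(Δᵒᵖ(h)) = S(h₂) ⊗ S(h₁)`. -/
def SSΔop (h : H) : H ⊗[k] H := sw (Q.Δ h) fun h₁ h₂ => Q.S h₂ ⊗ₜ[k] Q.S h₁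

/-- The Drinfeld twist `f = (S ⊗ S)(Δᵒᵖ(x¹)) γ Δ(x² β S(x³))`. -/
def f : H ⊗[k] H :=
  sw3 Q.Φ⁻¹.val fun x₁ x₂ x₃ => Q.SSΔop x₁ * Q.γ * Q.Δ (x₂ * Q.β * Q.S x₃)

/-- The inverse `f⁻¹ = g¹ ⊗ g² = Δ(S(x¹) α x²) δ (S ⊗ S)(Δᵒᵖ(x³))` of the Drinfeld twist. -/
def g : H ⊗[k] H :=
  sw3 Q.Φ⁻¹.val fun x₁ x₂ x₃ => Q.Δ (Q.S x₁ * Q.α * x₂) * Q.δ * Q.SSΔop x₃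

/-- `p_R = x¹ ⊗ x² β S(x³)`. -/
def pR : H ⊗[k] H := sw3 Q.Φ⁻¹.val fun x₁ x₂ x₃ => x₁ ⊗ₜ[k] (x₂ * Q.β * Q.S x₃)

/-- `q_R = X¹ ⊗ S⁻¹(α X³) X²`. -/
def qR : H ⊗[k] H := sw3 Q.Φ.val fun X₁ X₂ X₃ => X₁ ⊗ₜ[k] (Q.S.symm (Q.α * X₃) * X₂)

end QuasiHopfAlgebra

/-- An `R`-matrix for the quasi-Hopf algebra `Q`. -/
structure RMatrix (Q : QuasiHopfAlgebra k H) where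
  R : (H ⊗[k] H)ˣ
  /-- `(Δ ⊗ id)(R) = Φ₃₁₂ R₁₃ Φ⁻¹₁₃₂ R₂₃ Φ`, where `Φ₃₁₂ = X² ⊗ X³ ⊗ X¹` and
  `Φ⁻¹₁₃₂ = x¹ ⊗ x³ ⊗ x²` -/
  Δ_left : sw R.val (fun R₁ R₂ => TensorProduct.assoc k H H H (Q.Δ R₁ ⊗ₜ[k] R₂)) =
    sw3 Q.Φ.val (fun X₁ X₂ X₃ => X₂ ⊗ₜ[k] (X₃ ⊗ₜ[k] X₁)) *
    sw R.val (fun R₁ R₂ => R₁ ⊗ₜ[k] ((1 : H) ⊗ₜ[k] R₂)) *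
    sw3 Q.Φ⁻¹.val (fun x₁ x₂ x₃ => x₁ ⊗ₜ[k] (x₃ ⊗ₜ[k] x₂)) *
    ((1 : H) ⊗ₜ[k] R.val) * Q.Φ.val
  /-- `(id ⊗ Δ)(R) = Φ⁻¹₂₃₁ R₁₃ Φ₂₁₃ R₁₂ Φ⁻¹`, where `Φ⁻¹₂₃₁ = x³ ⊗ x¹ ⊗ x²` and
  `Φ₂₁₃ = X² ⊗ X¹ ⊗ X³` -/
  Δ_right : sw R.val (fun R₁ R₂ => R₁ ⊗ₜ[k] Q.Δ R₂) =
    sw3 Q.Φ⁻¹.val (fun x₁ x₂ x₃ => x₃ ⊗ₜ[k] (x₁ ⊗ₜ[k] x₂)) *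
    sw R.val (fun R₁ R₂ => R₁ ⊗ₜ[k] ((1 : H) ⊗ₜ[k] R₂)) *
    sw3 Q.Φ.val (fun X₁ X₂ X₃ => X₂ ⊗ₜ[k] (X₁ ⊗ₜ[k] X₃)) *
    sw R.val (fun R₁ R₂ => R₁ ⊗ₜ[k] (R₂ ⊗ₜ[k] (1 : H))) * Q.Φ⁻¹.val
  /-- `Δᵒᵖ(h) R = R Δ(h)` -/
  Δ_op : ∀ h, TensorProduct.comm k H H (Q.Δ h) * R.val = R.val * Q.Δ h
  /-- `(ε ⊗ id)(R) = 1` -/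
  ε_left : sw R.val (fun R₁ R₂ => Q.ε R₁ • R₂) = 1
  /-- `(id ⊗ ε)(R) = 1` -/
  ε_right : sw R.val (fun R₁ R₂ => Q.ε R₂ • R₁) = 1

/-- `(H, R)` is triangular when `R⁻¹ = R₂₁ = R² ⊗ R¹`. -/
def RMatrix.IsTriangular {Q : QuasiHopfAlgebra k H} (𝓡 : RMatrix Q) : Prop :=
  𝓡.R⁻¹.val = TensorProduct.comm k H H 𝓡.R.val

/-- The Drinfeld element `u = S(R² p²) α R¹ p¹`, where `p_R = p¹ ⊗ p²`. -/
def RMatrix.u {Q : QuasiHopfAlgebra k H} (𝓡 : RMatrix Q) : H :=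
  sw 𝓡.R.val fun R₁ R₂ => sw Q.pR fun p₁ p₂ => Q.S (R₂ * p₂) * Q.α * (R₁ * p₁)

/-! ### Yetter-Drinfeld modules and braided Hopf algebras -/

/-- The data of a left `H`-action and a left `H`-coaction on `V`. -/
structure YDData (k H V : Type*) [Field k] [Ring H] [Algebra k H] [AddCommGroup V]
    [Module k V] where
  /-- the action `h · v` -/
  act : H →ₗ[k] V →ₗ[k] V
  /-- the coaction `λ(v) = v₍₋₁₎ ⊗ v₍₀₎` -/
  coact : V →ₗ[k] H ⊗[k] V

/-- `M` is a left Yetter-Drinfeld module over `H`. -/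
structure IsYetterDrinfeld {V : Type*} [AddCommGroup V] [Module k V]
    (Q : QuasiHopfAlgebra k H) (M : YDData k H V) : Prop where
  one_act : ∀ v, M.act 1 v = v
  mul_act : ∀ h h' v, M.act (h * h') v = M.act h (M.act h' v)
  /-- `X¹m₍₋₁₎ ⊗ (X²·m₍₀₎)₍₋₁₎X³ ⊗ (X²·m₍₀₎)₍₀₎ =
  X¹(Y¹·m)₍₋₁₎₁Y² ⊗ X²(Y¹·m)₍₋₁₎₂Y³ ⊗ X³·(Y¹·m)₍₀₎` -/
  coact_coassoc : ∀ m,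
    (sw3 Q.Φ.val fun X₁ X₂ X₃ => sw (M.coact m) fun a m₀ =>
      sw (M.coact (M.act X₂ m₀)) fun b n₀ => (X₁ * a) ⊗ₜ[k] ((b * X₃) ⊗ₜ[k] n₀)) =
    (sw3 Q.Φ.val fun X₁ X₂ X₃ => sw3 Q.Φ.val fun Y₁ Y₂ Y₃ =>
      sw (M.coact (M.act Y₁ m)) fun a m₀ => sw (Q.Δ a) fun a₁ a₂ =>
        (X₁ * a₁ * Y₂) ⊗ₜ[k] ((X₂ * a₂ * Y₃) ⊗ₜ[k] M.act X₃ m₀))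
  /-- `ε(m₍₋₁₎) m₍₀₎ = m` -/
  coact_counit : ∀ m, (sw (M.coact m) fun a m₀ => Q.ε a • m₀) = m
  /-- `h₁m₍₋₁₎ ⊗ h₂·m₍₀₎ = (h₁·m)₍₋₁₎h₂ ⊗ (h₁·m)₍₀₎` -/
  act_coact : ∀ h m,
    (sw (Q.Δ h) fun h₁ h₂ => sw (M.coact m) fun a m₀ => (h₁ * a) ⊗ₜ[k] M.act h₂ m₀) =
    (sw (Q.Δ h) fun h₁ h₂ => sw (M.coact (M.act h₁ m)) fun a m₀ => (a * h₂) ⊗ₜ[k] m₀)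

/-- The coaction on the tensor product of Yetter-Drinfeld modules, evaluated at `m ⊗ n`:
`X¹(x¹Y¹·m)₍₋₁₎x²(Y²·n)₍₋₁₎Y³ ⊗ X²·(x¹Y¹·m)₍₀₎ ⊗ X³x³·(Y²·n)₍₀₎`. -/
def tensorCoact {V W : Type*} [AddCommGroup V] [Module k V] [AddCommGroup W] [Module k W]
    (Q : QuasiHopfAlgebra k H) (M : YDData k H V) (N : YDData k H W) (m : V) (n : W) :
    H ⊗[k] (V ⊗[k] W) :=
  sw3 Q.Φ.val fun X₁ X₂ X₃ => sw3 Q.Φ⁻¹.val fun x₁ x₂ x₃ => sw3 Q.Φ.val fun Y₁ Y₂ Y₃ =>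
    sw (M.coact (M.act (x₁ * Y₁) m)) fun a m₀ => sw (N.coact (N.act Y₂ n)) fun b n₀ =>
      (X₁ * a * x₂ * b * Y₃) ⊗ₜ[k] (M.act X₂ m₀ ⊗ₜ[k] N.act (X₃ * x₃) n₀)

/-- The structure maps of a braided Hopf algebra: an object with action and coaction, a
multiplication, a unit, a comultiplication, a counit and an antipode. -/
structure BraidedHopfData (k H V : Type*) [Field k] [Ring H] [Algebra k H] [AddCommGroup V]
    [Module k V] extends YDData k H V where
  mul : V →ₗ[k] V →ₗ[k] V
  one : V
  comul : V →ₗ[k] V ⊗[k] V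
  counit : V →ₗ[k] k
  antipode : V →ₗ[k] V

/-- `B` is a braided Hopf algebra, that is, a Hopf algebra in the braided monoidal category of left
Yetter-Drinfeld modules over `H`. -/
structure IsBraidedHopfAlgebra {V : Type*} [AddCommGroup V] [Module k V]
    (Q : QuasiHopfAlgebra k H) (B : BraidedHopfData k H V) : Prop where
  yetterDrinfeld : IsYetterDrinfeld Q B.toYDData
  /-- `(ab)c = (X¹·a)[(X²·b)(X³·c)]` -/
  mul_assoc : ∀ a b c, B.mul (B.mul a b) c =
    sw3 Q.Φ.val fun X₁ X₂ X₃ => B.mul (B.act X₁ a) (B.mul (B.act X₂ b) (B.act X₃ c))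
  one_mul : ∀ a, B.mul B.one a = a
  mul_one : ∀ a, B.mul a B.one = a
  /-- `h·(ab) = (h₁·a)(h₂·b)` -/
  act_mul : ∀ h a b, B.act h (B.mul a b) =
    sw (Q.Δ h) fun h₁ h₂ => B.mul (B.act h₁ a) (B.act h₂ b)
  act_one : ∀ h, B.act h B.one = Q.ε h • B.one
  /-- the multiplication is colinear -/
  coact_mul : ∀ a b, B.coact (B.mul a b) =
    TensorProduct.map LinearMap.id (TensorProduct.lift B.mul)
      (tensorCoact Q B.toYDData B.toYDData a b)
  coact_one : B.coact B.one = 1 ⊗ₜ[k] B.one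
  /-- `X¹·b₍₁,₁₎ ⊗ X²·b₍₁,₂₎ ⊗ X³·b₂ = b₁ ⊗ b₍₂,₁₎ ⊗ b₍₂,₂₎` -/
  comul_coassoc : ∀ b,
    (sw3 Q.Φ.val fun X₁ X₂ X₃ => sw (B.comul b) fun b₁ b₂ => sw (B.comul b₁) fun b₁₁ b₁₂ =>
      B.act X₁ b₁₁ ⊗ₜ[k] (B.act X₂ b₁₂ ⊗ₜ[k] B.act X₃ b₂)) =
    (sw (B.comul b) fun b₁ b₂ => b₁ ⊗ₜ[k] B.comul b₂)
  counit_left : ∀ b, (sw (B.comul b) fun b₁ b₂ => B.counit b₁ • b₂) = b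
  counit_right : ∀ b, (sw (B.comul b) fun b₁ b₂ => B.counit b₂ • b₁) = b
  /-- `Δ(h·b) = h₁·b₁ ⊗ h₂·b₂` -/
  comul_act : ∀ h b, B.comul (B.act h b) =
    sw (Q.Δ h) fun h₁ h₂ => TensorProduct.map (B.act h₁) (B.act h₂) (B.comul b)
  counit_act : ∀ h b, B.counit (B.act h b) = Q.ε h * B.counit b
  /-- the comultiplication is colinear -/
  comul_coact : ∀ b, TensorProduct.map LinearMap.id B.comul (B.coact b) =
    sw (B.comul b) fun b₁ b₂ => tensorCoact Q B.toYDData B.toYDData b₁ b₂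
  /-- `ε(b₍₀₎) b₍₋₁₎ = ε(b) 1` -/
  counit_coact : ∀ b, (sw (B.coact b) fun a b₀ => B.counit b₀ • a) = B.counit b • (1 : H)
  /-- the comultiplication is multiplicative, for the multiplication of `B ⊗ B` given by the
  associativity constraints and the braiding `c(m ⊗ n) = m₍₋₁₎·n ⊗ m₍₀₎`:
  `Δ(bb') = [y¹X¹·b₁][y²Y¹(x¹X²·b₂)₍₋₁₎x²X³₁·b'₁] ⊗ [y³₁Y²·(x¹X²·b₂)₍₀₎][y³₂Y³x³X³₂·b'₂]` -/
  comul_mul : ∀ b b', B.comul (B.mul b b') =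
    sw3 Q.Φ⁻¹.val fun y₁ y₂ y₃ => sw3 Q.Φ.val fun X₁ X₂ X₃ => sw3 Q.Φ.val fun Y₁ Y₂ Y₃ =>
    sw3 Q.Φ⁻¹.val fun x₁ x₂ x₃ => sw (B.comul b) fun b₁ b₂ => sw (B.comul b') fun b'₁ b'₂ =>
    sw (B.coact (B.act (x₁ * X₂) b₂)) fun a c₀ => sw (Q.Δ X₃) fun X₃₁ X₃₂ =>
    sw (Q.Δ y₃) fun y₃₁ y₃₂ =>
      B.mul (B.act (y₁ * X₁) b₁) (B.act (y₂ * Y₁ * a * x₂ * X₃₁) b'₁) ⊗ₜ[k]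
      B.mul (B.act (y₃₁ * Y₂) c₀) (B.act (y₃₂ * Y₃ * x₃ * X₃₂) b'₂)
  comul_one : B.comul B.one = B.one ⊗ₜ[k] B.one
  counit_mul : ∀ a b, B.counit (B.mul a b) = B.counit a * B.counit b
  counit_one : B.counit B.one = 1
  antipode_act : ∀ h b, B.antipode (B.act h b) = B.act h (B.antipode b)
  antipode_coact : ∀ b, B.coact (B.antipode b) =
    TensorProduct.map LinearMap.id B.antipode (B.coact b)
  /-- `S(b₁) b₂ = ε(b) 1` -/
  antipode_left : ∀ b,
    (sw (B.comul b) fun b₁ b₂ => B.mul (B.antipode b₁) b₂) = B.counit b • B.one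
  /-- `b₁ S(b₂) = ε(b) 1` -/
  antipode_right : ∀ b,
    (sw (B.comul b) fun b₁ b₂ => B.mul b₁ (B.antipode b₂)) = B.counit b • B.one

/-- `θ` is an isomorphism of braided Hopf algebras: a bijective linear map that commutes with the
`H`-actions, the `H`-coactions and all the Hopf algebra structure maps. -/
structure IsBraidedHopfIso {V W : Type*} [AddCommGroup V] [Module k V] [AddCommGroup W]
    [Module k W] (B : BraidedHopfData k H V) (C : BraidedHopfData k H W) (θ : V →ₗ[k] W) :
    Prop where
  bijective : Function.Bijective θ
  map_act : ∀ h v, θ (B.act h v) = C.act h (θ v)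
  map_coact : ∀ v, C.coact (θ v) = TensorProduct.map LinearMap.id θ (B.coact v)
  map_mul : ∀ v w, θ (B.mul v w) = C.mul (θ v) (θ w)
  map_one : θ B.one = C.one
  map_comul : ∀ v, C.comul (θ v) = TensorProduct.map θ θ (B.comul v)
  map_counit : ∀ v, C.counit (θ v) = B.counit v
  map_antipode : ∀ v, θ (B.antipode v) = C.antipode (θ v)

/-! ### The constraints, the braiding and the canonical map `Θ` -/

/-- The associativity constraint `(u ⊗ v) ⊗ w ↦ X¹·u ⊗ (X²·v ⊗ X³·w)`. -/
def associator {U V W : Type*} [AddCommGroup U] [Module k U] [AddCommGroup V] [Module k V]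
    [AddCommGroup W] [Module k W] (Q : QuasiHopfAlgebra k H) (L : YDData k H U)
    (M : YDData k H V) (N : YDData k H W) : (U ⊗[k] V) ⊗[k] W →ₗ[k] U ⊗[k] (V ⊗[k] W) :=
  (sw3 Q.Φ.val fun X₁ X₂ X₃ => TensorProduct.map (L.act X₁)
    (TensorProduct.map (M.act X₂) (N.act X₃))) ∘ₗ (TensorProduct.assoc k U V W).toLinearMap

/-- The inverse associativity constraint `u ⊗ (v ⊗ w) ↦ (x¹·u ⊗ x²·v) ⊗ x³·w`. -/
def associatorInv {U V W : Type*} [AddCommGroup U] [Module k U] [AddCommGroup V] [Module k V]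
    [AddCommGroup W] [Module k W] (Q : QuasiHopfAlgebra k H) (L : YDData k H U)
    (M : YDData k H V) (N : YDData k H W) : U ⊗[k] (V ⊗[k] W) →ₗ[k] (U ⊗[k] V) ⊗[k] W :=
  (sw3 Q.Φ⁻¹.val fun x₁ x₂ x₃ => TensorProduct.map (TensorProduct.map (L.act x₁) (M.act x₂))
    (N.act x₃)) ∘ₗ (TensorProduct.assoc k U V W).symm.toLinearMap

/-- The braiding `c(m ⊗ n) = m₍₋₁₎·n ⊗ m₍₀₎`. -/
def braiding {V W : Type*} [AddCommGroup V] [Module k V] [AddCommGroup W] [Module k W]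
    (M : YDData k H V) (N : YDData k H W) : V ⊗[k] W →ₗ[k] W ⊗[k] V :=
  TensorProduct.lift (LinearMap.mk₂ k
    (fun m n => sw (M.coact m) fun a m₀ => N.act a n ⊗ₜ[k] m₀)
    (fun m m' n => by simp only [map_add, sw_add_left])
    (fun c m n => by simp only [map_smul, sw_smul_left])
    (fun m n n' => by simp only [map_add, TensorProduct.add_tmul, sw_add_right])
    (fun c m n => by simp only [map_smul, ← TensorProduct.smul_tmul', sw_smul_right]))

/-- The evaluation `M* ⊗ M → k`, `φ ⊗ m ↦ φ(α·m)`. -/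
def ev {V : Type*} [AddCommGroup V] [Module k V] (Q : QuasiHopfAlgebra k H) (M : YDData k H V) :
    Module.Dual k V ⊗[k] V →ₗ[k] k :=
  contractLeft k V ∘ₗ TensorProduct.map LinearMap.id (M.act Q.α)

/-- The value at `1` of the coevaluation `k → *M ⊗ M`, that is `∑ ᵢ mⁱ ⊗ S⁻¹(β)·mᵢ`. -/
def coev' {V : Type*} [AddCommGroup V] [Module k V] [FiniteDimensional k V]
    (Q : QuasiHopfAlgebra k H) (M : YDData k H V) : Module.Dual k V ⊗[k] V :=
  ∑ i, (Module.finBasis k V).coord i ⊗ₜ[k] M.act (Q.S.symm Q.β) (Module.finBasis k V i)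

/-- The canonical map `Θ : M* → *M` of the rigid braided category of finite dimensional
Yetter-Drinfeld modules, where `L` and `N` are the structures of `M*` and `*M`: the composite
`M* → M* ⊗ (*M ⊗ M) → (M* ⊗ *M) ⊗ M → (*M ⊗ M*) ⊗ M → *M ⊗ (M* ⊗ M) → *M`
of `M* ⊗ coev'`, `a⁻¹`, `c ⊗ M`, `a` and `*M ⊗ ev`. -/
def Θ {V : Type*} [AddCommGroup V] [Module k V] [FiniteDimensional k V]
    (Q : QuasiHopfAlgebra k H) (M : YDData k H V) (L N : YDData k H (Module.Dual k V)) :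
    Module.Dual k V →ₗ[k] Module.Dual k V :=
  (TensorProduct.rid k (Module.Dual k V)).toLinearMap ∘ₗ
    TensorProduct.map LinearMap.id (ev Q M) ∘ₗ
    associator Q N L M ∘ₗ
    TensorProduct.map (braiding L N) LinearMap.id ∘ₗ
    associatorInv Q L N M ∘ₗ
    (TensorProduct.mk k (Module.Dual k V) (Module.Dual k V ⊗[k] V)).flip (coev' Q M)

/-! ### The braided Hopf algebra `H₀` and its duals -/

section
variable {Q : QuasiHopfAlgebra k H} (𝓡 : RMatrix Q)

/-- The coaction `λ(m) = R² ⊗ R¹·m` induced by the `R`-matrix on a left `H`-module. -/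
def RMatrix.coact {V : Type*} [AddCommGroup V] [Module k V] (act : H →ₗ[k] V →ₗ[k] V) :
    V →ₗ[k] H ⊗[k] V :=
  sw 𝓡.R.val fun R₁ R₂ => TensorProduct.mk k H V R₂ ∘ₗ act R₁

/-- The action `h ▷ h' = h₁ h' S(h₂)`. -/
def QuasiHopfAlgebra.adj (Q : QuasiHopfAlgebra k H) : H →ₗ[k] H →ₗ[k] H :=
  LinearMap.mk₂ k (fun h h' => sw (Q.Δ h) fun h₁ h₂ => h₁ * h' * Q.S h₂)
    (fun h g h' => by simp only [map_add, sw_add_left])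
    (fun c h h' => by simp only [map_smul, sw_smul_left])
    (fun h h' g => by simp only [mul_add, add_mul, sw_add_right])
    (fun c h h' => by simp only [mul_smul_comm, smul_mul_assoc, sw_smul_right])

/-- The multiplication `h ∘ h' = X¹ h S(x¹X²) α x² X³₁ h' S(x³X³₂)` of `H₀`. -/
def QuasiHopfAlgebra.circ (Q : QuasiHopfAlgebra k H) : H →ₗ[k] H →ₗ[k] H :=
  LinearMap.mk₂ k (fun h h' => sw3 Q.Φ.val fun X₁ X₂ X₃ => sw3 Q.Φ⁻¹.val fun x₁ x₂ x₃ =>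
      sw (Q.Δ X₃) fun X₃₁ X₃₂ =>
        X₁ * h * Q.S (x₁ * X₂) * Q.α * x₂ * X₃₁ * h' * Q.S (x₃ * X₃₂))
    (fun h g h' => by simp only [mul_add, add_mul, sw_add_right, sw3_add_right])
    (fun c h h' => by simp only [mul_smul_comm, smul_mul_assoc, sw_smul_right, sw3_smul_right])
    (fun h h' g => by simp only [mul_add, add_mul, sw_add_right, sw3_add_right])
    (fun c h h' => by simp only [mul_smul_comm, smul_mul_assoc, sw_smul_right, sw3_smul_right])

/-- The comultiplication of `H₀`,
`Δ(h) = x¹X¹h₁g¹S(x²R²y³X³₂) ⊗ x³R¹ ▷ y¹X²h₂g²S(y²X³₁)`. -/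
def RMatrix.comulH₀ : H →ₗ[k] H ⊗[k] H where
  toFun h := sw3 Q.Φ⁻¹.val fun x₁ x₂ x₃ => sw3 Q.Φ.val fun X₁ X₂ X₃ =>
    sw (Q.Δ h) fun h₁ h₂ => sw Q.g fun g₁ g₂ => sw 𝓡.R.val fun R₁ R₂ =>
    sw3 Q.Φ⁻¹.val fun y₁ y₂ y₃ => sw (Q.Δ X₃) fun X₃₁ X₃₂ =>
      (x₁ * X₁ * h₁ * g₁ * Q.S (x₂ * R₂ * y₃ * X₃₂)) ⊗ₜ[k]
      Q.adj (x₃ * R₁) (y₁ * X₂ * h₂ * g₂ * Q.S (y₂ * X₃₁))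
  map_add' h h' := by simp only [map_add, sw_add_left, sw3_add_right]
  map_smul' c h := by simp only [map_smul, sw_smul_left, sw3_smul_right, RingHom.id_apply]

/-- The antipode `S(h) = X¹R²p²S(q¹(X²R¹p¹ ▷ h)S(q²)X³)` of `H₀`. -/
def RMatrix.antipodeH₀ : H →ₗ[k] H where
  toFun h := sw3 Q.Φ.val fun X₁ X₂ X₃ => sw 𝓡.R.val fun R₁ R₂ => sw Q.pR fun p₁ p₂ =>
    sw Q.qR fun q₁ q₂ =>
      X₁ * R₂ * p₂ * Q.S (q₁ * Q.adj (X₂ * R₁ * p₁) h * Q.S q₂ * X₃)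
  map_add' h h' := by
    simp only [map_add, mul_add, add_mul, sw_add_right, sw3_add_right]
  map_smul' c h := by
    simp only [map_smul, mul_smul_comm, smul_mul_assoc, sw_smul_right, sw3_smul_right,
      RingHom.id_apply]

/-- The braided Hopf algebra `H₀`: the space `H` with multiplication `∘`, unit `β`, counit `ε`,
action `▷` and coaction `h ↦ R² ⊗ R¹ ▷ h`. -/
def RMatrix.H₀ : BraidedHopfData k H H where
  act := Q.adj
  coact := 𝓡.coact Q.adj
  mul := Q.circ
  one := Q.β
  comul := 𝓡.comulH₀
  counit := Q.ε.toLinearMap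
  antipode := 𝓡.antipodeH₀

/-- The action `(h ↦ φ)(h') = φ(S(h) ▷ h')` on `H₀*`. -/
def QuasiHopfAlgebra.leftDualAct (Q : QuasiHopfAlgebra k H) :
    H →ₗ[k] Module.Dual k H →ₗ[k] Module.Dual k H :=
  LinearMap.mk₂ k (fun h φ => φ ∘ₗ Q.adj (Q.S h))
    (fun h g φ => by simp only [map_add, LinearMap.comp_add])
    (fun c h φ => by simp only [map_smul, LinearMap.comp_smul])
    (fun h φ ψ => LinearMap.add_comp _ _ _)
    (fun c h φ => LinearMap.smul_comp _ _ _)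

/-- The action `(h ≻ φ)(h') = φ(S⁻¹(h) ▷ h')` on `*H₀`. -/
def QuasiHopfAlgebra.rightDualAct (Q : QuasiHopfAlgebra k H) :
    H →ₗ[k] Module.Dual k H →ₗ[k] Module.Dual k H :=
  LinearMap.mk₂ k (fun h φ => φ ∘ₗ Q.adj (Q.S.symm h))
    (fun h g φ => by simp only [map_add, LinearMap.comp_add])
    (fun c h φ => by simp only [map_smul, LinearMap.comp_smul])
    (fun h φ ψ => LinearMap.add_comp _ _ _)
    (fun c h φ => LinearMap.smul_comp _ _ _)

/-- For a linear map `T` and `t = t¹ ⊗ t²`, the product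
`(φ, ψ) ↦ (h ↦ φ(T(t²) ▷ h₁) ψ(T(t¹) ▷ h₂))` on the dual of `H₀`, where `Δ(h) = h₁ ⊗ h₂` is the
comultiplication of `H₀`. -/
def RMatrix.dualMul (T : H →ₗ[k] H) (t : H ⊗[k] H) :
    Module.Dual k H →ₗ[k] Module.Dual k H →ₗ[k] Module.Dual k H :=
  LinearMap.mk₂ k
    (fun φ ψ => sw t fun t₁ t₂ => LinearMap.mul' k k ∘ₗ
      TensorProduct.map (φ ∘ₗ Q.adj (T t₂)) (ψ ∘ₗ Q.adj (T t₁)) ∘ₗ 𝓡.comulH₀)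
    (fun φ φ' ψ => by
      simp only [LinearMap.add_comp, TensorProduct.map_add_left, LinearMap.comp_add, sw_add_right])
    (fun c φ ψ => by
      simp only [LinearMap.smul_comp, TensorProduct.map_smul_left, LinearMap.comp_smul,
        sw_smul_right])
    (fun φ ψ ψ' => by
      simp only [LinearMap.add_comp, TensorProduct.map_add_right, LinearMap.comp_add,
        sw_add_right])
    (fun c φ ψ => by
      simp only [LinearMap.smul_comp, TensorProduct.map_smul_right, LinearMap.comp_smul,
        sw_smul_right])

/-- For a linear map `T` and `t = t¹ ⊗ t²`, the coproduct
`φ ↦ ∑ᵢⱼ φ((T(t²) ▷ eᵢ) ∘ (T(t¹) ▷ eⱼ)) eⁱ ⊗ eʲ` on the dual of `H₀`. -/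
def QuasiHopfAlgebra.dualComul [FiniteDimensional k H] (Q : QuasiHopfAlgebra k H)
    (T : H →ₗ[k] H) (t : H ⊗[k] H) :
    Module.Dual k H →ₗ[k] Module.Dual k H ⊗[k] Module.Dual k H where
  toFun φ := ∑ i, ∑ j,
    (sw t fun t₁ t₂ => φ (Q.circ (Q.adj (T t₂) (Module.finBasis k H i))
      (Q.adj (T t₁) (Module.finBasis k H j)))) •
    ((Module.finBasis k H).coord i ⊗ₜ[k] (Module.finBasis k H).coord j)
  map_add' φ ψ := by
    simp only [LinearMap.add_apply, sw_add_right, add_smul, Finset.sum_add_distrib]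
  map_smul' c φ := by
    simp only [LinearMap.smul_apply, sw_smul_right, smul_assoc, Finset.smul_sum, RingHom.id_apply]

/-- The left dual `H₀*` of `H₀`:
`(φ ∘ ψ)(h) = φ(f²R̄² ▷ h₁) ψ(f¹R̄¹ ▷ h₂)` with `R⁻¹ = R̄¹ ⊗ R̄²`, unit `ε`,
`Δ(φ) = ∑ φ((R²g² ▷ eᵢ) ∘ (R¹g¹ ▷ eⱼ)) eⁱ ⊗ eʲ`, counit `φ ↦ φ(β)`, antipode `φ ↦ φ ∘ S_{H₀}`,
action `h ↦ φ` and coaction `φ ↦ R² ⊗ (R¹ ↦ φ)`. -/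
def RMatrix.leftDualH₀ [FiniteDimensional k H] : BraidedHopfData k H (Module.Dual k H) where
  act := Q.leftDualAct
  coact := 𝓡.coact Q.leftDualAct
  mul := 𝓡.dualMul LinearMap.id (Q.f * 𝓡.R⁻¹.val)
  one := Q.ε.toLinearMap
  comul := Q.dualComul LinearMap.id (𝓡.R.val * Q.g)
  counit := LinearMap.applyₗ Q.β
  antipode := Module.Dual.transpose 𝓡.antipodeH₀

/-- The right dual `*H₀` of `H₀`:
`(φ ∘ ψ)(h) = φ(S⁻¹(f²R̄²) ▷ h₁) ψ(S⁻¹(f¹R̄¹) ▷ h₂)`, unit `ε`,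
`Δ(φ) = ∑ φ((S⁻¹(R²g²) ▷ eᵢ) ∘ (S⁻¹(R¹g¹) ▷ eⱼ)) eⁱ ⊗ eʲ`, counit `φ ↦ φ(β)`,
antipode `φ ↦ φ ∘ S_{H₀}`, action `h ≻ φ` and coaction `φ ↦ R² ⊗ (R¹ ≻ φ)`. -/
def RMatrix.rightDualH₀ [FiniteDimensional k H] : BraidedHopfData k H (Module.Dual k H) where
  act := Q.rightDualAct
  coact := 𝓡.coact Q.rightDualAct
  mul := 𝓡.dualMul Q.S.symm.toLinearMap (Q.f * 𝓡.R⁻¹.val)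
  one := Q.ε.toLinearMap
  comul := Q.dualComul Q.S.symm.toLinearMap (𝓡.R.val * Q.g)
  counit := LinearMap.applyₗ Q.β
  antipode := Module.Dual.transpose 𝓡.antipodeH₀

/-- The canonical map `Θ_{H₀} : H₀* → *H₀`. -/
def RMatrix.ΘH₀ [FiniteDimensional k H] : Module.Dual k H →ₗ[k] Module.Dual k H :=
  Θ Q 𝓡.H₀.toYDData 𝓡.leftDualH₀.toYDData 𝓡.rightDualH₀.toYDData

end

end

end

end QuasiHopf

open scoped TensorProduct
open CategoryTheory MonoidalCategory

namespace QuasiHopf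

universe u v

/-! ### Duals in a monoidal category: nested pairings and uniqueness of duals -/

section Nested

universe v₁ u₁

variable {C : Type u₁} [Category.{v₁} C] [MonoidalCategory C]

/-! All the given formulas are coordinates of canonical morphisms in one category. Since $R$ is
triangular, the finite dimensional $H$-modules form a rigid symmetric monoidal category `QMod 𝓡`,
with associator $\Phi$, braiding $R$ and duals built from $S,\alpha,\beta$. The axioms of a Hopf
algebra are proved there by diagrams; Sweedler calculus serves only to identify the morphisms with
the formulas.

$H_0$ is the Hopf algebra reconstructed from this category. The adjoint module $H$ acts naturally on
every module $V$, where $a$ acts as $X^1aS(X^2)\alpha X^3$, and the mate $H\to V\otimes V^*$ of this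
action is the representation $h\mapsto(v\mapsto hv)$. Product, coproduct, counit and antipode of
$H_0$ are the maps that make the action compatible with composition, tensor products, the unit
object and duals (`rep_circ`, `map_repLin_comulH₀`, `counitHom`, `repLin_antipodeH₀`). The regular
module is faithful, so identities can be tested on modules, where they follow from naturality
(`isHopf_of_action`).

In a symmetric rigid category the dual of a Hopf monoid is a Hopf monoid (`IsHopf.dual`). To
recognize $H_0^*$ one needs the Drinfeld twist: $g$ and $f$ are the two mutually inverse comparison
maps between $(V\otimes W)^*$ and $W^*\otimes V^*$, and this yields all the identities for
$f,g,\gamma$ that are used. After the braiding has been inserted, the relevant element is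
$t=(fR^{-1})_{21}$, which satisfies $t\,\Delta(\alpha)=\gamma_{21}R$ and $t\,\Delta(S(h))=(S\otimes
S)(\Delta(h))\,t$.

A module is a Yetter–Drinfeld module through $m\mapsto R^2\otimes R^1\cdot m$, and the formula for
$(\Delta\otimes id)(R)$ says that tensor products of modules carry the coaction of the same shape.
Hence $H$-linear maps are colinear, and a Hopf monoid in modules is a braided Hopf algebra
(`isBraidedHopfAlgebra`).

The element $u$ describes the canonical morphism $V\to V^{**}$. The inverse morphism gives $u^{-1}$,
its linearity gives $uh=S^2(h)u$, and its monoidality gives $t\,\Delta(u)=(S\otimes S)(t)(u\otimes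
u)$. Evaluating $\Theta_{H_0}$ on dual bases shows that it is precomposition with the adjoint action
of $w=S^{-1}(u^{-1})$, that is $u^{-1}\succ$. The three properties of $u$, rewritten for $w$,
together with $\varepsilon(w)=1$ and the $H$-linearity of $\underline S$, say that $\Theta_{H_0}$
respects all structure maps; transport along it then makes ${}^*H_0$ a braided Hopf algebra. -/

theorem nested_evaluation (V W D E : C) [ExactPairing V D] [ExactPairing W E] :
    ε_ (V ⊗ W) (E ⊗ D) = (α_ (E ⊗ D) V W).inv ≫
      ((α_ E D V).hom ≫ E ◁ ε_ V D ≫ (ρ_ E).hom) ▷ W ≫ ε_ W E := by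
  rw [ExactPairing.tensor_evaluation]; monoidal

/-- The bracketing is chosen so that, in modules, the two associators produce exactly the element
$B$ in the definition of $\delta$; the companion form of the evaluation produces the element $A$ of
$\gamma$. -/
theorem nested_coevaluation (V W D E : C) [ExactPairing V D] [ExactPairing W E] :
    η_ (V ⊗ W) (E ⊗ D) = η_ V D ≫
      ((ρ_ V).inv ≫ V ◁ η_ W E ≫ (α_ V W E).inv) ▷ D ≫ (α_ (V ⊗ W) E D).hom := by
  rw [ExactPairing.tensor_coevaluation]; monoidal

/-- The comparison of two duals of the same object. -/
def dualComparison (X Y Y' : C) [ExactPairing X Y] [ExactPairing X Y'] : Y ⟶ Y' :=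
  (ρ_ Y).inv ≫ Y ◁ η_ X Y' ≫ (α_ Y X Y').inv ≫ ε_ X Y ▷ Y' ≫ (λ_ Y').hom

theorem dualComparison_evaluation (X Y Y' : C) [ExactPairing X Y] [ExactPairing X Y'] :
    dualComparison X Y Y' ▷ X ≫ ε_ X Y' = ε_ X Y := by
  calc
    _ = 𝟙 _ ⊗≫ Y ◁ (η_ X Y' ▷ X) ⊗≫ (ε_ X Y ▷ (Y' ⊗ X) ≫ 𝟙_ C ◁ ε_ X Y') ⊗≫ 𝟙 _ := by
      simp only [dualComparison]; monoidal
    _ = 𝟙 _ ⊗≫ Y ◁ (η_ X Y' ▷ X ⊗≫ X ◁ ε_ X Y') ⊗≫ ε_ X Y := by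
      rw [← whisker_exchange]; monoidal
    _ = _ := by rw [ExactPairing.evaluation_coevaluation'']; monoidal

/-- Bending the wire $X$ back with the coevaluation recovers a morphism into the dual from its
pairing with $X$. -/
theorem eq_of_evaluation {X Y Z : C} [ExactPairing X Y] {f g : Z ⟶ Y}
    (h : f ▷ X ≫ ε_ X Y = g ▷ X ≫ ε_ X Y) : f = g := by
  have key : ∀ f : Z ⟶ Y, f = (ρ_ Z).inv ≫ Z ◁ η_ X Y ≫ (α_ Z X Y).inv ≫
      (f ▷ X ≫ ε_ X Y) ▷ Y ≫ (λ_ Y).hom := by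
    intro f
    symm
    calc
      _ = 𝟙 Z ⊗≫ (Z ◁ η_ X Y ≫ f ▷ (X ⊗ Y)) ⊗≫ ε_ X Y ▷ Y ⊗≫ 𝟙 Y := by monoidal
      _ = f ⊗≫ (Y ◁ η_ X Y ⊗≫ ε_ X Y ▷ Y) ⊗≫ 𝟙 Y := by rw [whisker_exchange]; monoidal
      _ = f := by rw [ExactPairing.coevaluation_evaluation'']; monoidal
  rw [key f, key g, h]

theorem dualComparison_comp (X Y Y' : C) [ExactPairing X Y] [ExactPairing X Y'] :
    dualComparison X Y Y' ≫ dualComparison X Y' Y = 𝟙 Y := by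
  apply eq_of_evaluation (X := X)
  rw [comp_whiskerRight, Category.assoc, dualComparison_evaluation, dualComparison_evaluation,
    id_whiskerRight, Category.id_comp]

end Nested

/-! ### Symmetric monoidal categories: Hopf monoids, mates and interchange -/

section Abstract

universe v₁ u₁

set_option linter.unusedSectionVars false
variable {C : Type u₁} [Category.{v₁} C] [MonoidalCategory C] [SymmetricCategory C]

/-- `X` with the given structure morphisms is a Hopf monoid. -/
structure IsHopf {X : C} (m : X ⊗ X ⟶ X) (η : 𝟙_ C ⟶ X) (Δ : X ⟶ X ⊗ X) (ε : X ⟶ 𝟙_ C)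
    (S : X ⟶ X) : Prop where
  mul_assoc : m ▷ X ≫ m = (α_ X X X).hom ≫ X ◁ m ≫ m
  one_mul : η ▷ X ≫ m = (λ_ X).hom
  mul_one : X ◁ η ≫ m = (ρ_ X).hom
  comul_assoc : Δ ≫ Δ ▷ X ≫ (α_ X X X).hom = Δ ≫ X ◁ Δ
  counit_left : Δ ≫ ε ▷ X ≫ (λ_ X).hom = 𝟙 X
  counit_right : Δ ≫ X ◁ ε ≫ (ρ_ X).hom = 𝟙 X
  comul_mul : m ≫ Δ = (Δ ⊗ₘ Δ) ≫ tensorμ X X X X ≫ (m ⊗ₘ m)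
  comul_one : η ≫ Δ = (λ_ (𝟙_ C)).inv ≫ (η ⊗ₘ η)
  counit_mul : m ≫ ε = (ε ⊗ₘ ε) ≫ (λ_ (𝟙_ C)).hom
  counit_one : η ≫ ε = 𝟙 (𝟙_ C)
  antipode_left : Δ ≫ S ▷ X ≫ m = ε ≫ η
  antipode_right : Δ ≫ X ◁ S ≫ m = ε ≫ η

/-- Transport of structure; it carries the Hopf structure of the left dual of $H_0$ over to the
right dual. -/
theorem IsHopf.of_iso {X Y : C} {m : X ⊗ X ⟶ X} {η : 𝟙_ C ⟶ X} {Δ : X ⟶ X ⊗ X} {ε : X ⟶ 𝟙_ C}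
    {S : X ⟶ X} (h : IsHopf m η Δ ε S) (e : X ≅ Y) :
    IsHopf ((e.inv ⊗ₘ e.inv) ≫ m ≫ e.hom) (η ≫ e.hom) (e.inv ≫ Δ ≫ (e.hom ⊗ₘ e.hom))
      (e.inv ≫ ε) (e.inv ≫ S ≫ e.hom) := by
  -- These four exchange rules cancel $e$ against $e^{-1}$ in one tensor factor, which brings each
  -- conjugated axiom back to the original one.
  have hl : ∀ {Z : C} (f : Z ⟶ X), (f ≫ e.hom) ▷ Y ≫ (e.inv ⊗ₘ e.inv) = Z ◁ e.inv ≫ f ▷ X := by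
    intro Z f
    rw [MonoidalCategory.tensorHom_def, comp_whiskerRight_assoc, hom_inv_whiskerRight_assoc,
      whisker_exchange]
  have hr : ∀ {Z : C} (f : Z ⟶ X), Y ◁ (f ≫ e.hom) ≫ (e.inv ⊗ₘ e.inv) = e.inv ▷ Z ≫ X ◁ f := by
    intro Z f
    rw [MonoidalCategory.tensorHom_def', whiskerLeft_comp_assoc, whiskerLeft_hom_inv_assoc,
      whisker_exchange]
  have cl : ∀ {Z : C} (f : X ⟶ Z), (e.hom ⊗ₘ e.hom) ≫ (e.inv ≫ f) ▷ Y = f ▷ X ≫ Z ◁ e.hom := by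
    intro Z f
    rw [MonoidalCategory.tensorHom_def', comp_whiskerRight, Category.assoc,
      hom_inv_whiskerRight_assoc, whisker_exchange]
  have cr : ∀ {Z : C} (f : X ⟶ Z), (e.hom ⊗ₘ e.hom) ≫ Y ◁ (e.inv ≫ f) = X ◁ f ≫ e.hom ▷ Z := by
    intro Z f
    rw [MonoidalCategory.tensorHom_def, whiskerLeft_comp, Category.assoc,
      whiskerLeft_hom_inv_assoc, whisker_exchange]
  constructor
  · have L := reassoc_of% (hl ((e.inv ⊗ₘ e.inv) ≫ m))
    have R := reassoc_of% (hr ((e.inv ⊗ₘ e.inv) ≫ m))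
    rw [L, R, comp_whiskerRight_assoc, reassoc_of% h.mul_assoc, whiskerLeft_comp_assoc]
    simp only [← tensorHom_id, ← id_tensorHom, tensorHom_comp_tensorHom_assoc, Category.id_comp,
      Category.comp_id]
    rw [associator_naturality_assoc, tensorHom_comp_tensorHom_assoc, Category.comp_id]
  · rw [reassoc_of% hl, reassoc_of% h.one_mul]; simp
  · rw [reassoc_of% hr, reassoc_of% h.mul_one]; simp
  · have L := reassoc_of% (cl (Δ ≫ (e.hom ⊗ₘ e.hom)))
    have R := cr (Δ ≫ (e.hom ⊗ₘ e.hom))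
    simp only [Category.assoc] at L R ⊢
    rw [L, R, whiskerLeft_comp_assoc, ← reassoc_of% h.comul_assoc]
    simp only [← tensorHom_id, ← id_tensorHom, tensorHom_comp_tensorHom_assoc,
      tensorHom_comp_tensorHom, Category.id_comp, Category.comp_id, ← associator_naturality]
  · rw [Category.assoc, Category.assoc, reassoc_of% cl, leftUnitor_naturality,
      reassoc_of% h.counit_left]; simp
  · rw [Category.assoc, Category.assoc, reassoc_of% cr, rightUnitor_naturality,
      reassoc_of% h.counit_right]; simp
  · have := reassoc_of% h.comul_mul
    simp only [Category.assoc, Iso.hom_inv_id_assoc, this, ← tensorHom_comp_tensorHom]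
    simp only [tensorHom_comp_tensorHom_assoc, Iso.hom_inv_id, tensorμ_natural_assoc,
      tensorHom_comp_tensorHom, id_tensorHom_id, Category.id_comp]
  · have := reassoc_of% h.comul_one
    simp only [Category.assoc, Iso.hom_inv_id_assoc, this, tensorHom_comp_tensorHom]
  · have := h.counit_mul
    simp only [Category.assoc, Iso.hom_inv_id_assoc, this, tensorHom_comp_tensorHom_assoc]
  · simp [h.counit_one]
  · have := reassoc_of% h.antipode_left
    simp only [Category.assoc]
    rw [reassoc_of% cl, ← tensorHom_id, ← id_tensorHom, tensorHom_comp_tensorHom_assoc]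
    simp [this]
  · have := reassoc_of% h.antipode_right
    simp only [Category.assoc]
    rw [reassoc_of% cr, ← tensorHom_id, ← id_tensorHom, tensorHom_comp_tensorHom_assoc]
    simp [this]

/-- The mate of `t : A ⊗ V ⟶ W` under the duality `V ⊣ D`. -/
def mate {A V W D : C} [ExactPairing V D] (t : A ⊗ V ⟶ W) : A ⟶ W ⊗ D :=
  (ρ_ A).inv ≫ A ◁ η_ V D ≫ (α_ A V D).inv ≫ t ▷ D

/-- A zigzag. Together with `mate_unmate` it identifies morphisms $A\otimes V\to V$ with morphisms
$A\to V\otimes V^*$, the internal endomorphisms of $V$. -/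
theorem unmate {A V W D : C} [ExactPairing V D] (t : A ⊗ V ⟶ W) :
    (mate t : A ⟶ W ⊗ D) ▷ V ≫ (α_ W D V).hom ≫ W ◁ ε_ V D ≫ (ρ_ W).hom = t := by
  calc
    _ = 𝟙 _ ⊗≫ A ◁ (η_ V D ▷ V) ⊗≫ (t ▷ (D ⊗ V) ≫ W ◁ ε_ V D) ⊗≫ 𝟙 _ := by
      simp only [mate]; monoidal
    _ = 𝟙 _ ⊗≫ A ◁ (η_ V D ▷ V ⊗≫ V ◁ ε_ V D) ⊗≫ t ⊗≫ 𝟙 _ := by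
      rw [← whisker_exchange]; monoidal
    _ = _ := by rw [ExactPairing.evaluation_coevaluation'']; monoidal

theorem mate_unmate {A V W D : C} [ExactPairing V D] (π : A ⟶ W ⊗ D) :
    mate (π ▷ V ≫ (α_ W D V).hom ≫ W ◁ ε_ V D ≫ (ρ_ W).hom) = π := by
  calc
    _ = 𝟙 A ⊗≫ (A ◁ η_ V D ≫ π ▷ (V ⊗ D)) ⊗≫ W ◁ ε_ V D ▷ D ⊗≫ 𝟙 (W ⊗ D) := by
      simp only [mate]; monoidal
    _ = π ⊗≫ W ◁ (D ◁ η_ V D ⊗≫ ε_ V D ▷ D) ⊗≫ 𝟙 (W ⊗ D) := by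
      rw [whisker_exchange]; monoidal
    _ = _ := by rw [ExactPairing.coevaluation_evaluation'']; monoidal

theorem unmate_coevaluation (V D : C) [ExactPairing V D] :
    η_ V D ▷ V ≫ (α_ V D V).hom ≫ V ◁ ε_ V D ≫ (ρ_ V).hom = (λ_ V).hom := by
  simp

theorem mate_comp {A A' V W D : C} [ExactPairing V D] (f : A' ⟶ A) (t : A ⊗ V ⟶ W) :
    (mate (f ▷ V ≫ t) : A' ⟶ W ⊗ D) = f ≫ mate t := by
  simp only [mate, comp_whiskerRight]
  rw [← associator_inv_naturality_left_assoc, whisker_exchange_assoc, rightUnitor_inv_naturality_assoc]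

/-- The tensor product of two morphisms of the type of a coevaluation. -/
def tensorCoev {V V' D D' : C} (c : 𝟙_ C ⟶ V ⊗ D) (c' : 𝟙_ C ⟶ V' ⊗ D') :
    𝟙_ C ⟶ (V ⊗ V') ⊗ (D ⊗ D') :=
  (λ_ (𝟙_ C)).inv ≫ (c ⊗ₘ c') ≫ tensorδ V V' D D'

/-- The mate of `t : A ⊗ V ⟶ W` along `c : 𝟙 ⟶ V ⊗ D`. -/
def mateAlong {A V W D : C} (c : 𝟙_ C ⟶ V ⊗ D) (t : A ⊗ V ⟶ W) : A ⟶ W ⊗ D :=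
  (ρ_ A).inv ≫ A ◁ c ≫ (α_ A V D).inv ≫ t ▷ D

theorem mateAlong_comp {A A' V W D : C} (c : 𝟙_ C ⟶ V ⊗ D) (f : A' ⟶ A) (t : A ⊗ V ⟶ W) :
    mateAlong c (f ▷ V ≫ t) = f ≫ mateAlong c t := by
  simp only [mateAlong, comp_whiskerRight]
  rw [← associator_inv_naturality_left_assoc, whisker_exchange_assoc,
    rightUnitor_inv_naturality_assoc]

/-- The interchange is compatible with associators and unitors, and it is undone by `tensorδ`. No
zigzag identity for $c$ or $c'$ enters. The lemma turns an equality tested by acting on $V\otimes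
V'$ into an equality after composition with a tensor product of mates. -/
theorem mateAlong_tensor {A A' V V' W W' D D' : C} (c : 𝟙_ C ⟶ V ⊗ D) (c' : 𝟙_ C ⟶ V' ⊗ D')
    (t : A ⊗ V ⟶ W) (t' : A' ⊗ V' ⟶ W') :
    mateAlong (tensorCoev c c') (tensorμ A A' V V' ≫ (t ⊗ₘ t')) ≫ tensorμ W W' D D' =
      (mateAlong c t ⊗ₘ mateAlong c' t') := by
  have h := tensor_associativity A A' V V' D D'
  simp only [mateAlong, tensorCoev, Category.assoc]
  rw [comp_whiskerRight, Category.assoc, tensorμ_natural_left]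
  have h' : (α_ (A ⊗ A') (V ⊗ V') (D ⊗ D')).inv ≫ tensorμ A A' V V' ▷ (D ⊗ D') ≫
      tensorμ (A ⊗ V) (A' ⊗ V') D D' = (A ⊗ A') ◁ tensorμ V V' D D' ≫
        tensorμ A A' (V ⊗ D) (V' ⊗ D') ≫ ((α_ A V D).inv ⊗ₘ (α_ A' V' D').inv) := by
    rw [Iso.inv_comp_eq, ← reassoc_of% h]
    simp
  rw [reassoc_of% h']
  simp only [whiskerLeft_comp, Category.assoc]
  rw [← whiskerLeft_comp_assoc _ (tensorδ _ _ _ _), tensorδ_tensorμ, whiskerLeft_id,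
    Category.id_comp, tensorμ_natural_right_assoc]
  have := tensor_right_unitality A A'
  rw [reassoc_of% (show (ρ_ (A ⊗ A')).inv ≫ (A ⊗ A') ◁ (λ_ (𝟙_ C)).inv ≫
      tensorμ A A' (𝟙_ C) (𝟙_ C) = ((ρ_ A).inv ⊗ₘ (ρ_ A').inv) by
    rw [Iso.inv_comp_eq, this]; simp [tensorHom_comp_tensorHom])]
  simp [tensorHom_comp_tensorHom]

/-- Joint cancellation for tensor products of pairings. -/
theorem tensor_cancel {X A A' V V' W W' D D' : C} (c : 𝟙_ C ⟶ V ⊗ D) (c' : 𝟙_ C ⟶ V' ⊗ D')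
    (t : A ⊗ V ⟶ W) (t' : A' ⊗ V' ⟶ W') (f g : X ⟶ A ⊗ A')
    (h : f ▷ (V ⊗ V') ≫ tensorμ A A' V V' ≫ (t ⊗ₘ t') =
      g ▷ (V ⊗ V') ≫ tensorμ A A' V V' ≫ (t ⊗ₘ t')) :
    f ≫ (mateAlong c t ⊗ₘ mateAlong c' t') = g ≫ (mateAlong c t ⊗ₘ mateAlong c' t') := by
  rw [← mateAlong_tensor, ← Category.assoc, ← mateAlong_comp, h, mateAlong_comp, Category.assoc]

/-- Joint cancellation for threefold tensor products of pairings. -/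
theorem tensor_cancel₃ {X A A' A'' V V' V'' W W' W'' D D' D'' : C} (c : 𝟙_ C ⟶ V ⊗ D)
    (c' : 𝟙_ C ⟶ V' ⊗ D') (c'' : 𝟙_ C ⟶ V'' ⊗ D'')
    (t : A ⊗ V ⟶ W) (t' : A' ⊗ V' ⟶ W') (t'' : A'' ⊗ V'' ⟶ W'') (f g : X ⟶ A ⊗ (A' ⊗ A''))
    (h : f ▷ (V ⊗ (V' ⊗ V'')) ≫ tensorμ A (A' ⊗ A'') V (V' ⊗ V'') ≫
        (t ⊗ₘ (tensorμ A' A'' V' V'' ≫ (t' ⊗ₘ t''))) =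
      g ▷ (V ⊗ (V' ⊗ V'')) ≫ tensorμ A (A' ⊗ A'') V (V' ⊗ V'') ≫
        (t ⊗ₘ (tensorμ A' A'' V' V'' ≫ (t' ⊗ₘ t'')))) :
    f ≫ (mateAlong c t ⊗ₘ (mateAlong c' t' ⊗ₘ mateAlong c'' t'')) =
      g ≫ (mateAlong c t ⊗ₘ (mateAlong c' t' ⊗ₘ mateAlong c'' t'')) := by
  have := congrArg (· ≫ (𝟙 _ ⊗ₘ tensorμ W' W'' D' D''))
    (tensor_cancel c (tensorCoev c' c'') _ _ f g h)
  simpa only [Category.assoc, tensorHom_comp_tensorHom, Category.comp_id, mateAlong_tensor]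
    using this

/-- On the right $X_1$ and $Y_2$ cross twice, and this double crossing cancels by symmetry; a mere
braiding would not suffice. In other words, the tensor product functor is braided. -/
theorem tensorμ_braiding (X₁ X₂ Y₁ Y₂ : C) :
    tensorμ X₁ X₂ Y₁ Y₂ ≫ ((β_ X₁ Y₁).hom ⊗ₘ (β_ X₂ Y₂).hom) =
      (β_ (X₁ ⊗ X₂) (Y₁ ⊗ Y₂)).hom ≫ tensorμ Y₁ Y₂ X₁ X₂ := by
  have : Y₁ ◁ (β_ X₁ Y₂).hom ▷ X₂ ≫ Y₁ ◁ (β_ Y₂ X₁).hom ▷ X₂ = 𝟙 _ := by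
    rw [← whiskerLeft_comp, ← comp_whiskerRight, SymmetricCategory.symmetry]; simp
  simp [tensorμ, MonoidalCategory.tensorHom_def, reassoc_of% this]

theorem tensorμ_tensorμ (X₁ X₂ Y₁ Y₂ : C) :
    tensorμ X₁ X₂ Y₁ Y₂ ≫ tensorμ X₁ Y₁ X₂ Y₂ = 𝟙 _ := by
  have : X₁ ◁ (β_ X₂ Y₁).hom ▷ Y₂ ≫ X₁ ◁ (β_ Y₁ X₂).hom ▷ Y₂ = 𝟙 _ := by
    rw [← whiskerLeft_comp, ← comp_whiskerRight, SymmetricCategory.symmetry]; simp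
  simp [tensorμ, reassoc_of% this]

/-- The wire $A$ slides past the cap by naturality of the braiding; symmetry turns the crossing left
over into the one on the other side. -/
theorem braiding_evaluation (A V D : C) [ExactPairing V D] :
    (α_ D A V).hom ≫ D ◁ (β_ A V).hom ≫ (α_ D V A).inv ≫ ε_ V D ▷ A =
      (β_ D A).hom ▷ V ≫ (α_ A D V).hom ≫ A ◁ ε_ V D ≫ (ρ_ A).hom ≫ (λ_ A).inv := by
  have nat : (β_ A (D ⊗ V)).hom ≫ ε_ V D ▷ A = A ◁ ε_ V D ≫ (β_ A (𝟙_ C)).hom := by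
    rw [BraidedCategory.braiding_naturality_right]
  have inv : (β_ A D).hom = (β_ D A).inv := SymmetricCategory.braiding_swap_eq_inv_braiding _ _
  rw [BraidedCategory.braiding_tensor_right_hom, braiding_tensorUnit_right, inv] at nat
  rw [← nat]; simp

/-- Sliding $A_1$ through the inner cap converts the nested pairing into the parallel one. In
modules this is how $\gamma$ becomes $\gamma_{21}R$. -/
theorem braid_nested_evaluation (A₁ A₂ B₁ B₂ : C) [ExactPairing A₁ B₁] [ExactPairing A₂ B₂] :
    (B₁ ⊗ B₂) ◁ (β_ A₁ A₂).hom ≫ ε_ (A₂ ⊗ A₁) (B₁ ⊗ B₂) =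
      tensorμ B₁ B₂ A₁ A₂ ≫ (ε_ A₁ B₁ ⊗ₘ ε_ A₂ B₂) ≫ (λ_ (𝟙_ C)).hom := by
  rw [ExactPairing.tensor_evaluation]
  calc
    _ = 𝟙 ((B₁ ⊗ B₂) ⊗ A₁ ⊗ A₂) ⊗≫ B₁ ◁ ((α_ B₂ A₁ A₂).hom ≫ B₂ ◁ (β_ A₁ A₂).hom ≫
          (α_ B₂ A₂ A₁).inv ≫ ε_ A₂ B₂ ▷ A₁) ⊗≫ ε_ A₁ B₁ := by monoidal
    _ = 𝟙 ((B₁ ⊗ B₂) ⊗ A₁ ⊗ A₂) ⊗≫ B₁ ◁ (β_ B₂ A₁).hom ▷ A₂ ⊗≫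
          ((B₁ ⊗ A₁) ◁ ε_ A₂ B₂ ≫ ε_ A₁ B₁ ▷ (𝟙_ C)) ⊗≫ 𝟙 (𝟙_ C) := by
      rw [braiding_evaluation]; monoidal
    _ = _ := by rw [whisker_exchange, tensorμ, MonoidalCategory.tensorHom_def]; monoidal

/-- The canonical isomorphism `(V ⊗ W) ⊗ (W* ⊗ V*) ⟶ (V ⊗ V*) ⊗ (W ⊗ W*)`. -/
def endTensor (V W V' W' : C) : (V ⊗ W) ⊗ (W' ⊗ V') ⟶ (V ⊗ V') ⊗ (W ⊗ W') :=
  (α_ V W (W' ⊗ V')).hom ≫ V ◁ ((α_ W W' V').inv ≫ (β_ (W ⊗ W') V').hom) ≫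
    (α_ V V' (W ⊗ W')).inv

/-- The block $W\otimes W'$ slides past the cap of $V$, by naturality of the braiding with respect
to that evaluation. So `endTensor` sends an endomorphism of $V\otimes W$ to the pair of wires that
acts on $V$ and $W$ in parallel. -/
theorem endTensor_evaluation (V W V' W' : C) [ExactPairing V V'] [ExactPairing W W'] :
    endTensor V W V' W' ▷ (V ⊗ W) ≫ tensorμ (V ⊗ V') (W ⊗ W') V W ≫
      (((α_ V V' V).hom ≫ V ◁ ε_ V V' ≫ (ρ_ V).hom) ⊗ₘ
        ((α_ W W' W).hom ≫ W ◁ ε_ W W' ≫ (ρ_ W).hom)) =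
    (α_ _ _ _).hom ≫ (V ⊗ W) ◁ ε_ (V ⊗ W) (W' ⊗ V') ≫ (ρ_ (V ⊗ W)).hom := by
  have nat : (β_ (W ⊗ W') (V' ⊗ V)).hom ≫ ε_ V V' ▷ (W ⊗ W') =
    (W ⊗ W') ◁ ε_ V V' ≫ (β_ (W ⊗ W') (𝟙_ C)).hom := by
    rw [BraidedCategory.braiding_naturality_right]
  rw [BraidedCategory.braiding_tensor_right_hom, braiding_tensorUnit_right] at nat
  rw [ExactPairing.tensor_evaluation]
  simp only [endTensor, tensorμ, MonoidalCategory.tensorHom_def]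
  calc
    _ = 𝟙 (((V ⊗ W) ⊗ (W' ⊗ V')) ⊗ (V ⊗ W)) ⊗≫ V ◁ (((α_ (W ⊗ W') V' V).inv ≫
        (β_ (W ⊗ W') V').hom ▷ V ≫ (α_ V' (W ⊗ W') V).hom ≫ V' ◁ (β_ (W ⊗ W') V).hom ≫
          (α_ V' V (W ⊗ W')).inv) ≫ ε_ V V' ▷ (W ⊗ W')) ▷ W ⊗≫ V ◁ W ◁ ε_ W W' ⊗≫
          𝟙 (V ⊗ W) := by
      monoidal
    _ = _ := by
      simp only [Category.assoc] at nat ⊢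
      rw [nat]; monoidal

/-- A morphism built from an endomorphism of the dual by bending wires. -/
theorem transpose_evaluation {A V D : C} [ExactPairing V D] (a : A ⊗ D ⟶ D) :
    D ◁ (((ρ_ A).inv ≫ A ◁ η_ V D ≫ (α_ A V D).inv ≫ (β_ A V).hom ▷ D ≫ (α_ V A D).hom ≫ V ◁ a) ▷ V
      ≫ (α_ V D V).hom ≫ V ◁ ε_ V D ≫ (ρ_ V).hom) ≫ ε_ V D =
    (α_ D A V).inv ≫ (β_ D A).hom ▷ V ≫ a ▷ V ≫ ε_ V D := by
  calc
    _ = 𝟙 (D ⊗ (A ⊗ V)) ⊗≫ D ◁ A ◁ η_ V D ▷ V ⊗≫ D ◁ (β_ A V).hom ▷ D ▷ V ⊗≫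
        ((D ⊗ V) ◁ (a ▷ V ≫ ε_ V D) ≫ ε_ V D ▷ 𝟙_ C) ⊗≫ 𝟙 (𝟙_ C) := by monoidal
    _ = 𝟙 (D ⊗ (A ⊗ V)) ⊗≫ D ◁ A ◁ η_ V D ▷ V ⊗≫ ((α_ D A V).hom ≫ D ◁ (β_ A V).hom ≫
        (α_ D V A).inv ≫ ε_ V D ▷ A) ▷ D ▷ V ⊗≫ (a ▷ V ≫ ε_ V D) ⊗≫ 𝟙 (𝟙_ C) := by
      rw [whisker_exchange]; monoidal
    _ = 𝟙 (D ⊗ (A ⊗ V)) ⊗≫ ((D ⊗ A) ◁ η_ V D ≫ (β_ D A).hom ▷ (V ⊗ D)) ▷ V ⊗≫ (A ◁ ε_ V D) ▷ (D ⊗ V)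
        ⊗≫ (a ▷ V ≫ ε_ V D) ⊗≫ 𝟙 (𝟙_ C) := by
      rw [braiding_evaluation]; monoidal
    _ = 𝟙 (D ⊗ (A ⊗ V)) ⊗≫ (β_ D A).hom ▷ V ⊗≫ A ◁ (D ◁ η_ V D ⊗≫ ε_ V D ▷ D) ▷ V ⊗≫
        (a ▷ V ≫ ε_ V D) ⊗≫ 𝟙 (𝟙_ C) := by
      rw [whisker_exchange]; monoidal
    _ = _ := by
      rw [ExactPairing.coevaluation_evaluation'']; monoidal

theorem eq_of_whiskerLeft_evaluation {X V D : C} [ExactPairing V D] (f g : X ⟶ V)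
    (h : D ◁ f ≫ ε_ V D = D ◁ g ≫ ε_ V D) : f = g := by
  have key : ∀ f : X ⟶ V, f = (λ_ X).inv ≫ η_ V D ▷ X ≫ (α_ V D X).hom ≫ V ◁ (D ◁ f ≫ ε_ V D) ≫
      (ρ_ V).hom := by
    intro f
    symm
    calc
      _ = 𝟙 X ⊗≫ (η_ V D ▷ X ≫ (V ⊗ D) ◁ f) ⊗≫ V ◁ ε_ V D ⊗≫ 𝟙 V := by monoidal
      _ = f ⊗≫ (η_ V D ▷ V ⊗≫ V ◁ ε_ V D) ⊗≫ 𝟙 V := by rw [← whisker_exchange]; monoidal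
      _ = f := by rw [ExactPairing.evaluation_coevaluation'']; monoidal
  rw [key f, key g, h]

theorem eq_mate_action {A V D : C} [ExactPairing V D] (t : A ⊗ V ⟶ V) :
    t = (mate t : A ⟶ V ⊗ D) ▷ V ≫ (α_ V D V).hom ≫ V ◁ ε_ V D ≫ (ρ_ V).hom := (unmate t).symm

/-- The composition of endomorphisms, `(V ⊗ V*) ⊗ (V ⊗ V*) ⟶ V ⊗ V*`. -/
def endMul (V D : C) [ExactPairing V D] : (V ⊗ D) ⊗ (V ⊗ D) ⟶ V ⊗ D :=
  (α_ V D (V ⊗ D)).hom ≫ V ◁ ((α_ D V D).inv ≫ ε_ V D ▷ D ≫ (λ_ D).hom)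

/-- An action is the same as a multiplicative map to the internal endomorphisms: `endMul` followed
by evaluation acts twice. -/
theorem action_mul_of_mate {A V D : C} [ExactPairing V D] (t : A ⊗ V ⟶ V) (m : A ⊗ A ⟶ A)
    (h : m ≫ (mate t : A ⟶ V ⊗ D) = ((mate t : A ⟶ V ⊗ D) ⊗ₘ mate t) ≫ endMul V D) :
    m ▷ V ≫ t = (α_ A A V).hom ≫ A ◁ t ≫ t := by
  have e : endMul V D ▷ V ≫ (α_ V D V).hom ≫ V ◁ ε_ V D ≫ (ρ_ V).hom =
      (α_ _ _ _).hom ≫ (V ⊗ D) ◁ ((α_ V D V).hom ≫ V ◁ ε_ V D ≫ (ρ_ V).hom) ≫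
        (α_ V D V).hom ≫ V ◁ ε_ V D ≫ (ρ_ V).hom := by
    calc
      _ = 𝟙 _ ⊗≫ V ◁ (ε_ V D ▷ (D ⊗ V) ≫ 𝟙_ C ◁ ε_ V D) ⊗≫ 𝟙 V := by
        simp only [endMul]; monoidal
      _ = _ := by rw [← whisker_exchange]; monoidal
  conv_lhs => rw [eq_mate_action (D := D) t]
  rw [← comp_whiskerRight_assoc, h, comp_whiskerRight_assoc, e, MonoidalCategory.tensorHom_def',
    comp_whiskerRight_assoc, associator_naturality_left_assoc, ← whisker_exchange_assoc, unmate,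
    associator_naturality_middle_assoc, ← whiskerLeft_comp_assoc, unmate]

/-- The dual $T$ of $V\otimes W$ is arbitrary, and $i$ compares it with $E\otimes D$. This freedom
brings the Drinfeld twist into the coproduct. -/
theorem action_comul_of_mate {A V W D E T : C} [ExactPairing V D] [ExactPairing W E]
    [ExactPairing (V ⊗ W) T] (t : A ⊗ V ⟶ V) (t' : A ⊗ W ⟶ W) (t'' : A ⊗ (V ⊗ W) ⟶ V ⊗ W)
    (Δ : A ⟶ A ⊗ A) (i : T ⟶ E ⊗ D)
    (hi : i ▷ (V ⊗ W) ≫ ε_ (V ⊗ W) (E ⊗ D) = ε_ (V ⊗ W) T)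
    (h : Δ ≫ ((mate t : A ⟶ V ⊗ D) ⊗ₘ (mate t' : A ⟶ W ⊗ E)) =
      (mate t'' : A ⟶ (V ⊗ W) ⊗ T) ≫ (V ⊗ W) ◁ i ≫ endTensor V W D E) :
    Δ ▷ (V ⊗ W) ≫ tensorμ A A V W ≫ (t ⊗ₘ t') = t'' := by
  conv_lhs => rw [eq_mate_action (D := D) t, eq_mate_action (D := E) t']
  rw [← tensorHom_comp_tensorHom, ← tensorμ_natural_left_assoc, ← comp_whiskerRight_assoc, h,
    comp_whiskerRight_assoc, comp_whiskerRight_assoc, endTensor_evaluation,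
    associator_naturality_middle_assoc, ← whiskerLeft_comp_assoc, hi, unmate]

/-! ### Reconstruction of a Hopf monoid from a universal natural action -/

section Reconstruction

variable {A : C} (θ : ∀ V : C, A ⊗ V ⟶ V)
  (nat : ∀ {V W : C} (f : V ⟶ W), A ◁ f ≫ θ W = θ V ≫ f)
  {m : A ⊗ A ⟶ A} {η : 𝟙_ C ⟶ A} {Δ : A ⟶ A ⊗ A} {ε : A ⟶ 𝟙_ C} {S : A ⟶ A}
  (hm : ∀ V, m ▷ V ≫ θ V = (α_ A A V).hom ≫ A ◁ θ V ≫ θ V)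
  (hη : ∀ V, η ▷ V ≫ θ V = (λ_ V).hom)
  (hΔ : ∀ V W, Δ ▷ (V ⊗ W) ≫ tensorμ A A V W ≫ (θ V ⊗ₘ θ W) = θ (V ⊗ W))
  (hε : θ (𝟙_ C) = (ρ_ A).hom ≫ ε)

include nat hm hΔ in
-- Acting on $V\otimes W$ twice through the coproduct is acting twice on each factor; naturality of
-- $\theta$ is applied to $\theta_V\otimes\theta_W$ after the wires have been regrouped.
theorem action_comul_mul (V W : C) :
    (m ≫ Δ) ▷ (V ⊗ W) ≫ tensorμ A A V W ≫ (θ V ⊗ₘ θ W) =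
    ((Δ ⊗ₘ Δ) ≫ tensorμ A A A A ≫ (m ⊗ₘ m)) ▷ (V ⊗ W) ≫ tensorμ A A V W ≫ (θ V ⊗ₘ θ W) := by
  rw [comp_whiskerRight_assoc, hΔ, hm, comp_whiskerRight, comp_whiskerRight]
  simp only [Category.assoc]
  rw [tensorμ_natural_left_assoc, tensorHom_comp_tensorHom, hm, hm, ← tensorHom_comp_tensorHom,
    tensor_associativity_assoc, ← tensorHom_comp_tensorHom, ← tensorμ_natural_right_assoc]
  rw [MonoidalCategory.tensorHom_def', comp_whiskerRight_assoc, associator_naturality_left_assoc,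
    ← whisker_exchange_assoc, ← whisker_exchange_assoc, associator_naturality_middle_assoc, hΔ,
    ← whiskerLeft_comp_assoc, ← whiskerLeft_comp_assoc, Category.assoc, hΔ]

include nat hΔ in
-- Both sides are the action on the threefold tensor product, on one side conjugated by the
-- associator; naturality of $\theta$ with respect to the associator removes the conjugation.
theorem action_comul_assoc (U V W : C) :
    (Δ ≫ Δ ▷ A ≫ (α_ A A A).hom) ▷ (U ⊗ (V ⊗ W)) ≫ tensorμ A (A ⊗ A) U (V ⊗ W) ≫
        (θ U ⊗ₘ (tensorμ A A V W ≫ (θ V ⊗ₘ θ W))) =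
      (Δ ≫ A ◁ Δ) ▷ (U ⊗ (V ⊗ W)) ≫ tensorμ A (A ⊗ A) U (V ⊗ W) ≫
        (θ U ⊗ₘ (tensorμ A A V W ≫ (θ V ⊗ₘ θ W))) := by
  have r : (Δ ≫ A ◁ Δ) ▷ (U ⊗ (V ⊗ W)) ≫ tensorμ A (A ⊗ A) U (V ⊗ W) ≫
        (θ U ⊗ₘ (tensorμ A A V W ≫ (θ V ⊗ₘ θ W))) = θ (U ⊗ (V ⊗ W)) := by
    rw [comp_whiskerRight_assoc, ← id_tensorHom, tensorμ_natural_left_assoc,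
      tensorHom_comp_tensorHom, hΔ]
    simp only [id_whiskerRight, Category.id_comp, hΔ]
  have l : (α_ A A A).hom ▷ (U ⊗ (V ⊗ W)) ≫ tensorμ A (A ⊗ A) U (V ⊗ W) ≫
      (A ⊗ U) ◁ tensorμ A A V W = ((A ⊗ A) ⊗ A) ◁ (α_ U V W).inv ≫ tensorμ (A ⊗ A) A (U ⊗ V) W ≫
        tensorμ A A U V ▷ (A ⊗ W) ≫ (α_ (A ⊗ U) (A ⊗ V) (A ⊗ W)).hom := by
    rw [associator_monoidal, MonoidalCategory.tensorHom_def']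
    simp only [Category.assoc, whiskerLeft_inv_hom_assoc]
  have e : (θ U ⊗ₘ (tensorμ A A V W ≫ (θ V ⊗ₘ θ W))) = (A ⊗ U) ◁ tensorμ A A V W ≫
      (θ U ⊗ₘ (θ V ⊗ₘ θ W)) := by
    rw [← id_tensorHom, tensorHom_comp_tensorHom, Category.id_comp]
  rw [r, e, comp_whiskerRight_assoc, comp_whiskerRight_assoc, reassoc_of% l, ← associator_naturality,
    ← whisker_exchange_assoc, ← whisker_exchange_assoc, ← tensorHom_id Δ A,
    tensorμ_natural_left_assoc, ← tensorHom_id (tensorμ A A U V), tensorHom_comp_tensorHom_assoc,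
    tensorHom_comp_tensorHom_assoc]
  simp only [Category.assoc, hΔ, id_whiskerRight, Category.id_comp]
  rw [reassoc_of% (hΔ (U ⊗ V) W), reassoc_of% (nat (α_ U V W).inv)]
  simp

variable {D : C → C} [∀ V, ExactPairing V (D V)]
  (hS : ∀ V, S ≫ mate (D := D V) (θ V) = (ρ_ A).inv ≫ A ◁ η_ V (D V) ≫ (α_ A V (D V)).inv ≫
    (β_ A V).hom ▷ D V ≫ (α_ V A (D V)).hom ≫ V ◁ θ (D V))

include nat hm hη hΔ hε hS in
-- Paired with $V^*$, the antipode becomes the action on $V^*$. The coproduct then assembles the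
-- action on $V^*\otimes V$, and naturality with respect to the evaluation replaces it by the action
-- on the unit object, which is $\varepsilon$.
theorem action_antipode_left (V : C) :
    (Δ ≫ S ▷ A ≫ m) ▷ V ≫ θ V = (ε ≫ η) ▷ V ≫ θ V := by
  apply eq_of_whiskerLeft_evaluation (D := D V)
  have h1 : D V ◁ (S ▷ V ≫ θ V) ≫ ε_ V (D V) =
      (α_ (D V) A V).inv ≫ (β_ (D V) A).hom ▷ V ≫ θ (D V) ▷ V ≫ ε_ V (D V) := by
    rw [← transpose_evaluation, ← hS, ← mate_comp, unmate]
  have h2 : (Δ ≫ S ▷ A ≫ m) ▷ V ≫ θ V = (Δ ▷ V ≫ (α_ A A V).hom ≫ A ◁ θ V) ≫ S ▷ V ≫ θ V := by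
    rw [comp_whiskerRight_assoc, comp_whiskerRight_assoc, hm, associator_naturality_left_assoc,
      ← whisker_exchange_assoc]
    simp only [Category.assoc]
  have h3 : D V ◁ (Δ ▷ V ≫ (α_ A A V).hom ≫ A ◁ θ V) ≫ (α_ (D V) A V).inv ≫
      (β_ (D V) A).hom ▷ V ≫ θ (D V) ▷ V = (α_ (D V) A V).inv ≫ (β_ (D V) A).hom ▷ V ≫
        (α_ A (D V) V).hom ≫ θ (D V ⊗ V) := by
    rw [← hΔ]
    have e : (β_ (D V) A).hom ▷ V ≫ (α_ A (D V) V).hom ≫ Δ ▷ (D V ⊗ V) =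
        (D V ◁ Δ) ▷ V ≫ (β_ (D V) (A ⊗ A)).hom ▷ V ≫ (α_ (A ⊗ A) (D V) V).hom := by
      rw [← comp_whiskerRight_assoc, BraidedCategory.braiding_naturality_right]
      simp
    have c : (β_ A (D V)).hom = (β_ (D V) A).inv :=
      SymmetricCategory.braiding_swap_eq_inv_braiding _ _
    rw [reassoc_of% e, BraidedCategory.braiding_tensor_right_hom, tensorμ, c]
    rw [MonoidalCategory.tensorHom_def']
    calc
      _ = 𝟙 (D V ⊗ A ⊗ V) ⊗≫ D V ◁ Δ ▷ V ⊗≫ ((D V ⊗ A) ◁ θ V ≫ (β_ (D V) A).hom ▷ V) ⊗≫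
          θ (D V) ▷ V ⊗≫ 𝟙 (D V ⊗ V) := by monoidal
      _ = 𝟙 (D V ⊗ A ⊗ V) ⊗≫ D V ◁ Δ ▷ V ⊗≫ ((β_ (D V) A).hom ▷ A) ▷ V ⊗≫ A ◁ ((β_ (D V) A).hom ≫ (β_ (D V) A).inv) ▷ V ⊗≫ (A ⊗ D V) ◁ θ V ⊗≫
          θ (D V) ▷ V ⊗≫ 𝟙 (D V ⊗ V) := by rw [whisker_exchange, Iso.hom_inv_id]; monoidal
      _ = _ := by monoidal
  have h5 := nat (ε_ V (D V))
  rw [h2, whiskerLeft_comp_assoc, h1, reassoc_of% h3, ← h5, hε, comp_whiskerRight_assoc, hη]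
  calc
    _ = 𝟙 (D V ⊗ A ⊗ V) ⊗≫ (β_ (D V) A).hom ▷ V ⊗≫ (A ◁ ε_ V (D V) ≫ ε ▷ 𝟙_ C) ⊗≫ 𝟙 (𝟙_ C) := by
      monoidal
    _ = 𝟙 (D V ⊗ A ⊗ V) ⊗≫ ((β_ (D V) A).hom ≫ ε ▷ D V) ▷ V ⊗≫ ε_ V (D V) := by
      rw [whisker_exchange]; monoidal
    _ = _ := by
      rw [← BraidedCategory.braiding_naturality_right, braiding_tensorUnit_right]; monoidal

include nat hm hη hΔ hε hS in
theorem action_antipode_right (V : C) :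
    -- Mirror argument with the coevaluation: after passing to mates the composite is the action on
    -- $V\otimes V^*$ applied to the coevaluation of $V$.
    (Δ ≫ A ◁ S ≫ m) ▷ V ≫ θ V = (ε ≫ η) ▷ V ≫ θ V := by
  have mate_mul : m ≫ mate (D := D V) (θ V) =
      A ◁ mate (D := D V) (θ V) ≫ (α_ A V (D V)).inv ≫ θ V ▷ D V := by
    rw [← mate_comp, hm]
    simp only [mate]
    monoidal
  have h1 : (Δ ≫ A ◁ S ≫ m) ≫ mate (D := D V) (θ V) = (ε ≫ η) ≫ mate (D := D V) (θ V) := by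
    have e1 : η ≫ mate (D := D V) (θ V) = η_ V (D V) := by
      rw [← mate_comp, hη]; simp only [mate]; monoidal
    have e2 : A ◁ ((ρ_ A).inv ≫ A ◁ η_ V (D V) ≫ (α_ A V (D V)).inv ≫
        (β_ A V).hom ▷ D V ≫ (α_ V A (D V)).hom ≫ V ◁ θ (D V)) ≫ (α_ A V (D V)).inv ≫ θ V ▷ D V =
        (ρ_ (A ⊗ A)).inv ≫ (A ⊗ A) ◁ η_ V (D V) ≫ tensorμ A A V (D V) ≫ (θ V ⊗ₘ θ (D V)) := by
      rw [MonoidalCategory.tensorHom_def']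
      simp only [tensorμ]
      monoidal
    simp only [Category.assoc]
    rw [e1, mate_mul, ← whiskerLeft_comp_assoc, hS, e2, rightUnitor_inv_naturality_assoc,
      ← whisker_exchange_assoc, hΔ, nat, hε]
    simp
  rw [← unmate (D := D V) (θ V), ← comp_whiskerRight_assoc, h1, comp_whiskerRight_assoc]

include nat hm hη hΔ hε hS in
/-- An object with a universal natural action is a Hopf monoid. -/
theorem isHopf_of_action
    (U₁ : ∀ {X : C} (f g : X ⟶ A), (∀ V, f ▷ V ≫ θ V = g ▷ V ≫ θ V) → f = g)
    (U₂ : ∀ {X : C} (f g : X ⟶ A ⊗ A), (∀ V W, f ▷ (V ⊗ W) ≫ tensorμ A A V W ≫ (θ V ⊗ₘ θ W) =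
      g ▷ (V ⊗ W) ≫ tensorμ A A V W ≫ (θ V ⊗ₘ θ W)) → f = g)
    (U₃ : ∀ {X : C} (f g : X ⟶ A ⊗ (A ⊗ A)), (∀ U V W,
      f ▷ (U ⊗ (V ⊗ W)) ≫ tensorμ A (A ⊗ A) U (V ⊗ W) ≫
        (θ U ⊗ₘ (tensorμ A A V W ≫ (θ V ⊗ₘ θ W))) =
      g ▷ (U ⊗ (V ⊗ W)) ≫ tensorμ A (A ⊗ A) U (V ⊗ W) ≫
        (θ U ⊗ₘ (tensorμ A A V W ≫ (θ V ⊗ₘ θ W)))) → f = g) :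
    IsHopf m η Δ ε S where
  mul_assoc := U₁ _ _ fun V => by
    simp only [comp_whiskerRight, Category.assoc, hm]
    rw [associator_naturality_left_assoc, ← whisker_exchange_assoc, hm,
      associator_naturality_middle_assoc, ← whiskerLeft_comp_assoc, hm]
    simp
  one_mul := U₁ _ _ fun V => by
    rw [comp_whiskerRight_assoc, hm, associator_naturality_left_assoc, ← whisker_exchange_assoc, hη]
    simp
  mul_one := U₁ _ _ fun V => by
    rw [comp_whiskerRight_assoc, hm, associator_naturality_middle_assoc, ← whiskerLeft_comp_assoc,
      hη]
    simp
  comul_assoc := U₃ _ _ fun U V W => action_comul_assoc θ nat hΔ U V W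
  counit_left := U₁ _ _ fun V => by
    -- The action on $\mathbb 1\otimes V$ is computed twice: by naturality it is the action on $V$,
    -- and by the coproduct it is $\varepsilon$ on the first leg and $\theta_V$ on the second.
    have h := nat (λ_ V).hom
    have e : tensorμ A A (𝟙_ C) V ≫ ((ρ_ A).hom ⊗ₘ 𝟙 (A ⊗ V)) =
        (A ⊗ A) ◁ (λ_ V).hom ≫ (α_ A A V).hom := by
      simp only [tensorμ, braiding_tensorUnit_right, tensorHom_id]
      monoidal
    have e' : ((ρ_ A).hom ≫ ε ⊗ₘ θ V) = ((ρ_ A).hom ⊗ₘ 𝟙 (A ⊗ V)) ≫ A ◁ θ V ≫ ε ▷ V := by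
      rw [tensorHom_id, ← MonoidalCategory.tensorHom_def', ← tensorHom_id, tensorHom_comp_tensorHom,
        Category.id_comp]
    rw [← hΔ, hε, e', reassoc_of% e, ← whisker_exchange_assoc, Category.assoc, cancel_epi] at h
    conv_rhs => rw [id_whiskerRight, Category.id_comp, h]
    rw [comp_whiskerRight_assoc, comp_whiskerRight_assoc, Category.assoc, Category.assoc,
      Category.assoc, whisker_exchange_assoc, leftUnitor_naturality]
    simp
  counit_right := U₁ _ _ fun V => by
    have h := nat (ρ_ V).hom
    have e : tensorμ A A V (𝟙_ C) ≫ (𝟙 (A ⊗ V) ⊗ₘ (ρ_ A).hom) =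
        (A ⊗ A) ◁ (ρ_ V).hom ≫ (α_ A A V).hom ≫ A ◁ (β_ A V).hom ≫ (α_ A V A).inv := by
      simp only [tensorμ, id_tensorHom]
      monoidal
    have e' : (θ V ⊗ₘ (ρ_ A).hom ≫ ε) = (𝟙 (A ⊗ V) ⊗ₘ (ρ_ A).hom) ≫ (A ⊗ V) ◁ ε ≫ θ V ▷ 𝟙_ C := by
      rw [id_tensorHom, ← whiskerLeft_comp_assoc, ← MonoidalCategory.tensorHom_def']
    have n : A ◁ (β_ A V).hom ≫ (α_ A V A).inv ≫ (A ⊗ V) ◁ ε =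
        A ◁ (ε ▷ V) ≫ A ◁ (β_ (𝟙_ C) V).hom ≫ (α_ _ _ _).inv := by
      rw [← whiskerLeft_comp_assoc, BraidedCategory.braiding_naturality_left]
      simp
    rw [← hΔ, hε, e', reassoc_of% e, ← whisker_exchange_assoc, reassoc_of% n, Category.assoc,
      cancel_epi, braiding_tensorUnit_left] at h
    conv_rhs => rw [id_whiskerRight, Category.id_comp, h]
    simp
  comul_mul := U₂ _ _ fun V W => action_comul_mul θ nat hm hΔ V W
  comul_one := U₂ _ _ fun V W => by
    rw [comp_whiskerRight_assoc, hΔ, hη, comp_whiskerRight_assoc, tensorμ_natural_left_assoc,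
      tensorHom_comp_tensorHom, hη, hη, tensor_left_unitality]
  counit_mul := by
    -- On the unit object the action is $\varepsilon$, so associativity of the action there reads as
    -- multiplicativity of $\varepsilon$.
    rw [← cancel_epi (ρ_ (A ⊗ A)).hom, ← rightUnitor_naturality_assoc, ← hε, hm, hε]
    simp [MonoidalCategory.tensorHom_def', unitors_equal]
  counit_one := by
    rw [← cancel_epi (ρ_ (𝟙_ C)).hom, ← rightUnitor_naturality_assoc, ← hε, hη, unitors_equal]
    simp
  antipode_left := U₁ _ _ fun V => action_antipode_left θ nat hm hη hΔ hε hS V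
  antipode_right := U₁ _ _ fun V => action_antipode_right θ nat hm hη hΔ hε hS V

end Reconstruction

/-! ### The dual of a Hopf monoid -/

/-- The tensor product of two pairings. -/
def pairTensor {X Y V W : C} (p : X ⊗ V ⟶ 𝟙_ C) (q : Y ⊗ W ⟶ 𝟙_ C) :
    (X ⊗ Y) ⊗ (V ⊗ W) ⟶ 𝟙_ C :=
  tensorμ X Y V W ≫ (p ⊗ₘ q) ≫ (λ_ (𝟙_ C)).hom

section PairTensor

variable {X X' Y Y' V V' W W' : C} (p : X ⊗ V ⟶ 𝟙_ C) (q : Y ⊗ W ⟶ 𝟙_ C)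

theorem pairTensor_left (f : X' ⟶ X) (g : Y' ⟶ Y) :
    (f ⊗ₘ g) ▷ (V ⊗ W) ≫ pairTensor p q = pairTensor (f ▷ V ≫ p) (g ▷ W ≫ q) := by
  rw [pairTensor, tensorμ_natural_left_assoc, tensorHom_comp_tensorHom_assoc, pairTensor]

theorem pairTensor_right (f : V' ⟶ V) (g : W' ⟶ W) :
    (X ⊗ Y) ◁ (f ⊗ₘ g) ≫ pairTensor p q = pairTensor (X ◁ f ≫ p) (Y ◁ g ≫ q) := by
  rw [pairTensor, tensorμ_natural_right_assoc, tensorHom_comp_tensorHom_assoc, pairTensor]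

theorem pairTensor_left_left (f : X' ⟶ X) :
    f ▷ Y ▷ (V ⊗ W) ≫ pairTensor p q = pairTensor (f ▷ V ≫ p) q := by
  rw [← tensorHom_id f, pairTensor_left, id_whiskerRight, Category.id_comp]

theorem pairTensor_left_right (g : Y' ⟶ Y) :
    (X ◁ g) ▷ (V ⊗ W) ≫ pairTensor p q = pairTensor p (g ▷ W ≫ q) := by
  rw [← id_tensorHom X, pairTensor_left, id_whiskerRight, Category.id_comp]

theorem pairTensor_right_left (f : V' ⟶ V) :
    (X ⊗ Y) ◁ f ▷ W ≫ pairTensor p q = pairTensor (X ◁ f ≫ p) q := by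
  rw [← tensorHom_id f, pairTensor_right, whiskerLeft_id, Category.id_comp]

theorem pairTensor_right_right (g : W' ⟶ W) :
    (X ⊗ Y) ◁ (V ◁ g) ≫ pairTensor p q = pairTensor p (Y ◁ g ≫ q) := by
  rw [← id_tensorHom V, pairTensor_right, whiskerLeft_id, Category.id_comp]

theorem pairTensor_assoc {Z U : C} (r : Z ⊗ U ⟶ 𝟙_ C) :
    pairTensor (pairTensor p q) r =
      ((α_ X Y Z).hom ⊗ₘ (α_ V W U).hom) ≫ pairTensor p (pairTensor q r) := by
  have h := associator_monoidal X Y Z V W U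
  have l : ((tensorμ X Y V W ≫ (p ⊗ₘ q) ≫ (λ_ (𝟙_ C)).hom) ⊗ₘ r) =
      tensorμ X Y V W ▷ (Z ⊗ U) ≫ ((p ⊗ₘ q) ⊗ₘ r) ≫ (λ_ (𝟙_ C)).hom ▷ 𝟙_ C := by
    rw [← tensorHom_id, ← tensorHom_id, tensorHom_comp_tensorHom, tensorHom_comp_tensorHom]
    simp
  have r' : (p ⊗ₘ (tensorμ Y Z W U ≫ (q ⊗ₘ r) ≫ (λ_ (𝟙_ C)).hom)) =
      (X ⊗ V) ◁ tensorμ Y Z W U ≫ (p ⊗ₘ (q ⊗ₘ r)) ≫ 𝟙_ C ◁ (λ_ (𝟙_ C)).hom := by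
    rw [← id_tensorHom, ← id_tensorHom, tensorHom_comp_tensorHom, tensorHom_comp_tensorHom]
    simp
  simp only [pairTensor]
  rw [l, r']
  simp only [Category.assoc]
  rw [← reassoc_of% h, ← associator_naturality_assoc]
  congr 3
  monoidal

theorem pairTensor_unit_left :
    pairTensor (λ_ (𝟙_ C)).hom q = ((λ_ Y).hom ⊗ₘ (λ_ W).hom) ≫ q := by
  have e : tensorμ (𝟙_ C) Y (𝟙_ C) W ≫ (λ_ (𝟙_ C)).hom ▷ (Y ⊗ W) ≫ (λ_ (Y ⊗ W)).hom =
      ((λ_ Y).hom ⊗ₘ (λ_ W).hom) := by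
    simp only [tensorμ, braiding_tensorUnit_right, MonoidalCategory.tensorHom_def]
    monoidal
  rw [pairTensor, MonoidalCategory.tensorHom_def, Category.assoc, leftUnitor_naturality,
    reassoc_of% e]

theorem pairTensor_unit_right :
    pairTensor p (λ_ (𝟙_ C)).hom = ((ρ_ X).hom ⊗ₘ (ρ_ V).hom) ≫ p := by
  have e : tensorμ X (𝟙_ C) V (𝟙_ C) ≫ (X ⊗ V) ◁ (λ_ (𝟙_ C)).hom ≫ (ρ_ (X ⊗ V)).hom =
      ((ρ_ X).hom ⊗ₘ (ρ_ V).hom) := by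
    simp only [tensorμ, braiding_tensorUnit_left, MonoidalCategory.tensorHom_def]
    monoidal
  rw [pairTensor, MonoidalCategory.tensorHom_def', Category.assoc, unitors_equal,
    rightUnitor_naturality, ← unitors_equal, reassoc_of% e]

/-- The componentwise braiding on a product category. -/
abbrev braidedProd : BraidedCategory (C × C) where
  braiding X Y := Iso.prod (β_ X.1 Y.1) (β_ X.2 Y.2)
  braiding_naturality_right X _ _ f := by
    ext <;> exact BraidedCategory.braiding_naturality_right _ _
  braiding_naturality_left f Z := by
    ext <;> exact BraidedCategory.braiding_naturality_left _ _
  hexagon_forward X Y Z := by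
    ext <;> exact BraidedCategory.hexagon_forward _ _ _
  hexagon_reverse X Y Z := by
    ext <;> exact BraidedCategory.hexagon_reverse _ _ _

/-- With the componentwise braiding on $C\times C$, the functor $\otimes$ is lax braided by
`tensorμ_braiding`. The identity is the general compatibility of a lax braided functor with the
interchange, applied to $\otimes$ itself. -/
theorem tensorμ_coherence (X₁ X₂ X₃ X₄ V₁ V₂ V₃ V₄ : C) :
    tensorμ (X₁ ⊗ X₂) (X₃ ⊗ X₄) (V₁ ⊗ V₂) (V₃ ⊗ V₄) ≫
      (tensorμ X₁ X₂ V₁ V₂ ⊗ₘ tensorμ X₃ X₄ V₃ V₄) ≫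
        tensorμ (X₁ ⊗ V₁) (X₂ ⊗ V₂) (X₃ ⊗ V₃) (X₄ ⊗ V₄) =
    (tensorμ X₁ X₂ X₃ X₄ ⊗ₘ tensorμ V₁ V₂ V₃ V₄) ≫
      tensorμ (X₁ ⊗ X₃) (X₂ ⊗ X₄) (V₁ ⊗ V₃) (V₂ ⊗ V₄) ≫
        (tensorμ X₁ X₃ V₁ V₃ ⊗ₘ tensorμ X₂ X₄ V₂ V₄) := by
  let _ : BraidedCategory (C × C) := braidedProd
  let _ : (tensor C).LaxBraided :=
    { braided := fun X Y => tensorμ_braiding X.1 X.2 Y.1 Y.2 }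
  exact tensorμ_comp_μ_tensorHom_μ_comp_μ (tensor C) (X₁, X₂) (X₃, X₄) (V₁, V₂) (V₃, V₄)

/-- The middle interchange is adjoint to itself under parallel pairings; this makes the bialgebra
axiom self-dual. -/
theorem pairTensor_tensorμ {X₁ X₂ X₃ X₄ V₁ V₂ V₃ V₄ : C} (p₁ : X₁ ⊗ V₁ ⟶ 𝟙_ C)
    (p₂ : X₂ ⊗ V₂ ⟶ 𝟙_ C) (p₃ : X₃ ⊗ V₃ ⟶ 𝟙_ C) (p₄ : X₄ ⊗ V₄ ⟶ 𝟙_ C) :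
    (tensorμ X₁ X₂ X₃ X₄ ⊗ₘ tensorμ V₁ V₂ V₃ V₄) ≫
      pairTensor (pairTensor p₁ p₃) (pairTensor p₂ p₄) =
    pairTensor (pairTensor p₁ p₂) (pairTensor p₃ p₄) := by
  have h := tensorμ_coherence X₁ X₂ X₃ X₄ V₁ V₂ V₃ V₄
  have u : tensorμ (𝟙_ C) (𝟙_ C) (𝟙_ C) (𝟙_ C) = 𝟙 _ := by
    simp only [tensorμ, braiding_tensorUnit_right]; monoidal
  simp only [pairTensor, ← tensorHom_comp_tensorHom, Category.assoc]
  rw [← reassoc_of% h, ← tensorμ_natural_assoc, u, Category.id_comp]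

end PairTensor

section Dual

variable {A B : C} {m : A ⊗ A ⟶ A} {η : 𝟙_ C ⟶ A} {Δ : A ⟶ A ⊗ A} {ε : A ⟶ 𝟙_ C} {S : A ⟶ A}
  {mB : B ⊗ B ⟶ B} {ηB : 𝟙_ C ⟶ B} {ΔB : B ⟶ B ⊗ B} {εB : B ⟶ 𝟙_ C} {SB : B ⟶ B}

/-- The dual of a Hopf monoid is a Hopf monoid. -/
theorem IsHopf.dual [ExactPairing A B] (h : IsHopf m η Δ ε S)
    (hm : mB ▷ A ≫ ε_ A B = (B ⊗ B) ◁ Δ ≫ pairTensor (ε_ A B) (ε_ A B))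
    (hη : ηB ▷ A ≫ ε_ A B = (λ_ A).hom ≫ ε)
    (hΔ : ΔB ▷ (A ⊗ A) ≫ pairTensor (ε_ A B) (ε_ A B) = B ◁ m ≫ ε_ A B)
    (hε : εB = (ρ_ B).inv ≫ B ◁ η ≫ ε_ A B)
    (hS : SB ▷ A ≫ ε_ A B = B ◁ S ≫ ε_ A B) : IsHopf mB ηB ΔB εB SB := by
  -- The evaluation has an invertible mate, so the cancellation lemmas allow morphisms into $B$,
  -- $B\otimes B$ and $B\otimes(B\otimes B)$ to be compared after pairing. Each axiom of $B$ then
  -- becomes the dual axiom of $A$.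
  have mate_ev : mateAlong (η_ A B) (ε_ A B) = (λ_ B).inv := by
    simp [mateAlong]
  have U₁ : ∀ {X : C} (f g : X ⟶ B), f ▷ A ≫ ε_ A B = g ▷ A ≫ ε_ A B → f = g := by
    intro X f g e
    have := congrArg (mateAlong (η_ A B)) e
    rwa [mateAlong_comp, mateAlong_comp, mate_ev, cancel_mono] at this
  have U₂ : ∀ {X : C} (f g : X ⟶ B ⊗ B), f ▷ (A ⊗ A) ≫ pairTensor (ε_ A B) (ε_ A B) =
      g ▷ (A ⊗ A) ≫ pairTensor (ε_ A B) (ε_ A B) → f = g := by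
    intro X f g e
    simp only [pairTensor, ← Category.assoc, cancel_mono] at e
    simp only [Category.assoc] at e
    have := tensor_cancel (η_ A B) (η_ A B) _ _ f g e
    rwa [mate_ev, cancel_mono] at this
  have U₃ : ∀ {X : C} (f g : X ⟶ B ⊗ (B ⊗ B)),
      f ▷ (A ⊗ (A ⊗ A)) ≫ pairTensor (ε_ A B) (pairTensor (ε_ A B) (ε_ A B)) =
      g ▷ (A ⊗ (A ⊗ A)) ≫ pairTensor (ε_ A B) (pairTensor (ε_ A B) (ε_ A B)) → f = g := by
    intro X f g e
    have r : pairTensor (ε_ A B) (pairTensor (ε_ A B) (ε_ A B)) =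
       (tensorμ B (B ⊗ B) A (A ⊗ A) ≫ (ε_ A B ⊗ₘ (tensorμ B B A A ≫ (ε_ A B ⊗ₘ ε_ A B)))) ≫
         (𝟙_ C ◁ (λ_ (𝟙_ C)).hom ≫ (λ_ (𝟙_ C)).hom) := by
      simp only [pairTensor, Category.assoc]
      rw [← id_tensorHom, tensorHom_comp_tensorHom_assoc]
      simp
    rw [r] at e
    simp only [← Category.assoc, cancel_mono] at e
    simp only [Category.assoc] at e
    have := tensor_cancel₃ (η_ A B) (η_ A B) (η_ A B) _ _ _ f g e
    rwa [mate_ev, cancel_mono] at this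
  have whisk : ∀ {X Y Z W : C} (f : X ⟶ Y) (g : Z ⟶ W) {T : C} (k : Y ⊗ W ⟶ T),
      X ◁ g ≫ f ▷ W ≫ k = f ▷ Z ≫ Y ◁ g ≫ k := fun f g _ k => whisker_exchange_assoc f g k
  set p := ε_ A B with hp
  have hε' : B ◁ η ≫ p = (ρ_ B).hom ≫ εB := by rw [hε]; simp
  constructor
  · apply U₁
    have l : mB ▷ B ▷ (A ⊗ A) ≫ pairTensor p p =
        ((B ⊗ B) ⊗ B) ◁ (Δ ▷ A) ≫ pairTensor (pairTensor p p) p := by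
      rw [pairTensor_left_left, hm, pairTensor_right_left]
    have r : (B ◁ mB) ▷ (A ⊗ A) ≫ pairTensor p p =
        (B ⊗ (B ⊗ B)) ◁ (A ◁ Δ) ≫ pairTensor p (pairTensor p p) := by
      rw [pairTensor_left_right, hm, pairTensor_right_right]
    simp only [comp_whiskerRight, Category.assoc]
    rw [hm, ← whisk, ← whisk, l, r, pairTensor_assoc, ← whisk, ← whisk (α_ B B B).hom,
      ← whiskerLeft_comp_assoc _ Δ (A ◁ Δ), ← h.comul_assoc, MonoidalCategory.tensorHom_def']
    simp
  · apply U₁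
    have l : ηB ▷ B ▷ (A ⊗ A) ≫ pairTensor p p =
        (𝟙_ C ⊗ B) ◁ (ε ▷ A) ≫ pairTensor (λ_ (𝟙_ C)).hom p := by
      rw [pairTensor_left_left, hη, pairTensor_right_left, leftUnitor_naturality]
    simp only [comp_whiskerRight, Category.assoc]
    rw [hm, ← whisk, l, pairTensor_unit_left, MonoidalCategory.tensorHom_def', Category.assoc,
      ← whiskerLeft_comp_assoc, ← whiskerLeft_comp_assoc, Category.assoc, h.counit_left]
    simp
  · apply U₁
    have l : (B ◁ ηB) ▷ (A ⊗ A) ≫ pairTensor p p =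
        (B ⊗ 𝟙_ C) ◁ (A ◁ ε) ≫ pairTensor p (λ_ (𝟙_ C)).hom := by
      rw [pairTensor_left_right, hη, pairTensor_right_right, leftUnitor_naturality]
    simp only [comp_whiskerRight, Category.assoc]
    rw [hm, ← whisk, l, pairTensor_unit_right, MonoidalCategory.tensorHom_def', Category.assoc,
      ← whiskerLeft_comp_assoc, ← whiskerLeft_comp_assoc, Category.assoc, h.counit_right]
    simp
  · apply U₃
    have l : ΔB ▷ B ▷ ((A ⊗ A) ⊗ A) ≫ pairTensor (pairTensor p p) p =
        (B ⊗ B) ◁ (m ▷ A) ≫ pairTensor p p := by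
      rw [pairTensor_left_left, hΔ, pairTensor_right_left]
    have r : (B ◁ ΔB) ▷ (A ⊗ (A ⊗ A)) ≫ pairTensor p (pairTensor p p) =
        (B ⊗ B) ◁ (A ◁ m) ≫ pairTensor p p := by
      rw [pairTensor_left_right, hΔ, pairTensor_right_right]
    have a : (α_ B B B).hom ▷ (A ⊗ (A ⊗ A)) ≫ pairTensor p (pairTensor p p) =
        ((B ⊗ B) ⊗ B) ◁ (α_ A A A).inv ≫ pairTensor (pairTensor p p) p := by
      rw [pairTensor_assoc, MonoidalCategory.tensorHom_def', Category.assoc,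
        whiskerLeft_inv_hom_assoc]
    simp only [comp_whiskerRight, Category.assoc]
    rw [a, ← whisk, l, r, ← whisk, ← whisk, ← whisk, hΔ, ← whiskerLeft_comp_assoc,
      ← whiskerLeft_comp_assoc, ← whiskerLeft_comp_assoc, Category.assoc,
      h.mul_assoc]
    simp
  · apply U₁
    have l : εB ▷ B ▷ (𝟙_ C ⊗ A) ≫ pairTensor (λ_ (𝟙_ C)).hom p =
        (B ⊗ B) ◁ (η ▷ A) ≫ pairTensor p p := by
      rw [pairTensor_left_left, pairTensor_right_left, hε', ← rightUnitor_naturality,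
        unitors_equal]
    have e : (λ_ B).hom ▷ A ≫ p = (𝟙_ C ⊗ B) ◁ (λ_ A).inv ≫ pairTensor (λ_ (𝟙_ C)).hom p := by
      rw [pairTensor_unit_left, MonoidalCategory.tensorHom_def', Category.assoc,
        whiskerLeft_inv_hom_assoc]
    simp only [comp_whiskerRight, Category.assoc]
    rw [e, ← whisk, l, ← whisk, ← whisk, hΔ, ← whiskerLeft_comp_assoc _ _ m, h.one_mul]
    simp
  · apply U₁
    have l : (B ◁ εB) ▷ (A ⊗ 𝟙_ C) ≫ pairTensor p (λ_ (𝟙_ C)).hom =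
        (B ⊗ B) ◁ (A ◁ η) ≫ pairTensor p p := by
      rw [pairTensor_left_right, pairTensor_right_right, hε', ← rightUnitor_naturality,
        unitors_equal]
    have e : (ρ_ B).hom ▷ A ≫ p = (B ⊗ 𝟙_ C) ◁ (ρ_ A).inv ≫ pairTensor p (λ_ (𝟙_ C)).hom := by
      rw [pairTensor_unit_right, MonoidalCategory.tensorHom_def', Category.assoc,
        whiskerLeft_inv_hom_assoc]
    simp only [comp_whiskerRight, Category.assoc]
    rw [e, ← whisk, l, ← whisk, ← whisk, hΔ, ← whiskerLeft_comp_assoc _ _ m, h.mul_one]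
    simp
  · apply U₂
    simp only [comp_whiskerRight, Category.assoc]
    rw [hΔ, ← whisk, hm, ← whiskerLeft_comp_assoc, h.comul_mul, pairTensor_left, hm,
      ← pairTensor_right]
    simp only [whiskerLeft_comp, Category.assoc]
    rw [pairTensor_right, ← hΔ, ← pairTensor_left]
    have c := pairTensor_tensorμ p p p p
    -- The interchange is an involution, so the one on the side of $A$ can be moved to the side of
    -- $B$.
    have c' : ((B ⊗ B) ⊗ (B ⊗ B)) ◁ tensorμ A A A A ≫ pairTensor (pairTensor p p) (pairTensor p p) =
      tensorμ B B B B ▷ _ ≫ pairTensor (pairTensor p p) (pairTensor p p) := by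
      nth_rw 1 [← c]
      rw [MonoidalCategory.tensorHom_def', Category.assoc, ← whiskerLeft_comp_assoc,
        tensorμ_tensorμ, whiskerLeft_id, Category.id_comp]
    rw [whisk, c', whisk, whisk]
  · apply U₂
    simp only [comp_whiskerRight, Category.assoc]
    rw [hΔ, pairTensor_left, hη, ← whisk, hη]
    rw [← leftUnitor_naturality, ← pairTensor_right, pairTensor_unit_left,
      ← whiskerLeft_comp_assoc, h.counit_mul, MonoidalCategory.tensorHom_def' (λ_ _).hom,
      Category.assoc, ← whisk]
    generalize (ε ⊗ₘ ε) = t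
    monoidal
  · have e : (ρ_ B).hom ≫ εB = εB ▷ 𝟙_ C ≫ (λ_ (𝟙_ C)).hom := by
      rw [unitors_equal, rightUnitor_naturality]
    have t : mB ≫ εB = (ρ_ (B ⊗ B)).inv ≫ (B ⊗ B) ◁ η ≫ mB ▷ A ≫ p := by
      rw [hε, rightUnitor_inv_naturality_assoc, whisk]
    rw [t, hm, ← whiskerLeft_comp_assoc, h.comul_one, whiskerLeft_comp_assoc, pairTensor_right,
      hε', e, ← pairTensor_left, pairTensor_unit_left, MonoidalCategory.tensorHom_def' (λ_ _).hom,
      Category.assoc, whisk, whiskerLeft_inv_hom_assoc, unitors_equal, rightUnitor_naturality,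
      rightUnitor_naturality_assoc]
    simp
  · rw [hε, rightUnitor_inv_naturality_assoc, ← whisk, hη]
    simp [h.counit_one, unitors_equal]
  · apply U₁
    have l : SB ▷ B ▷ (A ⊗ A) ≫ pairTensor p p = (B ⊗ B) ◁ (S ▷ A) ≫ pairTensor p p := by
      rw [pairTensor_left_left, pairTensor_right_left, hS]
    simp only [comp_whiskerRight, Category.assoc]
    rw [hm, ← whisk, ← whisk, l, ← whisk, hΔ, hη, ← whiskerLeft_comp_assoc,
      ← whiskerLeft_comp_assoc, Category.assoc, h.antipode_left, whiskerLeft_comp_assoc, hε',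
      ← leftUnitor_naturality, ← whisk, unitors_equal, rightUnitor_naturality]
  · apply U₁
    have l : (B ◁ SB) ▷ (A ⊗ A) ≫ pairTensor p p = (B ⊗ B) ◁ (A ◁ S) ≫ pairTensor p p := by
      rw [pairTensor_left_right, pairTensor_right_right, hS]
    simp only [comp_whiskerRight, Category.assoc]
    rw [hm, ← whisk, ← whisk, l, ← whisk, hΔ, hη, ← whiskerLeft_comp_assoc,
      ← whiskerLeft_comp_assoc, Category.assoc, h.antipode_right, whiskerLeft_comp_assoc, hε',
      ← leftUnitor_naturality, ← whisk, unitors_equal, rightUnitor_naturality]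

end Dual

/-! ### The double dual -/

/-- The canonical morphism from an object to its double dual. -/
def toDoubleDual (V D DD : C) [ExactPairing V D] [ExactPairing D DD] : V ⟶ DD :=
  (ρ_ V).inv ≫ V ◁ η_ D DD ≫ (α_ V D DD).inv ≫ ((β_ V D).hom ≫ ε_ V D) ▷ DD ≫ (λ_ DD).hom

/-- The canonical morphism from the double dual of an object. -/
def ofDoubleDual (V D DD : C) [ExactPairing V D] [ExactPairing D DD] : DD ⟶ V :=
  (ρ_ DD).inv ≫ DD ◁ η_ V D ≫ (α_ DD V D).inv ≫ (β_ DD V).hom ▷ D ≫ (α_ V DD D).hom ≫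
    V ◁ ε_ D DD ≫ (ρ_ V).hom

theorem toDoubleDual_evaluation (V D DD : C) [ExactPairing V D] [ExactPairing D DD] :
    toDoubleDual V D DD ▷ D ≫ ε_ D DD = (β_ V D).hom ≫ ε_ V D := by
  calc
    _ = 𝟙 (V ⊗ D) ⊗≫ V ◁ (η_ D DD ▷ D) ⊗≫ (((β_ V D).hom ≫ ε_ V D) ▷ (DD ⊗ D) ≫
        𝟙_ C ◁ ε_ D DD) ⊗≫ 𝟙 (𝟙_ C) := by
      simp only [toDoubleDual]; monoidal
    _ = 𝟙 (V ⊗ D) ⊗≫ V ◁ (η_ D DD ▷ D ⊗≫ D ◁ ε_ D DD) ⊗≫ (β_ V D).hom ⊗≫ ε_ V D ⊗≫ 𝟙 (𝟙_ C) := by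
      rw [← whisker_exchange]; monoidal
    _ = _ := by rw [ExactPairing.evaluation_coevaluation'']; monoidal

/-- The braiding of $V$ past its own coevaluation is trivial by naturality, after which a zigzag
remains. This composite yields $u^{-1}u=1$; finite dimensionality supplies the other order. -/
theorem toDoubleDual_ofDoubleDual (V D DD : C) [ExactPairing V D] [ExactPairing D DD] :
    toDoubleDual V D DD ≫ ofDoubleDual V D DD = 𝟙 V := by
  have e := toDoubleDual_evaluation V D DD
  have h : toDoubleDual V D DD ▷ V ≫ (β_ DD V).hom = (β_ V V).hom ≫ V ◁ toDoubleDual V D DD := by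
    rw [BraidedCategory.braiding_naturality_left]
  have n : (β_ V (V ⊗ D)).hom = (α_ V V D).inv ≫ (β_ V V).hom ▷ D ≫ (α_ V V D).hom ≫
      V ◁ (β_ V D).hom ≫ (α_ V D V).inv := BraidedCategory.braiding_tensor_right_hom V V D
  rw [ofDoubleDual, rightUnitor_inv_naturality_assoc, ← whisker_exchange_assoc,
    associator_inv_naturality_left_assoc, ← comp_whiskerRight_assoc, h, comp_whiskerRight_assoc,
    associator_naturality_middle_assoc, ← whiskerLeft_comp_assoc, e]
  have n' : (α_ V V D).inv ≫ (β_ V V).hom ▷ D ≫ (α_ V V D).hom ≫ V ◁ (β_ V D).hom =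
      (β_ V (V ⊗ D)).hom ≫ (α_ V D V).hom := by
    rw [n]; simp
  rw [whiskerLeft_comp, Category.assoc, reassoc_of% n',
    BraidedCategory.braiding_naturality_right_assoc, braiding_tensorUnit_right,
    reassoc_of% (ExactPairing.evaluation_coevaluation V D)]
  simp

/-- Compatibility of the double dual with tensor products. -/
theorem toDoubleDual_tensor (V DV DDV W DW DDW T DDT X : C) [ExactPairing V DV]
    [ExactPairing DV DDV] [ExactPairing W DW] [ExactPairing DW DDW] [ExactPairing (V ⊗ W) T]
    [ExactPairing T DDT] [ExactPairing (DV ⊗ DW) X] (J : DV ⊗ DW ⟶ T) (J' : DDV ⊗ DDW ⟶ X)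
    (K : DDT ⟶ X) (hJ : J ▷ (V ⊗ W) ≫ ε_ (V ⊗ W) T = pairTensor (ε_ V DV) (ε_ W DW))
    (hJ' : J' ▷ (DV ⊗ DW) ≫ ε_ (DV ⊗ DW) X = pairTensor (ε_ DV DDV) (ε_ DW DDW))
    (hK : K ▷ (DV ⊗ DW) ≫ ε_ (DV ⊗ DW) X = DDT ◁ J ≫ ε_ T DDT) :
    (toDoubleDual V DV DDV ⊗ₘ toDoubleDual W DW DDW) ≫ J' = toDoubleDual (V ⊗ W) T DDT ≫ K := by
  have e : ((toDoubleDual V DV DDV ⊗ₘ toDoubleDual W DW DDW) ≫ J') ▷ (DV ⊗ DW) ≫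
      ε_ (DV ⊗ DW) X = (toDoubleDual (V ⊗ W) T DDT ≫ K) ▷ (DV ⊗ DW) ≫ ε_ (DV ⊗ DW) X := by
    -- Double duals are compared by pairing with $DV\otimes DW$, where each canonical map is the
    -- swapped evaluation; two swaps in parallel are one swap of tensor products.
    have b : pairTensor ((β_ V DV).hom ≫ ε_ V DV) ((β_ W DW).hom ≫ ε_ W DW) =
        (β_ (V ⊗ W) (DV ⊗ DW)).hom ≫ pairTensor (ε_ V DV) (ε_ W DW) := by
      simp only [pairTensor, ← tensorHom_comp_tensorHom, Category.assoc]
      rw [reassoc_of% (tensorμ_braiding V W DV DW)]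
    rw [comp_whiskerRight_assoc, comp_whiskerRight_assoc, hJ', hK, pairTensor_left,
      toDoubleDual_evaluation, toDoubleDual_evaluation, b, ← hJ,
      ← BraidedCategory.braiding_naturality_right_assoc, ← whisker_exchange_assoc,
      toDoubleDual_evaluation]
  have := congrArg (mateAlong (η_ (DV ⊗ DW) X)) e
  rw [mateAlong_comp, mateAlong_comp] at this
  have mate_ev : mateAlong (η_ (DV ⊗ DW) X) (ε_ (DV ⊗ DW) X) = (λ_ X).inv := by
    simp [mateAlong]
  rwa [mate_ev, cancel_mono] at this

end Abstract

attribute [fun_prop] IsLinearMap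

/-! ### Linearity and Sweedler contractions -/

section Linearity

variable {k A B C M N P : Type*} [Field k] [AddCommMonoid M] [Module k M] [AddCommMonoid N]
  [Module k N] [AddCommMonoid P] [Module k P] [AddCommMonoid A] [Module k A] [AddCommMonoid B]
  [Module k B] [AddCommMonoid C] [Module k C]

@[fun_prop]
theorem isLinearMap_id : IsLinearMap k (fun x : M => x) := ⟨fun _ _ => rfl, fun _ _ => rfl⟩

@[fun_prop]
theorem isLinearMap_comp {f : N → P} {g : M → N} (hf : IsLinearMap k f)
    (hg : IsLinearMap k g) : IsLinearMap k (fun x => f (g x)) :=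
  ⟨fun x y => by simp [hf.map_add, hg.map_add], fun c x => by simp [hf.map_smul, hg.map_smul]⟩

@[fun_prop]
theorem isLinearMap_coe (f : N →ₗ[k] P) : IsLinearMap k (fun x => f x) := f.isLinear

@[fun_prop]
theorem isLinearMap_coe_equiv (f : N ≃ₗ[k] P) : IsLinearMap k (fun x => f x) :=
  f.toLinearMap.isLinear

@[fun_prop]
theorem isLinearMap_coe_algHom {A B : Type*} [Ring A] [Algebra k A] [Ring B] [Algebra k B]
    (f : A →ₐ[k] B) : IsLinearMap k (fun x => f x) :=
  f.toLinearMap.isLinear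

@[fun_prop]
theorem isLinearMap_coe_algEquiv {A B : Type*} [Ring A] [Algebra k A] [Ring B] [Algebra k B]
    (f : A ≃ₐ[k] B) : IsLinearMap k (fun x => f x) :=
  f.toLinearMap.isLinear

@[fun_prop]
theorem isLinearMap_apply {f : M → N →ₗ[k] P} (hf : IsLinearMap k f) (y : N) :
    IsLinearMap k (fun x => f x y) :=
  ⟨fun x y => by simp [hf.map_add], fun c x => by simp [hf.map_smul]⟩

@[fun_prop]
theorem isLinearMap_tmul_left {f : M → N} (hf : IsLinearMap k f) (y : P) :
    IsLinearMap k (fun x => f x ⊗ₜ[k] y) :=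
  ⟨fun x z => by simp [hf.map_add, TensorProduct.add_tmul],
    fun c x => by simp [hf.map_smul, TensorProduct.smul_tmul']⟩

@[fun_prop]
theorem isLinearMap_tmul_right {f : M → N} (hf : IsLinearMap k f) (y : P) :
    IsLinearMap k (fun x => y ⊗ₜ[k] f x) :=
  ⟨fun x z => by simp [hf.map_add, TensorProduct.tmul_add], fun c x => by simp [hf.map_smul]⟩

@[fun_prop]
theorem isLinearMap_map_left {f : P → A →ₗ[k] M} (hf : IsLinearMap k f) (g : B →ₗ[k] N) :
    IsLinearMap k (fun x => TensorProduct.map (f x) g) :=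
  ⟨fun x z => by simp [hf.map_add, TensorProduct.map_add_left],
    fun c x => by simp [hf.map_smul, TensorProduct.map_smul_left]⟩

@[fun_prop]
theorem isLinearMap_map_right {f : P → A →ₗ[k] M} (hf : IsLinearMap k f) (g : B →ₗ[k] N) :
    IsLinearMap k (fun x => TensorProduct.map g (f x)) :=
  ⟨fun x z => by simp [hf.map_add, TensorProduct.map_add_right],
    fun c x => by simp [hf.map_smul, TensorProduct.map_smul_right]⟩

@[fun_prop]
theorem isLinearMap_smul_left {f : M → k} (hf : IsLinearMap k f) (y : P) :
    IsLinearMap k (fun x => f x • y) :=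
  ⟨fun x z => by simp [hf.map_add, add_smul], fun c x => by simp [hf.map_smul, mul_smul]⟩

@[fun_prop]
theorem isLinearMap_smul_right {f : M → N} (hf : IsLinearMap k f) (c : k) :
    IsLinearMap k (fun x => c • f x) :=
  ⟨fun x z => by simp [hf.map_add], fun d x => by simp [hf.map_smul, smul_comm c d]⟩

@[fun_prop]
theorem isLinearMap_mul_left {A : Type*} [Ring A] [Algebra k A] {f : M → A}
    (hf : IsLinearMap k f) (y : A) : IsLinearMap k (fun x => f x * y) :=
  ⟨fun x z => by simp [hf.map_add, add_mul], fun d x => by simp [hf.map_smul]⟩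

@[fun_prop]
theorem isLinearMap_mul_right {A : Type*} [Ring A] [Algebra k A] {f : M → A}
    (hf : IsLinearMap k f) (y : A) : IsLinearMap k (fun x => y * f x) :=
  ⟨fun x z => by simp [hf.map_add, mul_add], fun d x => by simp [hf.map_smul]⟩

@[fun_prop]
theorem isLinearMap_sum {ι : Type*} (s : Finset ι) {f : M → ι → N}
    (hf : ∀ i, IsLinearMap k fun x => f x i) : IsLinearMap k (fun x => ∑ i ∈ s, f x i) :=
  ⟨fun x z => by simp [(hf _).map_add, Finset.sum_add_distrib],
    fun d x => by simp [(hf _).map_smul, Finset.smul_sum]⟩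

@[fun_prop]
theorem isLinearMap_comp_left {f : M → N →ₗ[k] P} (hf : IsLinearMap k f) (g : A →ₗ[k] N) :
    IsLinearMap k (fun x => f x ∘ₗ g) :=
  ⟨fun x z => by simp [hf.map_add, LinearMap.add_comp],
    fun d x => by simp [hf.map_smul, LinearMap.smul_comp]⟩

@[fun_prop]
theorem isLinearMap_comp_right {f : M → A →ₗ[k] N} (hf : IsLinearMap k f) (g : N →ₗ[k] P) :
    IsLinearMap k (fun x => g ∘ₗ f x) :=
  ⟨fun x z => by simp [hf.map_add, LinearMap.comp_add],
    fun d x => by simp [hf.map_smul, LinearMap.comp_smul]⟩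

end Linearity

section Sweedler

variable {k A B C M N P : Type*} [Field k] [AddCommGroup M] [Module k M] [AddCommGroup N]
  [Module k N] [AddCommGroup P] [Module k P] [AddCommGroup A] [Module k A] [AddCommGroup B]
  [Module k B] [AddCommGroup C] [Module k C]

@[fun_prop]
theorem isLinearMap_sw_left {f : M → A ⊗[k] B} (hf : IsLinearMap k f) (F : A → B → N) :
    IsLinearMap k (fun x => sw (f x) F) :=
  ⟨fun x z => by simp [hf.map_add, sw_add_left], fun d x => by simp [hf.map_smul, sw_smul_left]⟩

@[fun_prop]
theorem isLinearMap_sw_right {F : M → A → B → N} (hF : ∀ a b, IsLinearMap k fun x => F x a b)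
    (t : A ⊗[k] B) : IsLinearMap k (fun x => sw t (F x)) :=
  ⟨fun x z => by
    rw [← sw_add_right]; congr 1; funext a b; exact (hF a b).map_add x z,
   fun d x => by
    rw [← sw_smul_right]; congr 1; funext a b; exact (hF a b).map_smul d x⟩

@[fun_prop]
theorem isLinearMap_sw3_left {f : M → A ⊗[k] (B ⊗[k] C)} (hf : IsLinearMap k f)
    (F : A → B → C → N) : IsLinearMap k (fun x => sw3 (f x) F) := by
  unfold sw3; fun_prop

@[fun_prop]
theorem isLinearMap_sw3_right {F : M → A → B → C → N}
    (hF : ∀ a b c, IsLinearMap k fun x => F x a b c)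
    (t : A ⊗[k] (B ⊗[k] C)) : IsLinearMap k (fun x => sw3 t (F x)) := by
  unfold sw3; fun_prop

/-- The device behind the Sweedler identities below: $\Phi$, $R$, $\Delta(h)$ are replaced by
arbitrary tensors, the linearity of both sides is found by `fun_prop`, and the claim is checked on
pure tensors. It is stated for functions rather than linear maps so that nested contractions fit. -/
theorem tensor_ext {E F : A ⊗[k] B → M} (hE : IsLinearMap k E) (hF : IsLinearMap k F)
    (h : ∀ a b, E (a ⊗ₜ b) = F (a ⊗ₜ b)) (t : A ⊗[k] B) : E t = F t := by
  have : hE.mk' E = hF.mk' F := TensorProduct.ext' h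
  exact LinearMap.congr_fun this t

theorem tensor_ext₃ {E F : A ⊗[k] (B ⊗[k] C) → M} (hE : IsLinearMap k E) (hF : IsLinearMap k F)
    (h : ∀ a b c, E (a ⊗ₜ (b ⊗ₜ c)) = F (a ⊗ₜ (b ⊗ₜ c))) (t : A ⊗[k] (B ⊗[k] C)) : E t = F t :=
  tensor_ext hE hF (fun a => tensor_ext (by fun_prop) (by fun_prop) (h a)) t

theorem sw_eq {E : A ⊗[k] B → M} (hE : IsLinearMap k E) {F : A → B → M}
    (h : ∀ a b, F a b = E (a ⊗ₜ b)) (t : A ⊗[k] B) : sw t F = E t := by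
  have := sw_eq_lift t (TensorProduct.curry (hE.mk' E))
  rw [show F = fun a b => E (a ⊗ₜ b) from funext fun a => funext fun b => h a b]
  exact this.trans (tensor_ext (by fun_prop) hE (fun a b => by simp) t)

theorem sw3_eq {E : A ⊗[k] (B ⊗[k] C) → M} (hE : IsLinearMap k E) {F : A → B → C → M}
    (h : ∀ a b c, F a b c = E (a ⊗ₜ (b ⊗ₜ c))) (t : A ⊗[k] (B ⊗[k] C)) : sw3 t F = E t :=
  sw_eq hE (fun a s => sw_eq (E := fun s => E (a ⊗ₜ s)) (by fun_prop) (h a) s) t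

theorem sw_pure {F : A → B → M} (h₁ : ∀ b, IsLinearMap k fun a => F a b)
    (h₂ : ∀ a, IsLinearMap k fun b => F a b) (a : A) (b : B) : sw (a ⊗ₜ[k] b) F = F a b :=
  sw_tmul a b F h₁ h₂

theorem sw3_pure {F : A → B → C → M} (h₁ : ∀ b c, IsLinearMap k fun a => F a b c)
    (h₂ : ∀ a c, IsLinearMap k fun b => F a b c) (h₃ : ∀ a b, IsLinearMap k fun c => F a b c)
    (a : A) (b : B) (c : C) : sw3 (a ⊗ₜ[k] (b ⊗ₜ[k] c)) F = F a b c := by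
  unfold sw3
  rw [sw_pure, sw_pure] <;> intros <;> fun_prop

theorem sw_map {E : M → N} (hE : IsLinearMap k E) (t : A ⊗[k] B) (F : A → B → M) :
    E (sw t F) = sw t fun a b => E (F a b) := by
  simp only [sw, Module.Basis.constr_apply, Finsupp.sum]
  rw [show E = hE.mk' E from rfl, map_sum]
  simp only [map_smul]

theorem sw3_map {E : M → N} (hE : IsLinearMap k E) (t : A ⊗[k] (B ⊗[k] C)) (F : A → B → C → M) :
    E (sw3 t F) = sw3 t fun a b c => E (F a b c) := by
  simp only [sw3, sw_map hE]

/-- The action of a tensor product of algebras on a tensor product of modules. -/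
noncomputable def tact {A B : Type*} [Ring A] [Algebra k A] [Ring B] [Algebra k B]
    (ρ : A →ₐ[k] Module.End k M) (σ : B →ₐ[k] Module.End k N) :
    A ⊗[k] B →ₐ[k] Module.End k (M ⊗[k] N) :=
  Module.endTensorEndAlgHom.comp (Algebra.TensorProduct.map ρ σ)

@[simp]
theorem tact_tmul {A B : Type*} [Ring A] [Algebra k A] [Ring B] [Algebra k B]
    (ρ : A →ₐ[k] Module.End k M) (σ : B →ₐ[k] Module.End k N) (a : A) (b : B) :
    tact ρ σ (a ⊗ₜ b) = TensorProduct.map (ρ a) (σ b) := by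
  simp [tact, Module.endTensorEndAlgHom_apply]
  rfl

@[fun_prop]
theorem isLinearMap_tact {A B : Type*} [Ring A] [Algebra k A] [Ring B] [Algebra k B]
    (ρ : A →ₐ[k] Module.End k M) (σ : B →ₐ[k] Module.End k N) {f : P → A ⊗[k] B}
    (hf : IsLinearMap k f) : IsLinearMap k fun x => tact ρ σ (f x) :=
  isLinearMap_comp (tact ρ σ).toLinearMap.isLinear hf

end Sweedler

/-! ### Modules over a quasi-Hopf algebra and their constraints -/

/-- Finite dimensional left modules over a quasi-Hopf algebra with an `R`-matrix. -/
structure QMod {k : Type u} {H : Type v} [Field k] [Ring H] [Algebra k H]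
    {Q : QuasiHopfAlgebra k H} (𝓡 : RMatrix Q) where
  carrier : Type (max u v)
  [grp : AddCommGroup carrier]
  [mod : Module k carrier]
  [fin : FiniteDimensional k carrier]
  act : H →ₐ[k] Module.End k carrier

namespace QMod

attribute [instance] QMod.grp QMod.mod QMod.fin

variable {k : Type u} {H : Type v} [Field k] [Ring H] [Algebra k H] {Q : QuasiHopfAlgebra k H}
  {𝓡 : RMatrix Q}

/-- The `H`-linear maps. -/
@[ext]
structure Hom (M N : QMod 𝓡) where
  lin : M.carrier →ₗ[k] N.carrier
  comm : ∀ h m, lin (M.act h m) = N.act h (lin m)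

instance : Category (QMod 𝓡) where
  Hom := Hom
  id M := ⟨LinearMap.id, fun _ _ => rfl⟩
  comp f g := ⟨g.lin ∘ₗ f.lin, fun h m => by simp [f.comm, g.comm]⟩

@[ext]
theorem hom_ext {M N : QMod 𝓡} {f g : M ⟶ N} (h : ∀ m, f.lin m = g.lin m) : f = g :=
  Hom.ext (LinearMap.ext h)

@[simp] theorem id_lin (M : QMod 𝓡) (m : M.carrier) : Hom.lin (𝟙 M) m = m := rfl

@[simp] theorem comp_lin {M N P : QMod 𝓡} (f : M ⟶ N) (g : N ⟶ P) (m : M.carrier) :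
    (f ≫ g).lin m = g.lin (f.lin m) := rfl

/-- A module isomorphism from an `H`-linear equivalence. -/
def mkIso {M N : QMod 𝓡} (e : M.carrier ≃ₗ[k] N.carrier)
    (h : ∀ a m, e (M.act a m) = N.act a (e m)) : M ≅ N where
  hom := ⟨e.toLinearMap, h⟩
  inv := ⟨e.symm.toLinearMap, fun a m => by
    apply e.injective
    have := h a (e.symm m)
    simp only [LinearEquiv.coe_coe, LinearEquiv.apply_symm_apply] at this ⊢
    exact this.symm⟩
  hom_inv_id := by ext m; exact e.symm_apply_apply m
  inv_hom_id := by ext m; exact e.apply_symm_apply m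

/-- The diagonal action on a tensor product. -/
noncomputable def tensorAct (M N : QMod 𝓡) : H →ₐ[k] Module.End k (M.carrier ⊗[k] N.carrier) :=
  (tact M.act N.act).comp Q.Δ

@[simp]
theorem tensorAct_apply (M N : QMod 𝓡) (h : H) :
    tensorAct M N h = tact M.act N.act (Q.Δ h) := rfl

/-- The action on the trivial module. -/
noncomputable def trivAct (Q : QuasiHopfAlgebra k H) : H →ₐ[k] Module.End k (ULift.{v} k) :=
  (Algebra.ofId k _).comp Q.ε

@[simp]
theorem trivAct_apply (h : H) (x : ULift.{v} k) : trivAct Q h x = Q.ε h • x := rfl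

/-- The tensor product of modules. -/
noncomputable abbrev tensor (M N : QMod 𝓡) : QMod 𝓡 where
  carrier := M.carrier ⊗[k] N.carrier
  act := tensorAct M N

/-- The trivial module. -/
noncomputable abbrev triv : QMod 𝓡 where
  carrier := ULift.{v} k
  act := trivAct Q

/-- The tensor product of `H`-linear maps is linear for the action of `H ⊗ H`. -/
theorem tact_map {M M' N N' : QMod 𝓡} (f : M ⟶ M') (g : N ⟶ N') (t : H ⊗[k] H)
    (x : M.carrier ⊗[k] N.carrier) :
    TensorProduct.map f.lin g.lin (tact M.act N.act t x) =
      tact M'.act N'.act t (TensorProduct.map f.lin g.lin x) := by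
  revert t
  refine tensor_ext (by fun_prop) (by fun_prop) fun a b => ?_
  revert x
  refine tensor_ext (by fun_prop) (by fun_prop) fun m n => ?_
  simp [f.comm, g.comm]

/-- The tensor product of morphisms. -/
noncomputable def tensorMap {M M' N N' : QMod 𝓡} (f : M ⟶ M') (g : N ⟶ N') :
    tensor M N ⟶ tensor M' N' :=
  ⟨TensorProduct.map f.lin g.lin, fun h x => tact_map f g (Q.Δ h) x⟩

section Actions

variable (U V W X : QMod 𝓡)

/-- The action of `H ⊗ H ⊗ H` on a threefold tensor product. -/
noncomputable abbrev tact₃ : H ⊗[k] (H ⊗[k] H) →ₐ[k]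
    Module.End k (U.carrier ⊗[k] (V.carrier ⊗[k] W.carrier)) :=
  tact U.act (tact V.act W.act)

/-- The action of `H ⊗ H ⊗ H ⊗ H` on a fourfold tensor product. -/
noncomputable abbrev tact₄ : H ⊗[k] (H ⊗[k] (H ⊗[k] H)) →ₐ[k]
    Module.End k (U.carrier ⊗[k] (V.carrier ⊗[k] (W.carrier ⊗[k] X.carrier))) :=
  tact U.act (tact₃ V W X)

theorem tact_assoc (s : H ⊗[k] H) (c : H) (x : (U.carrier ⊗[k] V.carrier) ⊗[k] W.carrier) :
    TensorProduct.assoc k _ _ _ (TensorProduct.map (tact U.act V.act s) (W.act c) x) =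
      tact₃ U V W (TensorProduct.assoc k H H H (s ⊗ₜ c)) (TensorProduct.assoc k _ _ _ x) := by
  revert s
  refine tensor_ext (by fun_prop) (by fun_prop) fun a b => ?_
  revert x
  refine tensor_ext (by fun_prop) (by fun_prop) fun y w => ?_
  revert y
  refine tensor_ext (by fun_prop) (by fun_prop) fun u v => ?_
  simp

theorem tact_tensor_right (s : H ⊗[k] H) (x : U.carrier ⊗[k] (V.carrier ⊗[k] W.carrier)) :
    tact U.act (tensor V W).act s x =
      tact₃ U V W (Algebra.TensorProduct.map (AlgHom.id k H) Q.Δ s) x := by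
  revert s
  refine tensor_ext (by fun_prop) (by fun_prop) fun a b => ?_
  simp

theorem tact_tensor_left (s : H ⊗[k] H) (x : (U.carrier ⊗[k] V.carrier) ⊗[k] W.carrier) :
    TensorProduct.assoc k _ _ _ (tact (tensor U V).act W.act s x) =
      tact₃ U V W (TensorProduct.assoc k H H H
        (Algebra.TensorProduct.map Q.Δ (AlgHom.id k H) s)) (TensorProduct.assoc k _ _ _ x) := by
  revert s
  refine tensor_ext (by fun_prop) (by fun_prop) fun a b => ?_
  simp [tact_assoc]

/-- The action of an invertible element of `H ⊗ H ⊗ H` on a threefold tensor product. -/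
noncomputable def tact₃Equiv (t : (H ⊗[k] (H ⊗[k] H))ˣ) :
    (U.carrier ⊗[k] (V.carrier ⊗[k] W.carrier)) ≃ₗ[k]
      (U.carrier ⊗[k] (V.carrier ⊗[k] W.carrier)) :=
  LinearEquiv.ofLinearMap (tact₃ U V W t.val) (tact₃ U V W t⁻¹.val)
    (by rw [← Module.End.mul_eq_comp, ← map_mul, Units.mul_inv, map_one]; rfl)
    (by rw [← Module.End.mul_eq_comp, ← map_mul, Units.inv_mul, map_one]; rfl)

/-- The associativity constraint. -/
noncomputable def assocIso : tensor (tensor U V) W ≅ tensor U (tensor V W) :=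
  mkIso ((TensorProduct.assoc k _ _ _).trans (tact₃Equiv U V W Q.Φ)) fun h x => by
    have := Q.coassoc h
    change tact₃ U V W Q.Φ.val (TensorProduct.assoc k _ _ _ (tact (tensor U V).act W.act (Q.Δ h) x))
      = tact U.act (tensor V W).act (Q.Δ h) (tact₃ U V W Q.Φ.val _)
    rw [tact_tensor_left, tact_tensor_right, ← Module.End.mul_apply, ← Module.End.mul_apply,
      ← map_mul, ← map_mul, this, Units.inv_mul_cancel_right]
    rfl

/-- The left unit constraint. -/
noncomputable def lunitIso : tensor triv U ≅ U :=
  mkIso ((TensorProduct.congr ULift.moduleEquiv (LinearEquiv.refl k _)).trans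
    (TensorProduct.lid k _)) fun h x => by
    conv_rhs => rw [← Q.counit_left h]
    rw [sw_eq (E := fun t => (TensorProduct.lid k H) (Q.ε.toLinearMap.rTensor H t)) (by fun_prop)
      (fun a b => by simp)]
    change TensorProduct.lid k _ (TensorProduct.congr _ _ (tact triv.act U.act (Q.Δ h) x)) = _
    generalize Q.Δ h = t
    revert t
    refine tensor_ext (by fun_prop) (by fun_prop) fun a b => ?_
    revert x
    refine tensor_ext (by fun_prop) (by fun_prop) fun c m => ?_
    simp [smul_smul, mul_comm]

/-- The right unit constraint. -/
noncomputable def runitIso : tensor U triv ≅ U :=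
  mkIso ((TensorProduct.congr (LinearEquiv.refl k _) ULift.moduleEquiv).trans
    (TensorProduct.rid k _)) fun h x => by
    conv_rhs => rw [← Q.counit_right h]
    rw [sw_eq (E := fun t => (TensorProduct.rid k H) (Q.ε.toLinearMap.lTensor H t)) (by fun_prop)
      (fun a b => by simp)]
    change TensorProduct.rid k _ (TensorProduct.congr _ _ (tact U.act triv.act (Q.Δ h) x)) = _
    generalize Q.Δ h = t
    revert t
    refine tensor_ext (by fun_prop) (by fun_prop) fun a b => ?_
    revert x
    refine tensor_ext (by fun_prop) (by fun_prop) fun c m => ?_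
    simp [smul_smul, mul_comm]

end Actions

open MonoidalCategory

noncomputable instance : MonoidalCategoryStruct (QMod 𝓡) where
  tensorObj := tensor
  whiskerLeft X _ _ f := tensorMap (𝟙 X) f
  whiskerRight f Y := tensorMap f (𝟙 Y)
  tensorHom := tensorMap
  tensorUnit := triv
  associator := assocIso
  leftUnitor := lunitIso
  rightUnitor := runitIso

section Lin

variable {U U' V V' W : QMod 𝓡}

theorem tensorHom_lin (f : U ⟶ U') (g : V ⟶ V') (x : (U ⊗ V).carrier) :
    (f ⊗ₘ g).lin x = TensorProduct.map f.lin g.lin x := rfl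

theorem whiskerLeft_lin (g : V ⟶ V') (x : (U ⊗ V).carrier) :
    (U ◁ g).lin x = TensorProduct.map LinearMap.id g.lin x := rfl

theorem whiskerRight_lin (f : U ⟶ U') (x : (U ⊗ V).carrier) :
    (f ▷ V).lin x = TensorProduct.map f.lin LinearMap.id x := rfl

end Lin

end QMod

/-! ### Pentagon and triangle: modules form a monoidal category -/

namespace QMod

variable {k : Type u} {H : Type v} [Field k] [Ring H] [Algebra k H] {Q : QuasiHopfAlgebra k H}
  {𝓡 : RMatrix Q}

section Pentagon

variable (U V W X : QMod 𝓡)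

theorem tact₄_one_tmul (t : H ⊗[k] (H ⊗[k] H))
    (z : U.carrier ⊗[k] (V.carrier ⊗[k] (W.carrier ⊗[k] X.carrier))) :
    TensorProduct.map LinearMap.id (tact₃ V W X t) z = tact₄ U V W X (1 ⊗ₜ t) z := by
  simp [Module.End.one_eq_id]

theorem tact₄_tmul_one (t : H ⊗[k] (H ⊗[k] H))
    (y : U.carrier ⊗[k] (V.carrier ⊗[k] W.carrier)) (x : X.carrier) :
    TensorProduct.map LinearMap.id (TensorProduct.assoc k _ _ _).toLinearMap
      (TensorProduct.assoc k _ _ _ (tact₃ U V W t y ⊗ₜ[k] x)) =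
    tact₄ U V W X (sw3 t fun X₁ X₂ X₃ => X₁ ⊗ₜ[k] (X₂ ⊗ₜ[k] (X₃ ⊗ₜ[k] (1 : H))))
      (TensorProduct.map LinearMap.id (TensorProduct.assoc k _ _ _).toLinearMap
        (TensorProduct.assoc k _ _ _ (y ⊗ₜ[k] x))) := by
  revert t
  refine tensor_ext₃ (by fun_prop) (by fun_prop) fun a b c => ?_
  revert y
  refine tensor_ext₃ (by fun_prop) (by fun_prop) fun m n p => ?_
  simp (disch := fun_prop) [sw3_pure]

theorem tact₄_tensor_left (t : H ⊗[k] (H ⊗[k] H))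
    (z : (U.carrier ⊗[k] V.carrier) ⊗[k] (W.carrier ⊗[k] X.carrier)) :
    TensorProduct.assoc k _ _ _ (tact₃ (tensor U V) W X t z) =
    tact₄ U V W X (sw3 t fun X₁ X₂ X₃ =>
      TensorProduct.assoc k H H (H ⊗[k] H) (Q.Δ X₁ ⊗ₜ[k] (X₂ ⊗ₜ[k] X₃)))
      (TensorProduct.assoc k _ _ _ z) := by
  revert t
  refine tensor_ext₃ (by fun_prop) (by fun_prop) fun a b c => ?_
  simp (disch := fun_prop) only [sw3_pure]
  simp only [tact_tmul]
  change TensorProduct.assoc k _ _ _ (TensorProduct.map (tact U.act V.act (Q.Δ a)) _ z) = _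
  generalize Q.Δ a = s
  revert s
  refine tensor_ext (by fun_prop) (by fun_prop) fun a b => ?_
  revert z
  refine tensor_ext (by fun_prop) (by fun_prop) fun m n => ?_
  revert m
  refine tensor_ext (by fun_prop) (by fun_prop) fun m n' => ?_
  simp

theorem tact₄_tensor_middle (t : H ⊗[k] (H ⊗[k] H))
    (z : U.carrier ⊗[k] ((V.carrier ⊗[k] W.carrier) ⊗[k] X.carrier)) :
    TensorProduct.map LinearMap.id (TensorProduct.assoc k _ _ _).toLinearMap
      (tact₃ U (tensor V W) X t z) =
    tact₄ U V W X (sw3 t fun X₁ X₂ X₃ =>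
      X₁ ⊗ₜ[k] TensorProduct.assoc k H H H (Q.Δ X₂ ⊗ₜ[k] X₃))
      (TensorProduct.map LinearMap.id (TensorProduct.assoc k _ _ _).toLinearMap z) := by
  revert t
  refine tensor_ext₃ (by fun_prop) (by fun_prop) fun a b c => ?_
  simp (disch := fun_prop) only [sw3_pure]
  revert z
  refine tensor_ext (by fun_prop) (by fun_prop) fun m n => ?_
  simp [tact_assoc]

theorem tact₄_tensor_right (t : H ⊗[k] (H ⊗[k] H))
    (z : U.carrier ⊗[k] (V.carrier ⊗[k] (W.carrier ⊗[k] X.carrier))) :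
    tact₃ U V (tensor W X) t z =
    tact₄ U V W X (sw3 t fun X₁ X₂ X₃ => X₁ ⊗ₜ[k] (X₂ ⊗ₜ[k] Q.Δ X₃)) z := by
  revert t
  refine tensor_ext₃ (by fun_prop) (by fun_prop) fun a b c => ?_
  simp (disch := fun_prop) [sw3_pure]

/-- Once everything is rebracketed to the right, each edge of the pentagon is the action of an
element of $H^{\otimes4}$, and the pentagon is the cocycle identity for $\Phi$. -/
theorem pentagon' : tensorMap (assocIso U V W).hom (𝟙 X) ≫ (assocIso U (tensor V W) X).hom ≫
    tensorMap (𝟙 U) (assocIso V W X).hom =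
      (assocIso (tensor U V) W X).hom ≫ (assocIso U V (tensor W X)).hom := by
  ext z
  revert z
  refine tensor_ext (by fun_prop) (by fun_prop) fun y x => ?_
  revert y
  refine tensor_ext (by fun_prop) (by fun_prop) fun y w => ?_
  revert y
  refine tensor_ext (by fun_prop) (by fun_prop) fun u v => ?_
  change TensorProduct.map LinearMap.id ((tact₃ V W X Q.Φ.val) ∘ₗ
    (TensorProduct.assoc k _ _ _).toLinearMap) (tact₃ U (tensor V W) X Q.Φ.val
      (TensorProduct.assoc k _ _ _ ((tact₃ U V W Q.Φ.val (u ⊗ₜ (v ⊗ₜ w))) ⊗ₜ x))) =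
      tact₃ U V (tensor W X) Q.Φ.val (TensorProduct.assoc k _ _ _
        (tact₃ (tensor U V) W X Q.Φ.val ((u ⊗ₜ v) ⊗ₜ (w ⊗ₜ x))))
  rw [show (LinearMap.id : U.carrier →ₗ[k] U.carrier) = LinearMap.id ∘ₗ LinearMap.id from rfl,
    TensorProduct.map_comp, LinearMap.comp_apply, tact₄_tensor_middle, tact₄_one_tmul,
    tact₄_tmul_one, tact₄_tensor_right, tact₄_tensor_left]
  simp only [← Module.End.mul_apply, ← map_mul]
  exact congrArg (fun T => tact₄ U V W X T (u ⊗ₜ (v ⊗ₜ (w ⊗ₜ x))))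
    ((@mul_assoc (H ⊗[k] (H ⊗[k] (H ⊗[k] H))) _ _ _ _).symm.trans Q.cocycle)

theorem triangle' : (assocIso U triv V).hom ≫ tensorMap (𝟙 U) (lunitIso V).hom =
    tensorMap (runitIso U).hom (𝟙 V) := by
  ext z
  revert z
  refine tensor_ext (by fun_prop) (by fun_prop) fun y x => ?_
  revert y
  refine tensor_ext (by fun_prop) (by fun_prop) fun y c => ?_
  change TensorProduct.map LinearMap.id (lunitIso V).hom.lin (tact₃ U triv V Q.Φ.val
    (y ⊗ₜ (c ⊗ₜ x))) = (runitIso U).hom.lin (y ⊗ₜ c) ⊗ₜ[k] x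
  have key : ∀ t : H ⊗[k] (H ⊗[k] H), TensorProduct.map LinearMap.id (lunitIso V).hom.lin
    (tact₃ U triv V t (y ⊗ₜ (c ⊗ₜ x))) =
      c.down • tact U.act V.act (sw3 t fun X₁ X₂ X₃ => Q.ε X₂ • (X₁ ⊗ₜ[k] X₃)) (y ⊗ₜ x) := by
    refine tensor_ext₃ (by fun_prop) (by fun_prop) fun a b d => ?_
    simp (disch := fun_prop) only [sw3_pure]
    simp [lunitIso, mkIso, smul_smul, mul_comm]
  rw [key, Q.cocycle_counit]
  simp [runitIso, mkIso, TensorProduct.smul_tmul']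

theorem associator_naturality' {U U' V V' W W' : QMod 𝓡} (f : U ⟶ U') (g : V ⟶ V') (h : W ⟶ W') :
    tensorMap (tensorMap f g) h ≫ (assocIso U' V' W').hom =
      (assocIso U V W).hom ≫ tensorMap f (tensorMap g h) := by
  ext z
  revert z
  refine tensor_ext (by fun_prop) (by fun_prop) fun y w => ?_
  revert y
  refine tensor_ext (by fun_prop) (by fun_prop) fun u v => ?_
  change tact₃ U' V' W' Q.Φ.val (f.lin u ⊗ₜ (g.lin v ⊗ₜ h.lin w)) =
    TensorProduct.map f.lin (TensorProduct.map g.lin h.lin) (tact₃ U V W Q.Φ.val (u ⊗ₜ (v ⊗ₜ w)))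
  generalize Q.Φ.val = t
  revert t
  refine tensor_ext₃ (by fun_prop) (by fun_prop) fun a b d => ?_
  simp [f.comm, g.comm, h.comm]

end Pentagon

theorem tensor_hom_ext {U V W : QMod 𝓡} {f g : U ⊗ V ⟶ W}
    (h : ∀ (u : U.carrier) (v : V.carrier), f.lin (u ⊗ₜ v) = g.lin (u ⊗ₜ v)) : f = g :=
  Hom.ext (TensorProduct.ext' h)

noncomputable instance : MonoidalCategory (QMod 𝓡) :=
  MonoidalCategory.ofTensorHom
    (id_tensorHom_id := fun U V => tensor_hom_ext fun u v => rfl)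
    (id_tensorHom := fun U _ _ f => rfl)
    (tensorHom_id := fun f V => rfl)
    (tensorHom_comp_tensorHom := fun f g h i => tensor_hom_ext fun u v => rfl)
    (associator_naturality := associator_naturality')
    (leftUnitor_naturality := fun f => tensor_hom_ext fun c v => by
      change (lunitIso _).hom.lin (c ⊗ₜ f.lin v) = f.lin ((lunitIso _).hom.lin (c ⊗ₜ v))
      simp [lunitIso, mkIso])
    (rightUnitor_naturality := fun f => tensor_hom_ext fun v c => by
      change (runitIso _).hom.lin (f.lin v ⊗ₜ c) = f.lin ((runitIso _).hom.lin (v ⊗ₜ c))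
      simp [runitIso, mkIso])
    (pentagon := pentagon')
    (triangle := triangle')

section Lin

variable {U V W : QMod 𝓡}

theorem associator_inv_lin (x : U.carrier ⊗[k] (V.carrier ⊗[k] W.carrier)) :
    (α_ U V W).inv.lin x = (TensorProduct.assoc k _ _ _).symm (tact₃ U V W Q.Φ⁻¹.val x) := rfl

theorem leftUnitor_hom_lin (c : ULift.{v} k) (v : V.carrier) :
    (λ_ V).hom.lin (c ⊗ₜ v) = c.down • v := rfl

theorem rightUnitor_hom_lin (c : ULift.{v} k) (v : V.carrier) :
    (ρ_ V).hom.lin (v ⊗ₜ c) = c.down • v := rfl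

theorem rightUnitor_inv_lin (v : V.carrier) : (ρ_ V).inv.lin v = v ⊗ₜ (1 : ULift.{v} k) := rfl

end Lin

end QMod

/-! ### The symmetry defined by the $R$-matrix -/

namespace QMod

variable {k : Type u} {H : Type v} [Field k] [Ring H] [Algebra k H] {Q : QuasiHopfAlgebra k H}
  {𝓡 : RMatrix Q}

theorem comm_comm {M N : Type*} [AddCommGroup M] [Module k M] [AddCommGroup N] [Module k N]
    (x : M ⊗[k] N) : TensorProduct.comm k N M (TensorProduct.comm k M N x) = x := by
  revert x
  exact tensor_ext (by fun_prop) (by fun_prop) fun m n => by simp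

theorem tact_comm (V W : QMod 𝓡) (t : H ⊗[k] H) (x : V.carrier ⊗[k] W.carrier) :
    TensorProduct.comm k _ _ (tact V.act W.act t x) =
      tact W.act V.act (TensorProduct.comm k H H t) (TensorProduct.comm k _ _ x) := by
  revert t
  refine tensor_ext (by fun_prop) (by fun_prop) fun a b => ?_
  revert x
  exact tensor_ext (by fun_prop) (by fun_prop) fun m n => by simp

/-- The braiding morphism `v ⊗ w ↦ R² w ⊗ R¹ v`. -/
noncomputable def braidHom (V W : QMod 𝓡) : tensor V W ⟶ tensor W V where
  lin := (TensorProduct.comm k _ _).toLinearMap ∘ₗ tact V.act W.act 𝓡.R.val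
  comm h x := by
    change TensorProduct.comm k _ _ (tact V.act W.act 𝓡.R.val (tact V.act W.act (Q.Δ h) x)) =
      tact W.act V.act (Q.Δ h) (TensorProduct.comm k _ _ (tact V.act W.act 𝓡.R.val x))
    rw [← Module.End.mul_apply, ← map_mul, ← 𝓡.Δ_op, map_mul, Module.End.mul_apply,
      tact_comm, comm_comm]

theorem braidHom_braidHom (h𝓡 : 𝓡.IsTriangular) (V W : QMod 𝓡) :
    braidHom V W ≫ braidHom W V = 𝟙 _ := by
  ext x
  change TensorProduct.comm k _ _ (tact W.act V.act 𝓡.R.val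
    (TensorProduct.comm k _ _ (tact V.act W.act 𝓡.R.val x))) = x
  rw [tact_comm, comm_comm, ← h𝓡, ← Module.End.mul_apply, ← map_mul, Units.inv_mul, map_one]
  rfl

theorem braidHom_naturality {V V' W W' : QMod 𝓡} (f : V ⟶ V') (g : W ⟶ W') :
    tensorMap f g ≫ braidHom V' W' = braidHom V W ≫ tensorMap g f := by
  ext x
  revert x
  refine tensor_ext (by fun_prop) (by fun_prop) fun v w => ?_
  change TensorProduct.comm k _ _ (tact V'.act W'.act 𝓡.R.val (f.lin v ⊗ₜ g.lin w)) =
    TensorProduct.map g.lin f.lin (TensorProduct.comm k _ _ (tact V.act W.act 𝓡.R.val (v ⊗ₜ w)))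
  generalize 𝓡.R.val = t
  revert t
  exact tensor_ext (by fun_prop) (by fun_prop) fun a b => by simp [f.comm, g.comm]

/-- The cyclic permutation `a ⊗ b ⊗ c ↦ b ⊗ c ⊗ a`. -/
noncomputable def cyc : H ⊗[k] (H ⊗[k] H) ≃ₐ[k] H ⊗[k] (H ⊗[k] H) :=
  (Algebra.TensorProduct.comm k H (H ⊗[k] H)).trans (Algebra.TensorProduct.assoc k k k H H H)

/-- The permutation `a ⊗ b ⊗ c ↦ a ⊗ c ⊗ b`. -/
noncomputable def swap₂₃ : H ⊗[k] (H ⊗[k] H) ≃ₐ[k] H ⊗[k] (H ⊗[k] H) :=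
  Algebra.TensorProduct.congr AlgEquiv.refl (Algebra.TensorProduct.comm k H H)

@[simp] theorem cyc_tmul (a b c : H) : cyc (a ⊗ₜ[k] (b ⊗ₜ[k] c)) = b ⊗ₜ (c ⊗ₜ a) := by
  simp [cyc]

@[simp] theorem swap₂₃_tmul (a b c : H) : swap₂₃ (a ⊗ₜ[k] (b ⊗ₜ[k] c)) = a ⊗ₜ (c ⊗ₜ b) := by
  simp [swap₂₃]

/-- The formula for $(id\otimes\Delta)(R)$ with its outer factors $\Phi^{-1}$ moved across, after a
cyclic permutation of the legs. It serves both for the hexagon and for the coassociativity of the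
coaction $R^2\otimes R^1\cdot m$. -/
theorem hexagon_element :
    Q.Φ.val * cyc ((sw 𝓡.R.val fun R₁ R₂ => R₁ ⊗ₜ[k] Q.Δ R₂) * Q.Φ.val) =
    swap₂₃ ((1 ⊗ₜ 𝓡.R.val) * Q.Φ.val * sw 𝓡.R.val fun R₁ R₂ => R₂ ⊗ₜ[k] (R₁ ⊗ₜ[k] (1 : H))) := by
  have e₁ : ∀ t : H ⊗[k] (H ⊗[k] H),
      cyc (sw3 t (fun x₁ x₂ x₃ => x₃ ⊗ₜ[k] (x₁ ⊗ₜ[k] x₂))) = t :=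
    tensor_ext₃ (by fun_prop) (by fun_prop) fun a b c => by simp (disch := fun_prop) [sw3_pure]
  have e₂ : ∀ t : H ⊗[k] H, cyc (sw t (fun R₁ R₂ => R₁ ⊗ₜ[k] ((1 : H) ⊗ₜ[k] R₂))) =
      swap₂₃ ((1 : H) ⊗ₜ t) :=
    tensor_ext (by fun_prop) (by fun_prop) fun a b => by simp (disch := fun_prop) [sw_pure]
  have e₃ : ∀ t : H ⊗[k] (H ⊗[k] H),
      cyc (sw3 t (fun x₁ x₂ x₃ => x₂ ⊗ₜ[k] (x₁ ⊗ₜ[k] x₃))) = swap₂₃ t :=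
    tensor_ext₃ (by fun_prop) (by fun_prop) fun a b c => by simp (disch := fun_prop) [sw3_pure]
  have e₄ : ∀ t : H ⊗[k] H, cyc (sw t (fun R₁ R₂ => R₁ ⊗ₜ[k] (R₂ ⊗ₜ[k] (1 : H)))) =
      swap₂₃ (sw t fun R₁ R₂ => R₂ ⊗ₜ[k] (R₁ ⊗ₜ[k] (1 : H))) :=
    tensor_ext (by fun_prop) (by fun_prop) fun a b => by simp (disch := fun_prop) [sw_pure]
  rw [𝓡.Δ_right]
  simp only [map_mul, e₁, e₂, e₃, e₄]
  have i : cyc Q.Φ⁻¹.val * cyc Q.Φ.val = 1 := by rw [← map_mul, Units.inv_mul, map_one]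
  simp only [mul_assoc, i, mul_one, Units.mul_inv_cancel_left]

theorem hexagon' (X Y Z : QMod 𝓡) :
    (assocIso X Y Z).hom ≫ braidHom X (tensor Y Z) ≫ (assocIso Y Z X).hom =
      tensorMap (braidHom X Y) (𝟙 Z) ≫ (assocIso Y X Z).hom ≫ tensorMap (𝟙 Y) (braidHom X Z) := by
  ext x
  revert x
  refine tensor_ext (by fun_prop) (by fun_prop) fun y z => ?_
  revert y
  refine tensor_ext (by fun_prop) (by fun_prop) fun x y => ?_
  change tact₃ Y Z X Q.Φ.val (TensorProduct.assoc k _ _ _ (TensorProduct.comm k _ _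
    (tact X.act (tensor Y Z).act 𝓡.R.val (tact₃ X Y Z Q.Φ.val (x ⊗ₜ (y ⊗ₜ z)))))) =
    TensorProduct.map LinearMap.id ((TensorProduct.comm k _ _).toLinearMap ∘ₗ
      tact X.act Z.act 𝓡.R.val) (tact₃ Y X Z Q.Φ.val (TensorProduct.assoc k _ _ _
        (TensorProduct.comm k _ _ (tact X.act Y.act 𝓡.R.val (x ⊗ₜ y)) ⊗ₜ z)))
  have e₁ : ∀ t w, tact X.act (tensor Y Z).act t w =
      tact₃ X Y Z (sw t fun R₁ R₂ => R₁ ⊗ₜ[k] Q.Δ R₂) w := by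
    intro t w
    revert t
    refine tensor_ext (by fun_prop) (by fun_prop) fun a b => ?_
    simp (disch := fun_prop) [sw_pure]
  have e₂ : ∀ t w, TensorProduct.assoc k _ _ _ (TensorProduct.comm k _ _ (tact₃ X Y Z t w)) =
      tact₃ Y Z X (cyc t) (TensorProduct.assoc k _ _ _ (TensorProduct.comm k _ _ w)) := by
    intro t w
    revert t
    refine tensor_ext₃ (by fun_prop) (by fun_prop) fun a b c => ?_
    revert w
    exact tensor_ext₃ (by fun_prop) (by fun_prop) fun x y z => by simp
  have e₃ : ∀ t, TensorProduct.assoc k _ _ _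
        (TensorProduct.comm k _ _ (tact X.act Y.act t (x ⊗ₜ y)) ⊗ₜ z) =
      tact₃ Y X Z (sw t fun R₁ R₂ => R₂ ⊗ₜ[k] (R₁ ⊗ₜ[k] (1 : H))) (y ⊗ₜ (x ⊗ₜ z)) := by
    refine tensor_ext (by fun_prop) (by fun_prop) fun a b => ?_
    simp (disch := fun_prop) [sw_pure]
  have e₄ : ∀ t w, TensorProduct.map LinearMap.id (tact X.act Z.act t) w =
      tact₃ Y X Z ((1 : H) ⊗ₜ t) w := by
    intro t w
    simp [Module.End.one_eq_id]
  have e₅ : ∀ t w, TensorProduct.map LinearMap.id (TensorProduct.comm k _ _).toLinearMap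
      (tact₃ Y X Z t w) = tact₃ Y Z X (swap₂₃ t)
        (TensorProduct.map LinearMap.id (TensorProduct.comm k _ _).toLinearMap w) := by
    intro t w
    revert t
    refine tensor_ext₃ (by fun_prop) (by fun_prop) fun a b c => ?_
    revert w
    exact tensor_ext₃ (by fun_prop) (by fun_prop) fun x y z => by simp
  rw [show (LinearMap.id : Y.carrier →ₗ[k] Y.carrier) = LinearMap.id ∘ₗ LinearMap.id from rfl,
    TensorProduct.map_comp, LinearMap.comp_apply, e₁, e₂, e₂, e₃, e₄]
  simp only [← Module.End.mul_apply, ← map_mul]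
  rw [e₅, ← mul_assoc, hexagon_element (𝓡 := 𝓡)]
  simp

noncomputable instance [h𝓡 : Fact 𝓡.IsTriangular] : BraidedCategory (QMod 𝓡) where
  braiding V W := ⟨braidHom V W, braidHom W V, braidHom_braidHom h𝓡.out V W,
    braidHom_braidHom h𝓡.out W V⟩
  braiding_naturality_right X _ _ f := braidHom_naturality (𝟙 X) f
  braiding_naturality_left f Z := braidHom_naturality f (𝟙 Z)
  hexagon_forward := hexagon'
  -- The braiding is its own inverse, so the reverse hexagon is the inverse of the forward one.
  hexagon_reverse X Y Z := by
    let b (V W : QMod 𝓡) : V ⊗ W ≅ W ⊗ V := ⟨braidHom V W, braidHom W V,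
      braidHom_braidHom h𝓡.out V W, braidHom_braidHom h𝓡.out W V⟩
    have h : α_ Z X Y ≪≫ b Z (X ⊗ Y) ≪≫ α_ X Y Z =
      whiskerRightIso (b Z X) Y ≪≫ α_ X Z Y ≪≫ whiskerLeftIso X (b Z Y) := Iso.ext (hexagon' Z X Y)
    simpa [b] using congrArg Iso.inv h

noncomputable instance [h𝓡 : Fact 𝓡.IsTriangular] : SymmetricCategory (QMod 𝓡) where
  symmetry V W := braidHom_braidHom h𝓡.out V W

end QMod

theorem QuasiHopfAlgebra.S_one {k H : Type*} [Field k] [Ring H] [Algebra k H]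
    (Q : QuasiHopfAlgebra k H) : Q.S 1 = 1 := by
  have h : ∀ x, Q.S 1 * x = x := fun x => by
    obtain ⟨y, rfl⟩ := Q.S.surjective x
    rw [← Q.S_mul, mul_one]
  simpa using h 1

/-! ### Duals of modules -/

namespace QMod

variable {k : Type u} {H : Type v} [Field k] [Ring H] [Algebra k H] {Q : QuasiHopfAlgebra k H}
  {𝓡 : RMatrix Q}

/-- `D` is identified with the linear dual of `V`, with the action `(h φ)(v) = φ(S(h) v)`. -/
class DualPair (V D : QMod 𝓡) where
  /-- the identification -/
  pair : D.carrier ≃ₗ[k] Module.Dual k V.carrier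
  pair_act : ∀ h φ v, pair (D.act h φ) v = pair φ (V.act (Q.S h) v)

section DualPair

variable (V D : QMod 𝓡) [DualPair V D]

/-- The pairing of a module with its dual. -/
noncomputable def pairing : D.carrier →ₗ[k] V.carrier →ₗ[k] k :=
  (DualPair.pair : D.carrier ≃ₗ[k] Module.Dual k V.carrier).toLinearMap

@[simp]
theorem pairing_act (h : H) (φ : D.carrier) (v : V.carrier) :
    pairing V D (D.act h φ) v = pairing V D φ (V.act (Q.S h) v) :=
  DualPair.pair_act h φ v

theorem pairing_ext {φ ψ : D.carrier} (h : ∀ v, pairing V D φ v = pairing V D ψ v) : φ = ψ :=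
  (DualPair.pair : D.carrier ≃ₗ[k] Module.Dual k V.carrier).injective (LinearMap.ext h)

theorem eq_of_pairing {v w : V.carrier} (h : ∀ φ, pairing V D φ v = pairing V D φ w) : v = w := by
  rw [← sub_eq_zero, ← Module.forall_dual_apply_eq_zero_iff k]
  intro φ
  obtain ⟨φ, rfl⟩ := (DualPair.pair : D.carrier ≃ₗ[k] Module.Dual k V.carrier).surjective φ
  rw [map_sub, sub_eq_zero]
  exact h φ

/-- The identification of `V ⊗ V*` with the endomorphisms of `V`. -/
noncomputable def endo : V.carrier ⊗[k] D.carrier ≃ₗ[k] Module.End k V.carrier :=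
  ((TensorProduct.congr (LinearEquiv.refl k V.carrier) DualPair.pair).trans
    (TensorProduct.comm k V.carrier (Module.Dual k V.carrier))).trans
    (dualTensorHomEquiv k V.carrier V.carrier)

@[simp]
theorem endo_tmul (v : V.carrier) (φ : D.carrier) (x : V.carrier) :
    endo V D (v ⊗ₜ φ) x = pairing V D φ x • v := by
  simp [endo, pairing]

@[simp]
theorem endo_tact (a b : H) (x : V.carrier ⊗[k] D.carrier) :
    endo V D (TensorProduct.map (V.act a) (D.act b) x) =
      V.act a * endo V D x * V.act (Q.S b) := by
  revert x
  refine tensor_ext (by fun_prop) (by fun_prop) fun m φ => ?_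
  ext x
  simp

/-- Acting on $V\otimes V^*$ by $\Delta(h)$ turns the operator of $b$ into that of $h_1bS(h_2)$. For
$b=\beta$ this makes the coevaluation linear; for general $b$ it makes the representation linear for
the adjoint action. -/
theorem endo_coev (b : H) (t : H ⊗[k] H) :
    tact V.act D.act t ((endo V D).symm (V.act b)) =
      (endo V D).symm (V.act (sw t fun h₁ h₂ => h₁ * b * Q.S h₂)) := by
  apply (endo V D).injective
  rw [LinearEquiv.apply_symm_apply]
  revert t
  refine tensor_ext (by fun_prop) (by fun_prop) fun a c => ?_
  simp (disch := fun_prop) [sw_pure]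

/-- The coevaluation. -/
noncomputable def coevHom : triv ⟶ tensor V D where
  lin := LinearMap.toSpanSingleton k _ ((endo V D).symm (V.act Q.β)) ∘ₗ
    ULift.moduleEquiv.toLinearMap
  comm h c := by
    have := endo_coev V D Q.β (Q.Δ h)
    rw [Q.S_β] at this
    change (Q.ε h • c).down • _ = tact V.act D.act (Q.Δ h) (c.down • _)
    rw [map_smul, this, map_smul, map_smul, ULift.smul_down, smul_eq_mul, mul_comm, mul_smul]

theorem pairing_tact (b : H) (t : H ⊗[k] H) (x : D.carrier ⊗[k] V.carrier) :
    TensorProduct.lift (pairing V D) (TensorProduct.map LinearMap.id (V.act b)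
      (tact D.act V.act t x)) = TensorProduct.lift (pairing V D)
        (TensorProduct.map LinearMap.id (V.act (sw t fun h₁ h₂ => Q.S h₁ * b * h₂)) x) := by
  revert t
  refine tensor_ext (by fun_prop) (by fun_prop) fun a c => ?_
  revert x
  refine tensor_ext (by fun_prop) (by fun_prop) fun φ v => ?_
  simp (disch := fun_prop) [sw_pure]

/-- The evaluation `φ ⊗ v ↦ φ(α v)`. -/
noncomputable def evHom : tensor D V ⟶ triv where
  lin := ULift.moduleEquiv.symm.toLinearMap ∘ₗ TensorProduct.lift (pairing V D) ∘ₗ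
    TensorProduct.map LinearMap.id (V.act Q.α)
  comm h x := by
    have := pairing_tact V D Q.α (Q.Δ h) x
    rw [Q.S_α] at this
    change ULift.up (TensorProduct.lift (pairing V D) (TensorProduct.map LinearMap.id (V.act Q.α)
      (tact D.act V.act (Q.Δ h) x))) = Q.ε h • ULift.up _
    rw [this]
    simp [TensorProduct.map_smul_right, ULift.ext_iff]

/-- The linear form `φ ⊗ v ↦ φ(α v)`. -/
noncomputable def evLin : D.carrier ⊗[k] V.carrier →ₗ[k] k :=
  TensorProduct.lift (pairing V D) ∘ₗ TensorProduct.map LinearMap.id (V.act Q.α)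

@[simp]
theorem evLin_tmul (φ : D.carrier) (v : V.carrier) :
    evLin V D (φ ⊗ₜ v) = pairing V D φ (V.act Q.α v) := by
  simp [evLin]

theorem whiskerRight_evHom (X : QMod 𝓡) (z : (D.carrier ⊗[k] V.carrier) ⊗[k] X.carrier) :
    (λ_ X).hom.lin ((evHom V D ▷ X).lin z) =
      TensorProduct.lid k _ (TensorProduct.map (evLin V D) LinearMap.id z) := by
  revert z
  refine tensor_ext (isLinearMap_comp (λ_ X).hom.lin.isLinear (LinearMap.isLinear _))
      (by fun_prop) fun y ψ => ?_
  rw [whiskerRight_lin]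
  simp only [TensorProduct.map_tmul, TensorProduct.lid_tmul]
  rfl

theorem whiskerLeft_evHom (X : QMod 𝓡) (z : X.carrier ⊗[k] (D.carrier ⊗[k] V.carrier)) :
    (ρ_ X).hom.lin ((X ◁ evHom V D).lin z) =
      TensorProduct.rid k _ (TensorProduct.map LinearMap.id (evLin V D) z) := by
  revert z
  refine tensor_ext (isLinearMap_comp (ρ_ X).hom.lin.isLinear (LinearMap.isLinear _))
      (by fun_prop) fun y ψ => ?_
  rw [whiskerLeft_lin]
  simp only [TensorProduct.map_tmul, TensorProduct.rid_tmul]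
  rfl

theorem coev_ev_aux (φ : D.carrier) (v : V.carrier) (t : H ⊗[k] (H ⊗[k] H))
    (x : V.carrier ⊗[k] D.carrier) :
    pairing V D (TensorProduct.lid k _ (TensorProduct.map
      (evLin V D) LinearMap.id
        ((TensorProduct.assoc k _ _ _).symm (tact₃ D V D t (φ ⊗ₜ x))))) v =
      pairing V D φ ((sw3 t fun X₁ X₂ X₃ =>
        V.act (Q.S X₁ * Q.α * X₂) * endo V D x * V.act (Q.S X₃)) v) := by
  revert t
  refine tensor_ext₃ (by fun_prop) (by fun_prop) fun a b d => ?_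
  simp (disch := fun_prop) only [sw3_pure]
  revert x
  refine tensor_ext (by fun_prop) (by fun_prop) fun w ψ => ?_
  simp [mul_comm]

/-- On operators this zigzag is the antipode axiom $S(x^1)\alpha x^2\beta S(x^3)=1$; the other
zigzag is $X^1\beta S(X^2)\alpha X^3=1$. -/
theorem coev_ev : D ◁ coevHom V D ≫ (α_ D V D).inv ≫ evHom V D ▷ D = (ρ_ D).hom ≫ (λ_ D).inv := by
  rw [← cancel_mono (λ_ D).hom]
  refine tensor_hom_ext fun φ c => pairing_ext V D fun v => ?_
  have := coev_ev_aux V D φ v Q.Φ⁻¹.val (c.down • (endo V D).symm (V.act Q.β))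
  have e := congrArg (pairing V D φ) (LinearMap.congr_fun (sw3_map (E := fun h => V.act h)
    (by fun_prop) Q.Φ⁻¹.val fun x₁ x₂ x₃ => Q.S x₁ * Q.α * x₂ * Q.β * Q.S x₃) v)
  rw [Q.Φ_α_β] at e
  simp only [map_smul, LinearEquiv.apply_symm_apply, mul_smul_comm, smul_mul_assoc,
    sw3_smul_right, ← map_mul] at this
  rw [LinearMap.smul_apply, map_smul] at this
  simp only [mul_assoc] at this e
  rw [← e, map_one] at this
  simp only [Category.assoc, Iso.inv_hom_id, Category.comp_id]
  rw [comp_lin, comp_lin, comp_lin, rightUnitor_hom_lin]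
  refine Eq.trans ?_ (this.trans (by simp))
  exact congrArg (fun y => pairing V D y v) (whiskerRight_evHom V D D _)

theorem ev_coev_aux (w : V.carrier) (t : H ⊗[k] (H ⊗[k] H)) (x : V.carrier ⊗[k] D.carrier) :
    TensorProduct.rid k _ (TensorProduct.map LinearMap.id
      (evLin V D)
        (tact₃ V D V t (TensorProduct.assoc k _ _ _ (x ⊗ₜ w)))) =
      (sw3 t fun X₁ X₂ X₃ => V.act X₁ * endo V D x * V.act (Q.S X₂ * Q.α * X₃)) w := by
  revert t
  refine tensor_ext₃ (by fun_prop) (by fun_prop) fun a b d => ?_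
  simp (disch := fun_prop) only [sw3_pure]
  revert x
  refine tensor_ext (by fun_prop) (by fun_prop) fun w ψ => ?_
  simp

theorem ev_coev : coevHom V D ▷ V ≫ (α_ V D V).hom ≫ V ◁ evHom V D = (λ_ V).hom ≫ (ρ_ V).inv := by
  rw [← cancel_mono (ρ_ V).hom]
  refine tensor_hom_ext fun c w => ?_
  have := ev_coev_aux V D w Q.Φ.val (c.down • (endo V D).symm (V.act Q.β))
  have e := LinearMap.congr_fun (sw3_map (E := fun h => V.act h)
    (by fun_prop) Q.Φ.val fun x₁ x₂ x₃ => x₁ * Q.β * Q.S x₂ * Q.α * x₃) w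
  rw [Q.Φ_β_α] at e
  simp only [map_smul, LinearEquiv.apply_symm_apply, mul_smul_comm, smul_mul_assoc,
    sw3_smul_right, ← map_mul] at this
  rw [LinearMap.smul_apply] at this
  simp only [mul_assoc] at this e
  rw [← e, map_one] at this
  simp only [Category.assoc, Iso.inv_hom_id, Category.comp_id]
  rw [comp_lin, comp_lin, comp_lin, leftUnitor_hom_lin]
  refine Eq.trans ?_ (this.trans (by simp))
  exact whiskerLeft_evHom V D V _

noncomputable instance : ExactPairing V D where
  coevaluation' := coevHom V D
  evaluation' := evHom V D
  coevaluation_evaluation' := coev_ev V D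
  evaluation_coevaluation' := ev_coev V D

theorem evaluation_lin (φ : D.carrier) (v : V.carrier) :
    (ε_ V D).lin (φ ⊗ₜ v) = ULift.up (pairing V D φ (V.act Q.α v)) := rfl

theorem coevaluation_lin (c : ULift.{v} k) :
    (η_ V D).lin c = c.down • (endo V D).symm (V.act Q.β) := rfl

end DualPair

/-- The action `(h φ)(v) = φ(S(h) v)` on the dual of a module. -/
noncomputable def dualAct (V : QMod 𝓡) : H →ₐ[k] Module.End k (Module.Dual k V.carrier) where
  toFun := fun h => Module.Dual.transpose (V.act (Q.S h))
  map_one' := by ext φ v; simp [Q.S_one, Module.Dual.transpose]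
  map_mul' := fun a b => by ext φ v; simp [Q.S_mul, Module.Dual.transpose]
  map_zero' := by ext φ v; simp [Module.Dual.transpose]
  map_add' := fun a b => by ext φ v; simp [Module.Dual.transpose]
  commutes' := fun c => by
    ext φ v
    simp [Module.Dual.transpose, Algebra.algebraMap_eq_smul_one, Q.S_one]

/-- The dual of a module. -/
noncomputable def dual (V : QMod 𝓡) : QMod 𝓡 where
  carrier := Module.Dual k V.carrier
  act := dualAct V

noncomputable instance (V : QMod 𝓡) : DualPair V (dual V) where
  pair := LinearEquiv.refl k _
  pair_act _ _ _ := rfl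

end QMod

theorem sw4_pure {k A B C D M : Type*} [Field k] [AddCommGroup A] [Module k A] [AddCommGroup B]
    [Module k B] [AddCommGroup C] [Module k C] [AddCommGroup D] [Module k D] [AddCommGroup M]
    [Module k M] {F : A → B → C → D → M} (h₁ : ∀ b c d, IsLinearMap k fun a => F a b c d)
    (h₂ : ∀ a c d, IsLinearMap k fun b => F a b c d)
    (h₃ : ∀ a b d, IsLinearMap k fun c => F a b c d)
    (h₄ : ∀ a b c, IsLinearMap k fun d => F a b c d)
    (a : A) (b : B) (c : C) (d : D) : sw4 (a ⊗ₜ[k] (b ⊗ₜ[k] (c ⊗ₜ[k] d))) F = F a b c d := by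
  unfold sw4
  rw [sw_pure, sw3_pure] <;> intros <;> fun_prop

@[fun_prop]
theorem isLinearMap_sw4_left {k A B C D M N : Type*} [Field k] [AddCommGroup A] [Module k A]
    [AddCommGroup B] [Module k B] [AddCommGroup C] [Module k C] [AddCommGroup D] [Module k D]
    [AddCommGroup M] [Module k M] [AddCommGroup N] [Module k N]
    {f : M → A ⊗[k] (B ⊗[k] (C ⊗[k] D))} (hf : IsLinearMap k f)
    (F : A → B → C → D → N) : IsLinearMap k (fun x => sw4 (f x) F) := by
  unfold sw4; fun_prop

@[fun_prop]
theorem isLinearMap_sw4_right {k A B C D M N : Type*} [Field k] [AddCommGroup A] [Module k A]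
    [AddCommGroup B] [Module k B] [AddCommGroup C] [Module k C] [AddCommGroup D] [Module k D]
    [AddCommGroup M] [Module k M] [AddCommGroup N] [Module k N] {F : M → A → B → C → D → N}
    (hF : ∀ a b c d, IsLinearMap k fun x => F x a b c d)
    (t : A ⊗[k] (B ⊗[k] (C ⊗[k] D))) : IsLinearMap k (fun x => sw4 t (F x)) := by
  unfold sw4; fun_prop

theorem sw4_map {k A B C D M N : Type*} [Field k] [AddCommGroup A] [Module k A]
    [AddCommGroup B] [Module k B] [AddCommGroup C] [Module k C] [AddCommGroup D] [Module k D]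
    [AddCommGroup M] [Module k M] [AddCommGroup N] [Module k N] {L : M → N} (hL : IsLinearMap k L)
    (t : A ⊗[k] (B ⊗[k] (C ⊗[k] D))) (F : A → B → C → D → M) :
    L (sw4 t F) = sw4 t fun a b c d => L (F a b c d) := by
  simp only [sw4, sw_map hL, sw3_map hL]

section Mul₄

variable {k H M : Type*} [Field k] [Ring H] [Algebra k H] [AddCommMonoid M] [Module k M]
  {f : M → H ⊗[k] (H ⊗[k] (H ⊗[k] H))}

@[fun_prop]
theorem isLinearMap_mul₄_left (hf : IsLinearMap k f) (y : H ⊗[k] (H ⊗[k] (H ⊗[k] H))) :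
    IsLinearMap k (fun x => f x * y) :=
  ⟨fun x z => by
    rw [hf.map_add]; exact @add_mul (H ⊗[k] (H ⊗[k] (H ⊗[k] H))) _ _ (Distrib.rightDistribClass _) (f x) (f z) y,
   fun c x => by
    rw [hf.map_smul]; exact @smul_mul_assoc k (H ⊗[k] (H ⊗[k] (H ⊗[k] H))) _ _ _ c (f x) y⟩

@[fun_prop]
theorem isLinearMap_mul₄_right (hf : IsLinearMap k f) (y : H ⊗[k] (H ⊗[k] (H ⊗[k] H))) :
    IsLinearMap k (fun x => y * f x) :=
  ⟨fun x z => by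
    rw [hf.map_add]; exact @mul_add (H ⊗[k] (H ⊗[k] (H ⊗[k] H))) _ _ (Distrib.leftDistribClass _) y (f x) (f z),
   fun c x => by
    rw [hf.map_smul]; exact @mul_smul_comm k (H ⊗[k] (H ⊗[k] (H ⊗[k] H))) _ _ _ c y (f x)⟩

end Mul₄

/-- The action of an element of `V ⊗ V*` on `V`, for a bilinear form on `V* × V`. -/
noncomputable def contract {k X Y : Type*} [Field k] [AddCommGroup X] [Module k X] [AddCommGroup Y]
    [Module k Y] (N : Y →ₗ[k] X →ₗ[k] k) : X ⊗[k] Y →ₗ[k] X →ₗ[k] X :=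
  LinearMap.compr₂ (TensorProduct.mk k _ _) ((TensorProduct.rid k _).toLinearMap ∘ₗ
    TensorProduct.map LinearMap.id (TensorProduct.lift N) ∘ₗ
      (TensorProduct.assoc k _ _ _).toLinearMap)

@[simp]
theorem contract_tmul {k X Y : Type*} [Field k] [AddCommGroup X] [Module k X] [AddCommGroup Y]
    [Module k Y] (N : Y →ₗ[k] X →ₗ[k] k) (x : X) (θ : Y) (y : X) :
    contract N (x ⊗ₜ θ) y = N θ y • x := by
  simp [contract]

/-! ### The Drinfeld twist as a comparison of duals -/

namespace QMod

variable {k : Type u} {H : Type v} [Field k] [Ring H] [Algebra k H] {Q : QuasiHopfAlgebra k H}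
  {𝓡 : RMatrix Q}

section NestedPairing

variable (V W D E : QMod 𝓡) [DualPair V D] [DualPair W E]

/-- The pairing of `V ⊗ W` with `W* ⊗ V*`, with `(ψ ⊗ φ)(v ⊗ w) = φ(v) ψ(w)`. -/
noncomputable def nestedPairing :
    E.carrier ⊗[k] D.carrier ≃ₗ[k] Module.Dual k (V.carrier ⊗[k] W.carrier) :=
  ((TensorProduct.comm k _ _).trans (TensorProduct.congr DualPair.pair DualPair.pair)).trans
    (TensorProduct.dualDistribEquiv k V.carrier W.carrier)

@[simp]
theorem nestedPairing_tmul (ψ : E.carrier) (φ : D.carrier) (v : V.carrier) (w : W.carrier) :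
    nestedPairing V W D E (ψ ⊗ₜ φ) (v ⊗ₜ w) = pairing V D φ v * pairing W E ψ w := by
  simp [nestedPairing, pairing, TensorProduct.dualDistribEquiv, TensorProduct.dualDistribEquivOfBasis]

/-- The pairing of `V ⊗ W` with `W* ⊗ V*` as a bilinear map. -/
noncomputable def nestedForm :
    E.carrier ⊗[k] D.carrier →ₗ[k] V.carrier ⊗[k] W.carrier →ₗ[k] k :=
  (nestedPairing V W D E).toLinearMap

@[simp]
theorem nestedForm_tmul (ψ : E.carrier) (φ : D.carrier) (v : V.carrier) (w : W.carrier) :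
    nestedForm V W D E (ψ ⊗ₜ φ) (v ⊗ₜ w) = pairing V D φ v * pairing W E ψ w :=
  nestedPairing_tmul V W D E ψ φ v w

theorem nested_evaluation_aux (ψ : E.carrier) (φ : D.carrier) (v : V.carrier) (w : W.carrier)
    (t t' : H ⊗[k] (H ⊗[k] H)) :
    evLin W E (TensorProduct.map ((TensorProduct.rid k _).toLinearMap ∘ₗ
      TensorProduct.map LinearMap.id (evLin V D) ∘ₗ tact₃ E D V t ∘ₗ
        (TensorProduct.assoc k _ _ _).toLinearMap) LinearMap.id
      ((TensorProduct.assoc k _ _ _).symm (tact₃ (tensor E D) V W t' ((ψ ⊗ₜ φ) ⊗ₜ (v ⊗ₜ w))))) =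
    nestedForm V W D E (ψ ⊗ₜ φ) (tact V.act W.act
      (sw4 (sw3 t (fun X₁ X₂ X₃ => X₁ ⊗ₜ[k] (X₂ ⊗ₜ[k] (X₃ ⊗ₜ[k] (1 : H)))) *
      sw3 t' (fun x₁ x₂ x₃ => TensorProduct.assoc k H H (H ⊗[k] H) (Q.Δ x₁ ⊗ₜ[k] (x₂ ⊗ₜ[k] x₃))))
        fun A₁ A₂ A₃ A₄ => (Q.S A₂ * Q.α * A₃) ⊗ₜ[k] (Q.S A₁ * Q.α * A₄)) (v ⊗ₜ w)) := by
  revert t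
  refine tensor_ext₃ (by fun_prop) (by fun_prop) fun a b c => ?_
  revert t'
  refine tensor_ext₃ (by fun_prop) (by fun_prop) fun a' b' c' => ?_
  simp (disch := fun_prop) only [sw3_pure, tact_tmul, TensorProduct.map_tmul, tensorAct_apply]
  generalize Q.Δ a' = s
  revert s
  refine tensor_ext (by fun_prop) (by fun_prop) fun p q => ?_
  simp (disch := fun_prop) [sw4_pure, Q.S_mul]

/-- The categorical evaluation of $V\otimes W$ against $W^*\otimes V^*$ is the naive pairing
corrected by $\gamma$; the two associators assemble $A$ and the two evaluations insert $\alpha$. -/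
theorem nested_evaluation_lin (θ : E.carrier ⊗[k] D.carrier) (y : V.carrier ⊗[k] W.carrier) :
    (ε_ (V ⊗ W) (E ⊗ D)).lin (θ ⊗ₜ y) =
      ULift.up (nestedForm V W D E θ (tact V.act W.act Q.γ y)) := by
  revert θ
  refine tensor_ext (isLinearMap_comp (ε_ (V ⊗ W) (E ⊗ D)).lin.isLinear (isLinearMap_tmul_left isLinearMap_id _)) (isLinearMap_comp ULift.moduleEquiv.symm.toLinearMap.isLinear (by fun_prop)) fun ψ φ => ?_
  revert y
  refine tensor_ext (isLinearMap_comp (ε_ (V ⊗ W) (E ⊗ D)).lin.isLinear (isLinearMap_tmul_right isLinearMap_id _)) (isLinearMap_comp ULift.moduleEquiv.symm.toLinearMap.isLinear (by fun_prop)) fun v w => ?_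
  rw [nested_evaluation]
  refine Eq.trans ?_ (congrArg ULift.up (nested_evaluation_aux V W D E ψ φ v w Q.Φ.val Q.Φ⁻¹.val))
  rw [comp_lin, comp_lin, associator_inv_lin, whiskerRight_lin]
  change ULift.up (evLin W E _) = _
  congr 2
  refine congrFun (congrArg _ (congrArg (TensorProduct.map · LinearMap.id) ?_)) _
  ext x
  rw [comp_lin, comp_lin]
  exact whiskerLeft_evHom V D E _

theorem nested_coevaluation_aux (x : V.carrier ⊗[k] D.carrier) (z : W.carrier ⊗[k] E.carrier)
    (t t' : H ⊗[k] (H ⊗[k] H)) (y : V.carrier ⊗[k] W.carrier) :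
    TensorProduct.rid k _ (TensorProduct.map LinearMap.id (TensorProduct.lift (nestedForm V W D E))
      (TensorProduct.assoc k _ _ _ ((tact₃ (tensor V W) E D t (TensorProduct.assoc k _ _ _
        (TensorProduct.map ((TensorProduct.assoc k _ _ _).symm.toLinearMap ∘ₗ tact₃ V W E t' ∘ₗ
          (TensorProduct.mk k _ _).flip z) LinearMap.id x))) ⊗ₜ y))) =
    sw4 (sw3 t (fun X₁ X₂ X₃ => TensorProduct.assoc k H H (H ⊗[k] H) (Q.Δ X₁ ⊗ₜ[k] (X₂ ⊗ₜ[k] X₃))) *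
      sw3 t' (fun x₁ x₂ x₃ => x₁ ⊗ₜ[k] (x₂ ⊗ₜ[k] (x₃ ⊗ₜ[k] (1 : H)))))
      (fun B₁ B₂ B₃ B₄ => TensorProduct.map (V.act B₁ * endo V D x * V.act (Q.S B₄))
         (W.act B₂ * endo W E z * W.act (Q.S B₃)) y) := by
  revert t
  refine tensor_ext₃ (by fun_prop) (by fun_prop) fun a b c => ?_
  revert t'
  refine tensor_ext₃ (by fun_prop) (by fun_prop) fun a' b' c' => ?_
  revert x
  refine tensor_ext (by fun_prop) (by fun_prop) fun v φ => ?_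
  revert z
  refine tensor_ext (by fun_prop) (by fun_prop) fun w ψ => ?_
  revert y
  refine tensor_ext (by fun_prop) (by fun_prop) fun v' w' => ?_
  simp (disch := fun_prop) only [sw3_pure]
  simp [TensorProduct.smul_tmul']
  generalize Q.Δ a = s
  revert s
  refine tensor_ext (by fun_prop) (by fun_prop) fun p q => ?_
  simp (disch := fun_prop) [sw4_pure, mul_comm, Q.S_mul, smul_smul, TensorProduct.smul_tmul']

/-- The coevaluation of a dual pair as an element. -/
noncomputable def coevElt (X Y : QMod 𝓡) [ExactPairing X Y] : X.carrier ⊗[k] Y.carrier :=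
  (η_ X Y).lin (1 : ULift.{v} k)

theorem coevElt_eq : coevElt V D = (endo V D).symm (V.act Q.β) :=
  (coevaluation_lin V D _).trans (one_smul k _)

/-- Read as an operator on $V\otimes W$, the nested coevaluation is $\delta$: the associators
assemble $B$ and the coevaluations insert $\beta$. -/
theorem contract_nested_coevaluation :
    contract (nestedForm V W D E) (coevElt (V ⊗ W) (E ⊗ D)) =
      tact V.act W.act Q.δ := by
  refine LinearMap.ext fun y => ?_
  have := nested_coevaluation_aux V W D E (coevElt V D) (coevElt W E) Q.Φ.val Q.Φ⁻¹.val y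
  have e : coevElt (V ⊗ W) (E ⊗ D) = (tact₃ (tensor V W) E D Q.Φ.val (TensorProduct.assoc k _ _ _
        (TensorProduct.map ((TensorProduct.assoc k _ _ _).symm.toLinearMap ∘ₗ tact₃ V W E Q.Φ⁻¹.val ∘ₗ
          (TensorProduct.mk k _ _).flip (coevElt W E)) LinearMap.id (coevElt V D)))) := by
    unfold coevElt
    rw [nested_coevaluation]
    rfl
  rw [← e] at this
  refine this.trans ?_
  simp only [coevElt_eq, LinearEquiv.apply_symm_apply, ← map_mul, ← tact_tmul]
  exact (sw4_map (L := fun t => tact V.act W.act t y) (by fun_prop) _ _).symm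

section Comparison

variable {X Y T : QMod 𝓡} [ExactPairing X Y] [DualPair X T]
  (N : Y.carrier →ₗ[k] X.carrier →ₗ[k] k) (σ : H →ₗ[k] Module.End k X.carrier)
  (hσ : ∀ h θ x, N (Y.act h θ) x = N θ (σ h x))

-- $N$ is any bilinear form, not necessarily the evaluation, and $\sigma$ expresses the action on
-- $Y$ through it. For the naive pairing of $W^*\otimes V^*$ with $V\otimes W$, the operator on the
-- right is the definition of $g$.
include hσ in
theorem dualComparison_to_lin (τ : T.carrier) (x : X.carrier) :
    N ((dualComparison X T Y).lin τ) x = pairing X T τ ((sw3 Q.Φ⁻¹.val fun x₁ x₂ x₃ =>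
      X.act (Q.S x₁ * Q.α * x₂) * contract N (coevElt X Y) * σ x₃) x) := by
  have key : ∀ (t : H ⊗[k] (H ⊗[k] H)) (z : X.carrier ⊗[k] Y.carrier),
      N (TensorProduct.lid k _ (TensorProduct.map (evLin X T) LinearMap.id
        ((TensorProduct.assoc k _ _ _).symm (tact₃ T X Y t (τ ⊗ₜ z))))) x =
      pairing X T τ ((sw3 t fun x₁ x₂ x₃ =>
        X.act (Q.S x₁ * Q.α * x₂) * contract N z * σ x₃) x) := by
    intro t z
    revert t
    refine tensor_ext₃ (by fun_prop) (by fun_prop) fun a b d => ?_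
    simp (disch := fun_prop) only [sw3_pure]
    revert z
    refine tensor_ext (by fun_prop) (by fun_prop) fun w ψ => ?_
    simp [hσ, mul_comm]
  refine Eq.trans ?_ (key _ _)
  congr 2
  exact whiskerRight_evHom X T Y _

include hσ in
theorem dualComparison_from_lin (γ : Module.End k X.carrier)
    (hγ : ∀ θ x, (ε_ X Y).lin (θ ⊗ₜ x) = ULift.up (N θ (γ x))) (θ : Y.carrier) (x : X.carrier) :
    pairing X T ((dualComparison X Y T).lin θ) x = N θ ((sw3 Q.Φ⁻¹.val fun x₁ x₂ x₃ =>
      σ x₁ * γ * X.act (x₂ * Q.β * Q.S x₃)) x) := by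
  have key : ∀ (t : H ⊗[k] (H ⊗[k] H)) (z : X.carrier ⊗[k] T.carrier),
      pairing X T (TensorProduct.lid k _ (TensorProduct.map (TensorProduct.lift N ∘ₗ
        TensorProduct.map LinearMap.id γ) LinearMap.id
        ((TensorProduct.assoc k _ _ _).symm (tact₃ Y X T t (θ ⊗ₜ z))))) x =
      N θ ((sw3 t fun x₁ x₂ x₃ => σ x₁ * γ * (X.act x₂ * endo X T z * X.act (Q.S x₃))) x) := by
    intro t z
    revert t
    refine tensor_ext₃ (by fun_prop) (by fun_prop) fun a b d => ?_
    simp (disch := fun_prop) only [sw3_pure]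
    revert z
    refine tensor_ext (by fun_prop) (by fun_prop) fun w ψ => ?_
    simp [hσ, mul_comm]
  have e : ∀ z : (Y.carrier ⊗[k] X.carrier) ⊗[k] T.carrier,
      (λ_ T).hom.lin ((ε_ X Y ▷ T).lin z) = TensorProduct.lid k _ (TensorProduct.map
        (TensorProduct.lift N ∘ₗ TensorProduct.map LinearMap.id γ) LinearMap.id z) := by
    refine tensor_ext (isLinearMap_comp (λ_ T).hom.lin.isLinear (LinearMap.isLinear _))
      (by fun_prop) fun y ψ => ?_
    rw [whiskerRight_lin]
    revert y
    refine tensor_ext (isLinearMap_comp (λ_ T).hom.lin.isLinear (isLinearMap_comp (TensorProduct.map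
      (ε_ X Y).lin LinearMap.id).isLinear (isLinearMap_tmul_left isLinearMap_id _)))
      (by fun_prop) fun θ x => ?_
    rw [TensorProduct.map_tmul, leftUnitor_hom_lin, hγ]
    simp
  have := key Q.Φ⁻¹.val ((endo X T).symm (X.act Q.β))
  simp only [LinearEquiv.apply_symm_apply, ← map_mul] at this
  refine Eq.trans ?_ this
  congr 2
  rw [← coevElt_eq]
  exact e _

end Comparison

end NestedPairing
end QMod

theorem mul_eq_one_symm_of_finite {k A : Type*} [Field k] [Ring A] [Algebra k A]
    [FiniteDimensional k A] {a b : A} (h : a * b = 1) : b * a = 1 := by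
  have e : LinearMap.mulLeft k a * LinearMap.mulLeft k b = 1 := by
    ext x; simp [← mul_assoc, h]
  have := LinearMap.congr_fun (mul_eq_one_symm e) 1
  simpa using this

namespace QMod

variable {k : Type u} {H : Type v} [Field k] [Ring H] [Algebra k H] {Q : QuasiHopfAlgebra k H}
  {𝓡 : RMatrix Q}

section Twist

variable (V W D E T : QMod 𝓡) [DualPair V D] [DualPair W E] [DualPair (V ⊗ W) T]

theorem isLinearMap_SSΔop (Q : QuasiHopfAlgebra k H) : IsLinearMap k Q.SSΔop := by
  unfold QuasiHopfAlgebra.SSΔop; fun_prop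

theorem tensorObj_act (V W : QMod 𝓡) (h : H) : (V ⊗ W).act h = tact V.act W.act (Q.Δ h) := rfl

theorem nestedForm_tact (t : H ⊗[k] H) (θ : E.carrier ⊗[k] D.carrier)
    (y : V.carrier ⊗[k] W.carrier) : nestedForm V W D E (tact E.act D.act t θ) y =
      nestedForm V W D E θ (tact V.act W.act (sw t fun a b => Q.S b ⊗ₜ[k] Q.S a) y) := by
  revert t
  refine tensor_ext (by fun_prop) (by fun_prop) fun a b => ?_
  simp (disch := fun_prop) only [sw_pure]
  revert θ
  refine tensor_ext (by fun_prop) (by fun_prop) fun ψ φ => ?_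
  revert y
  refine tensor_ext (by fun_prop) (by fun_prop) fun v w => ?_
  simp

theorem nestedForm_act (h : H) (θ : E.carrier ⊗[k] D.carrier)
    (y : V.carrier ⊗[k] W.carrier) : nestedForm V W D E ((E ⊗ D).act h θ) y =
      nestedForm V W D E θ (tact V.act W.act (Q.SSΔop h) y) :=
  nestedForm_tact V W D E _ θ y

/-- Left multiplication by the twist gives the comparison of the dual of a tensor product with the
tensor product of the duals. -/
theorem dual_tensor_comparison (τ : T.carrier) (y : V.carrier ⊗[k] W.carrier) :
    nestedForm V W D E ((dualComparison (V ⊗ W) T (E ⊗ D)).lin τ) y =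
      pairing (V ⊗ W) T τ (tact V.act W.act Q.g y) := by
  refine (dualComparison_to_lin (X := V ⊗ W) (Y := E ⊗ D) (T := T) (nestedForm V W D E)
    ((tact V.act W.act).toLinearMap ∘ₗ (isLinearMap_SSΔop Q).mk') (nestedForm_act V W D E) τ y).trans ?_
  rw [contract_nested_coevaluation]
  congr 1
  refine congrArg (fun t : Module.End k _ => t y) ?_
  refine Eq.trans ?_ (sw3_map (E := fun t => tact V.act W.act t) (by fun_prop) _ _).symm
  simp only [map_mul, tensorObj_act]
  rfl

/-- The comparison in the opposite direction reproduces the definition of $f$, just as the previous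
one reproduces that of $g$. -/
theorem tensor_dual_comparison (θ : E.carrier ⊗[k] D.carrier) (y : V.carrier ⊗[k] W.carrier) :
    pairing (V ⊗ W) T ((dualComparison (V ⊗ W) (E ⊗ D) T).lin θ) y =
      nestedForm V W D E θ (tact V.act W.act Q.f y) := by
  refine (dualComparison_from_lin (X := V ⊗ W) (Y := E ⊗ D) (T := T) (nestedForm V W D E)
    ((tact V.act W.act).toLinearMap ∘ₗ (isLinearMap_SSΔop Q).mk') (nestedForm_act V W D E)
    (tact V.act W.act Q.γ) (nested_evaluation_lin V W D E) θ y).trans ?_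
  congr 1
  refine congrArg (fun t : Module.End k _ => t y) ?_
  refine Eq.trans ?_ (sw3_map (E := fun t => tact V.act W.act t) (by fun_prop) _ _).symm
  simp only [map_mul, tensorObj_act]
  rfl

-- The two comparison maps compose to the identity, which on operators is $gf=1$.
include D E in
theorem pairing_f_g (τ : T.carrier) (y : V.carrier ⊗[k] W.carrier) :
    pairing (V ⊗ W) T τ (tact V.act W.act (Q.g * Q.f) y) = pairing (V ⊗ W) T τ y := by
  have := tensor_dual_comparison V W D E T ((dualComparison (V ⊗ W) T (E ⊗ D)).lin τ) y
  rw [← comp_lin, dualComparison_comp, dual_tensor_comparison] at this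
  rw [map_mul]
  exact this.symm

-- The comparison map preserves evaluations: $\alpha$ acts diagonally on one side, and $\gamma$
-- corrects the pairing on the other.
include D E in
theorem pairing_g_γ (τ : T.carrier) (y : V.carrier ⊗[k] W.carrier) :
    pairing (V ⊗ W) T τ (tact V.act W.act (Q.g * Q.γ) y) =
      pairing (V ⊗ W) T τ (tact V.act W.act (Q.Δ Q.α) y) := by
  have := congrArg (fun f : T ⊗ (V ⊗ W) ⟶ _ => f.lin (τ ⊗ₜ y))
    (dualComparison_evaluation (V ⊗ W) T (E ⊗ D))
  have := congrArg ULift.down ((nested_evaluation_lin V W D E _ _).symm.trans this)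
  rw [map_mul]
  exact (dual_tensor_comparison V W D E T τ _).symm.trans this

-- The linearity of the comparison map, read on operators.
include D E in
theorem pairing_Δ_S_g (h : H) (τ : T.carrier) (y : V.carrier ⊗[k] W.carrier) :
    pairing (V ⊗ W) T τ (tact V.act W.act (Q.Δ (Q.S h) * Q.g) y) =
      pairing (V ⊗ W) T τ (tact V.act W.act (Q.g * Q.SSΔop h) y) := by
  have := congrArg (fun z => nestedForm V W D E z y)
    ((dualComparison (V ⊗ W) T (E ⊗ D)).comm h τ)
  rw [map_mul, map_mul]
  refine Eq.trans ?_ (this.trans ?_)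
  · refine Eq.trans ?_ (dual_tensor_comparison V W D E T _ y).symm
    rw [pairing_act]
    rfl
  · exact (nestedForm_act V W D E _ _ y).trans (dual_tensor_comparison V W D E T _ _)

end Twist

section Regular

variable [FiniteDimensional k H]

/-- The left regular module. -/
noncomputable def reg (𝓡 : RMatrix Q) : QMod 𝓡 where
  carrier := ULift.{u} H
  fin := Module.Finite.equiv (ULift.moduleEquiv (R := k) (M := H)).symm
  act := ((ULift.moduleEquiv (R := k) (M := H)).symm.conjAlgEquiv k).toAlgHom.comp
    (Algebra.lmul k H)

/-- The identification of the left regular module with `H`. -/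
noncomputable def regEquiv (𝓡 : RMatrix Q) : H ≃ₗ[k] (reg 𝓡).carrier := ULift.moduleEquiv.symm

@[simp]
theorem reg_act (a b : H) : (reg 𝓡).act a (regEquiv 𝓡 b) = regEquiv 𝓡 (a * b) := rfl

/-- An element of $H\otimes H$ is recovered from its action on $1\otimes1$ in the regular module, so
operator identities become identities in $H\otimes H$. -/
theorem reg_tact_injective {s t : H ⊗[k] H}
    (h : ∀ y, tact (reg 𝓡).act (reg 𝓡).act s y = tact (reg 𝓡).act (reg 𝓡).act t y) : s = t := by
  have e : ∀ t : H ⊗[k] H, TensorProduct.congr (regEquiv 𝓡).symm (regEquiv 𝓡).symm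
      (tact (reg 𝓡).act (reg 𝓡).act t (regEquiv 𝓡 1 ⊗ₜ regEquiv 𝓡 1)) = t :=
    tensor_ext (by fun_prop) (by fun_prop) fun a b => by simp
  rw [← e s, h, e]

end Regular

end QMod

namespace QuasiHopfAlgebra

open QMod

variable {k : Type u} {H : Type v} [Field k] [Ring H] [Algebra k H] [FiniteDimensional k H]
  (Q : QuasiHopfAlgebra k H) (𝓡 : RMatrix Q)

include 𝓡

theorem g_mul_f : Q.g * Q.f = 1 := by
  refine reg_tact_injective (𝓡 := 𝓡) fun y => eq_of_pairing (reg 𝓡 ⊗ reg 𝓡)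
    (dual (reg 𝓡 ⊗ reg 𝓡)) fun τ => ?_
  refine (pairing_f_g _ _ (dual (reg 𝓡)) (dual (reg 𝓡)) _ τ y).trans ?_
  rw [map_one]; rfl

theorem g_mul_γ : Q.g * Q.γ = Q.Δ Q.α :=
  reg_tact_injective (𝓡 := 𝓡) fun y => eq_of_pairing (reg 𝓡 ⊗ reg 𝓡)
    (dual (reg 𝓡 ⊗ reg 𝓡)) fun τ => pairing_g_γ _ _ (dual (reg 𝓡)) (dual (reg 𝓡)) _ τ y

theorem Δ_S_mul_g (h : H) : Q.Δ (Q.S h) * Q.g = Q.g * Q.SSΔop h :=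
  reg_tact_injective (𝓡 := 𝓡) fun y => eq_of_pairing (reg 𝓡 ⊗ reg 𝓡)
    (dual (reg 𝓡 ⊗ reg 𝓡)) fun τ => pairing_Δ_S_g _ _ (dual (reg 𝓡)) (dual (reg 𝓡)) _ h τ y

end QuasiHopfAlgebra

/-- Apply $\varepsilon$ to $S(h_1)\alpha h_2=\varepsilon(h)\alpha$ and use $\varepsilon(\alpha)=1$
and the counit axiom. -/
theorem QuasiHopfAlgebra.ε_S {k H : Type*} [Field k] [Ring H] [Algebra k H]
    (Q : QuasiHopfAlgebra k H) (h : H) : Q.ε (Q.S h) = Q.ε h := by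
  have e := congrArg Q.ε (Q.S_α h)
  have e' := congrArg (fun x => Q.ε (Q.S x)) (Q.counit_right h)
  simp only [sw_map (k := k) (E := fun x => Q.ε x) (by fun_prop),
    sw_map (k := k) (E := fun x => Q.ε (Q.S x)) (by fun_prop), map_mul, map_smul, Q.ε_α, smul_eq_mul,
    mul_one] at e e'
  rw [← e', ← e]
  simp only [mul_comm]

theorem QuasiHopfAlgebra.adj_apply {k H : Type*} [Field k] [Ring H] [Algebra k H]
    (Q : QuasiHopfAlgebra k H) (h x : H) :
    Q.adj h x = sw (Q.Δ h) fun h₁ h₂ => h₁ * x * Q.S h₂ := rfl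

/-! ### The adjoint module and its natural action on all modules -/

namespace QMod

variable {k : Type u} {H : Type v} [Field k] [Ring H] [Algebra k H] {Q : QuasiHopfAlgebra k H}
  {𝓡 : RMatrix Q} [FiniteDimensional k H]

/-- The adjoint action. -/
noncomputable def adjHom (Q : QuasiHopfAlgebra k H) : H →ₐ[k] Module.End k H where
  toFun := Q.adj
  map_one' := by
    ext x
    rw [Q.adj_apply, map_one, Algebra.TensorProduct.one_def, sw_pure] <;> intros
    · simp [Q.S_one]
    all_goals fun_prop
  map_mul' a b := by
    ext x
    rw [Module.End.mul_apply]
    simp only [Q.adj_apply, map_mul]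
    generalize Q.Δ a = s
    generalize Q.Δ b = t
    revert s
    refine tensor_ext (by fun_prop) (by fun_prop) fun a b => ?_
    revert t
    refine tensor_ext (by fun_prop) (by fun_prop) fun c d => ?_
    simp (disch := fun_prop) [sw_pure, Q.S_mul, mul_assoc]
  map_zero' := map_zero _
  map_add' := map_add _
  commutes' c := by
    ext x
    rw [Q.adj_apply, AlgHom.commutes, Algebra.TensorProduct.algebraMap_apply, sw_pure] <;> intros
    · simp [Q.S_one, Algebra.algebraMap_eq_smul_one]
    all_goals fun_prop

/-- `H` with the adjoint action. -/
noncomputable def adjMod (𝓡 : RMatrix Q) : QMod 𝓡 where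
  carrier := ULift.{u} H
  fin := Module.Finite.equiv (ULift.moduleEquiv (R := k) (M := H)).symm
  act := ((ULift.moduleEquiv (R := k) (M := H)).symm.conjAlgEquiv k).toAlgHom.comp (adjHom Q)

/-- The identification of `H` with the adjoint module. -/
noncomputable def adjEquiv (𝓡 : RMatrix Q) : H ≃ₗ[k] (adjMod 𝓡).carrier := ULift.moduleEquiv.symm

@[simp]
theorem adjMod_act (a b : H) : (adjMod 𝓡).act a (adjEquiv 𝓡 b) = adjEquiv 𝓡 (Q.adj a b) := rfl

section Rep

variable (V D : QMod 𝓡) [DualPair V D]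

/-- The action of `H` on `V` as a map to `V ⊗ V*`. -/
noncomputable def repLin : H →ₗ[k] V.carrier ⊗[k] D.carrier :=
  (endo V D).symm.toLinearMap ∘ₗ V.act.toLinearMap

@[simp]
theorem endo_repLin (h : H) : endo V D (repLin V D h) = V.act h := by simp [repLin]

theorem endo_ext {x y : V.carrier ⊗[k] D.carrier} (h : endo V D x = endo V D y) : x = y :=
  (endo V D).injective h

theorem map_repLin (a b h : H) :
    TensorProduct.map (V.act a) (D.act b) (repLin V D h) = repLin V D (a * h * Q.S b) :=
  endo_ext V D (by simp)

/-- The action of `H` on `V` as a morphism to `V ⊗ V*`. -/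
noncomputable def rep : adjMod 𝓡 ⟶ V ⊗ D where
  lin := repLin V D ∘ₗ (adjEquiv 𝓡).symm.toLinearMap
  comm h x := by
    obtain ⟨x, rfl⟩ := (adjEquiv 𝓡).surjective x
    rw [adjMod_act]
    simp only [LinearMap.comp_apply, LinearEquiv.coe_coe, LinearEquiv.symm_apply_apply]
    exact (endo_coev V D x (Q.Δ h)).symm

theorem rep_lin (h : H) : (rep V D).lin (adjEquiv 𝓡 h) = repLin V D h := by
  change repLin V D _ = _
  simp

/-- The action of `H₀` on a module. -/
noncomputable def adjAction : adjMod 𝓡 ⊗ V ⟶ V :=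
  rep V (dual V) ▷ V ≫ (α_ V (dual V) V).hom ≫ V ◁ ε_ V (dual V) ≫ (ρ_ V).hom

/-- In unbending the representation, $\Phi$ comes from the associator, $S(X^2)$ from the action on
$V^*$ and $\alpha$ from the evaluation. The result no longer mentions the chosen dual. -/
theorem rep_action_lin (h : H) (w : V.carrier) :
    (rep V D ▷ V ≫ (α_ V D V).hom ≫ V ◁ ε_ V D ≫ (ρ_ V).hom).lin (adjEquiv 𝓡 h ⊗ₜ w) =
      V.act (sw3 Q.Φ.val fun X₁ X₂ X₃ => X₁ * h * Q.S X₂ * Q.α * X₃) w := by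
  have := ev_coev_aux V D w Q.Φ.val (repLin V D h)
  simp only [endo_repLin, ← map_mul] at this
  rw [← sw3_map (E := fun t => V.act t) (by fun_prop)] at this
  simp only [mul_assoc] at this ⊢
  refine Eq.trans ?_ this
  rw [comp_lin, comp_lin, comp_lin, whiskerRight_lin, TensorProduct.map_tmul, rep_lin]
  exact whiskerLeft_evHom V D V _

theorem adjAction_lin (h : H) (w : V.carrier) :
    (adjAction V).lin (adjEquiv 𝓡 h ⊗ₜ w) =
      V.act (sw3 Q.Φ.val fun X₁ X₂ X₃ => X₁ * h * Q.S X₂ * Q.α * X₃) w :=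
  rep_action_lin V (dual V) h w

theorem adjMod_tensor_ext {U W : QMod 𝓡} {f g : adjMod 𝓡 ⊗ U ⟶ W}
    (h : ∀ (a : H) (v : U.carrier), f.lin (adjEquiv 𝓡 a ⊗ₜ v) = g.lin (adjEquiv 𝓡 a ⊗ₜ v)) : f = g :=
  tensor_hom_ext fun u v => by
    obtain ⟨a, rfl⟩ := (adjEquiv 𝓡).surjective u
    exact h a v

theorem adjAction_eq : adjAction V =
    rep V D ▷ V ≫ (α_ V D V).hom ≫ V ◁ ε_ V D ≫ (ρ_ V).hom :=
  adjMod_tensor_ext fun a v => by rw [adjAction_lin, rep_action_lin]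

theorem adjAction_naturality {V W : QMod 𝓡} (f : V ⟶ W) :
    adjMod 𝓡 ◁ f ≫ adjAction W = adjAction V ≫ f :=
  adjMod_tensor_ext fun a v => by
    rw [comp_lin, comp_lin, adjAction_lin, f.comm]
    exact adjAction_lin W a (f.lin v)

theorem mate_adjAction [Fact 𝓡.IsTriangular] : (mate (adjAction V) : adjMod 𝓡 ⟶ V ⊗ D) = rep V D := by
  rw [adjAction_eq V D, mate_unmate]

end Rep

end QMod

/-! ### Product and coproduct of $H_0$ as categorical morphisms -/

namespace QMod

variable {k : Type u} {H : Type v} [Field k] [Ring H] [Algebra k H] {Q : QuasiHopfAlgebra k H}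
  {𝓡 : RMatrix Q} [FiniteDimensional k H]

/-- The lift of a morphism along an injective one, for a given linear lift. -/
def liftHom {X A B : QMod 𝓡} (ι : A ⟶ B) (hι : Function.Injective ι.lin) (f : X ⟶ B)
    (g : X.carrier →ₗ[k] A.carrier) (h : ∀ x, ι.lin (g x) = f.lin x) : X ⟶ A :=
  ⟨g, fun a x => hι (by rw [h, f.comm, ι.comm, h])⟩

section EndMul

variable [Fact 𝓡.IsTriangular] (V W D E : QMod 𝓡) [DualPair V D] [DualPair W E]

theorem endMul_aux (t t' : H ⊗[k] (H ⊗[k] H)) (x y : V.carrier ⊗[k] D.carrier) :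
    endo V D (TensorProduct.map LinearMap.id ((TensorProduct.lid k _).toLinearMap ∘ₗ
      TensorProduct.map (evLin V D) LinearMap.id ∘ₗ (TensorProduct.assoc k _ _ _).symm.toLinearMap ∘ₗ
        tact₃ D V D t') (tact₃ V D (tensor V D) t (TensorProduct.assoc k _ _ _ (x ⊗ₜ y)))) =
    sw3 t fun X₁ X₂ X₃ => sw3 t' fun x₁ x₂ x₃ => sw (Q.Δ X₃) fun X₃₁ X₃₂ =>
      V.act X₁ * endo V D x * V.act (Q.S (x₁ * X₂)) * V.act Q.α * V.act x₂ * V.act X₃₁ *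
        endo V D y * V.act (Q.S (x₃ * X₃₂)) := by
  revert t
  refine tensor_ext₃ (by fun_prop) (by fun_prop) fun a b c => ?_
  revert t'
  refine tensor_ext₃ (by fun_prop) (by fun_prop) fun a' b' c' => ?_
  simp (disch := fun_prop) only [sw3_pure, tact_tmul, tensorAct_apply]
  generalize Q.Δ c = s
  revert s
  refine tensor_ext (by fun_prop) (by fun_prop) fun p q => ?_
  revert x
  refine tensor_ext (by fun_prop) (by fun_prop) fun v φ => ?_
  revert y
  refine tensor_ext (by fun_prop) (by fun_prop) fun w ψ => ?_
  ext z
  simp (disch := fun_prop) [sw_pure, Q.S_mul, smul_smul, mul_comm]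

/-- The source of the formula for $\circ$: composition in $V\otimes V^*$, with its two associators
and one evaluation written out. -/
theorem endMul_lin (x y : V.carrier ⊗[k] D.carrier) :
    endo V D ((endMul V D).lin (x ⊗ₜ y)) =
    sw3 Q.Φ.val fun X₁ X₂ X₃ => sw3 Q.Φ⁻¹.val fun x₁ x₂ x₃ => sw (Q.Δ X₃) fun X₃₁ X₃₂ =>
      V.act X₁ * endo V D x * V.act (Q.S (x₁ * X₂)) * V.act Q.α * V.act x₂ * V.act X₃₁ *
        endo V D y * V.act (Q.S (x₃ * X₃₂)) := by
  refine Eq.trans ?_ (endMul_aux V D Q.Φ.val Q.Φ⁻¹.val x y)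
  congr 1
  unfold endMul
  rw [comp_lin, whiskerLeft_lin]
  refine congrFun (congrArg _ (congrArg (TensorProduct.map LinearMap.id) ?_)) _
  ext z
  rw [comp_lin, comp_lin]
  exact whiskerRight_evHom V D D _

end EndMul

section EndTensor

variable [Fact 𝓡.IsTriangular] (V W D E : QMod 𝓡) [DualPair V D] [DualPair W E]

theorem endTensor_aux (x t y : H ⊗[k] (H ⊗[k] H)) (r : H ⊗[k] H)
    (z : V.carrier ⊗[k] D.carrier) (w : W.carrier ⊗[k] E.carrier) :
   (TensorProduct.assoc k _ _ _).symm (tact₃ V D (tensor W E) x (TensorProduct.map LinearMap.id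
      ((TensorProduct.comm k _ _).toLinearMap ∘ₗ tact (tensorAct W E) D.act r ∘ₗ
        (TensorProduct.assoc k _ _ _).symm.toLinearMap ∘ₗ tact₃ W E D y)
      (tact₃ V W (tensor E D) t (TensorProduct.assoc k _ _ _
       (TensorProduct.map LinearMap.id (TensorProduct.comm k _ _).toLinearMap
         (TensorProduct.tensorTensorTensorComm k _ _ _ _ (z ⊗ₜ w))))))) =
   sw3 x fun x₁ x₂ x₃ => sw3 t fun X₁ X₂ X₃ => sw r fun R₁ R₂ =>
    sw3 y fun y₁ y₂ y₃ => sw (Q.Δ X₃) fun X₃₁ X₃₂ =>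
      TensorProduct.map (V.act (x₁ * X₁)) (D.act (x₂ * R₂ * y₃ * X₃₂)) z ⊗ₜ
       tact W.act E.act (Q.Δ (x₃ * R₁)) (TensorProduct.map (W.act (y₁ * X₂)) (E.act (y₂ * X₃₁)) w) := by
  revert x
  refine tensor_ext₃ (by fun_prop) (by fun_prop) fun x₁ x₂ x₃ => ?_
  revert t
  refine tensor_ext₃ (by fun_prop) (by fun_prop) fun a b c => ?_
  revert y
  refine tensor_ext₃ (by fun_prop) (by fun_prop) fun a' b' c' => ?_
  revert r
  refine tensor_ext (by fun_prop) (by fun_prop) fun r₁ r₂ => ?_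
  simp (disch := fun_prop) only [sw3_pure, sw_pure, tact_tmul, tensorAct_apply]
  generalize Q.Δ c = s
  revert s
  refine tensor_ext (by fun_prop) (by fun_prop) fun p q => ?_
  revert z
  refine tensor_ext (by fun_prop) (by fun_prop) fun v φ => ?_
  revert w
  refine tensor_ext (by fun_prop) (by fun_prop) fun w ψ => ?_
  simp (disch := fun_prop) [sw_pure]

/-- The middle interchange `(V ⊗ V*) ⊗ (W ⊗ W*) ≃ (V ⊗ W) ⊗ (W* ⊗ V*)`. -/
noncomputable def nestedElt : (V.carrier ⊗[k] D.carrier) ⊗[k] (W.carrier ⊗[k] E.carrier) →ₗ[k]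
    (V.carrier ⊗[k] W.carrier) ⊗[k] (E.carrier ⊗[k] D.carrier) :=
  TensorProduct.map LinearMap.id (TensorProduct.comm k _ _).toLinearMap ∘ₗ
    (TensorProduct.tensorTensorTensorComm k _ _ _ _).toLinearMap

@[simp]
theorem nestedElt_tmul (v : V.carrier) (φ : D.carrier) (w : W.carrier) (ψ : E.carrier) :
    nestedElt V W D E ((v ⊗ₜ φ) ⊗ₜ (w ⊗ₜ ψ)) = (v ⊗ₜ w) ⊗ₜ (ψ ⊗ₜ φ) := by
  simp [nestedElt]

/-- The source of the formula for $\underline\Delta$: three associators give $x$, $X$, $y$, and the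
braiding of $W\otimes W^*$ past $V^*$ gives $R$, whose first leg acts diagonally and thus through
$\triangleright$. -/
theorem endTensor_lin (z : V.carrier ⊗[k] D.carrier) (w : W.carrier ⊗[k] E.carrier) :
    (endTensor V W D E).lin (nestedElt V W D E (z ⊗ₜ w)) =
    sw3 Q.Φ⁻¹.val fun x₁ x₂ x₃ => sw3 Q.Φ.val fun X₁ X₂ X₃ => sw 𝓡.R.val fun R₁ R₂ =>
    sw3 Q.Φ⁻¹.val fun y₁ y₂ y₃ => sw (Q.Δ X₃) fun X₃₁ X₃₂ =>
      TensorProduct.map (V.act (x₁ * X₁)) (D.act (x₂ * R₂ * y₃ * X₃₂)) z ⊗ₜ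
       tact W.act E.act (Q.Δ (x₃ * R₁))
        (TensorProduct.map (W.act (y₁ * X₂)) (E.act (y₂ * X₃₁)) w) :=
  endTensor_aux V W D E Q.Φ⁻¹.val Q.Φ.val Q.Φ⁻¹.val 𝓡.R.val z w

theorem contract_nestedElt (z : V.carrier ⊗[k] D.carrier) (w : W.carrier ⊗[k] E.carrier) :
    contract (nestedForm V W D E) (nestedElt V W D E (z ⊗ₜ w)) =
      TensorProduct.map (endo V D z) (endo W E w) := by
  refine LinearMap.ext fun y => ?_
  revert z
  refine tensor_ext (by fun_prop) (by fun_prop) fun v φ => ?_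
  revert w
  refine tensor_ext (by fun_prop) (by fun_prop) fun w ψ => ?_
  revert y
  refine tensor_ext (by fun_prop) (by fun_prop) fun v' w' => ?_
  rw [nestedElt_tmul]
  refine (contract_tmul _ _ _ _).trans ?_
  simp [TensorProduct.smul_tmul', smul_smul, mul_comm]

theorem contract_nestedForm_injective {z z' : (V.carrier ⊗[k] W.carrier) ⊗[k] (E.carrier ⊗[k] D.carrier)}
    (h : contract (nestedForm V W D E) z =
      contract (nestedForm V W D E) z') : z = z' := by
  let e := ((TensorProduct.congr (LinearEquiv.refl k (V.carrier ⊗[k] W.carrier)) (nestedPairing V W D E)).trans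
    (TensorProduct.comm k _ _)).trans (dualTensorHomEquiv k (V.carrier ⊗[k] W.carrier) (V.carrier ⊗[k] W.carrier))
  have he : ∀ z, e z = contract (nestedForm V W D E) z := by
    intro z
    refine LinearMap.ext fun y => ?_
    revert z
    refine tensor_ext (by fun_prop) (by fun_prop) fun v θ => ?_
    refine Eq.trans ?_ (contract_tmul _ _ _ _).symm
    simp [e, nestedForm]
  exact e.injective (by rw [he, he, h])

variable (T : QMod 𝓡) [DualPair (V ⊗ W) T]

theorem contract_whiskerLeft_comparison (z : (V.carrier ⊗[k] W.carrier) ⊗[k] T.carrier) :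
    contract (nestedForm V W D E)
      (TensorProduct.map LinearMap.id (dualComparison (V ⊗ W) T (E ⊗ D)).lin z) =
        endo (V ⊗ W) T z * tact V.act W.act Q.g := by
  refine LinearMap.ext fun y => ?_
  revert z
  refine tensor_ext (isLinearMap_apply (isLinearMap_comp (LinearMap.isLinear _)
    (LinearMap.isLinear _)) y) (isLinearMap_apply (isLinearMap_mul_left
      (LinearMap.isLinear (endo (V ⊗ W) T).toLinearMap) _) y) fun x τ => ?_
  rw [TensorProduct.map_tmul, contract_tmul]
  refine Eq.trans ?_ (endo_tmul (V ⊗ W) T x τ _).symm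
  rw [dual_tensor_comparison]
  rfl

/-- On $V\otimes W$ the element $h$ acts by $\Delta(h)$, and replacing $(V\otimes W)^*$ by
$W^*\otimes V^*$ multiplies by $g$ on the right; hence the factors $h_1g^1$ and $h_2g^2$ in
$\underline\Delta$. -/
theorem rep_tensor_comparison (h : H) :
    TensorProduct.map LinearMap.id (dualComparison (V ⊗ W) T (E ⊗ D)).lin (repLin (V ⊗ W) T h) =
      sw (Q.Δ h) fun h₁ h₂ => sw Q.g fun g₁ g₂ =>
        nestedElt V W D E (repLin V D (h₁ * g₁) ⊗ₜ repLin W E (h₂ * g₂)) := by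
  apply contract_nestedForm_injective
  refine (contract_whiskerLeft_comparison V W D E T _).trans ?_
  rw [endo_repLin, tensorObj_act, ← map_mul]
  generalize Q.Δ h = s
  generalize Q.g = t
  revert s
  refine tensor_ext (by fun_prop) (by fun_prop) fun a b => ?_
  revert t
  refine tensor_ext (by fun_prop) (by fun_prop) fun c d => ?_
  simp (disch := fun_prop) [sw_pure, contract_nestedElt]

theorem tact_Δ_repLin (a b : H) :
    tact V.act D.act (Q.Δ a) (repLin V D b) = repLin V D (Q.adj a b) :=
  endo_coev V D b (Q.Δ a)

theorem map_repLin_comul_aux (x X y : H ⊗[k] (H ⊗[k] H)) (s g r : H ⊗[k] H) :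
    TensorProduct.map (repLin V D) (repLin W E)
      (sw3 x fun x₁ x₂ x₃ => sw3 X fun X₁ X₂ X₃ => sw s fun h₁ h₂ => sw g fun g₁ g₂ =>
        sw r fun R₁ R₂ => sw3 y fun y₁ y₂ y₃ => sw (Q.Δ X₃) fun X₃₁ X₃₂ =>
          (x₁ * X₁ * h₁ * g₁ * Q.S (x₂ * R₂ * y₃ * X₃₂)) ⊗ₜ[k]
          Q.adj (x₃ * R₁) (y₁ * X₂ * h₂ * g₂ * Q.S (y₂ * X₃₁))) =
    sw s fun h₁ h₂ => sw g fun g₁ g₂ => sw3 x fun x₁ x₂ x₃ => sw3 X fun X₁ X₂ X₃ =>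
      sw r fun R₁ R₂ => sw3 y fun y₁ y₂ y₃ => sw (Q.Δ X₃) fun X₃₁ X₃₂ =>
        repLin V D (x₁ * X₁ * (h₁ * g₁) * Q.S (x₂ * R₂ * y₃ * X₃₂)) ⊗ₜ[k]
        repLin W E (Q.adj (x₃ * R₁) (y₁ * X₂ * (h₂ * g₂) * Q.S (y₂ * X₃₁))) := by
  revert x
  refine tensor_ext₃ (by fun_prop) (by fun_prop) fun x₁ x₂ x₃ => ?_
  revert X
  refine tensor_ext₃ (by fun_prop) (by fun_prop) fun a b c => ?_
  revert s
  refine tensor_ext (by fun_prop) (by fun_prop) fun h₁ h₂ => ?_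
  revert g
  refine tensor_ext (by fun_prop) (by fun_prop) fun g₁ g₂ => ?_
  revert r
  refine tensor_ext (by fun_prop) (by fun_prop) fun r₁ r₂ => ?_
  revert y
  refine tensor_ext₃ (by fun_prop) (by fun_prop) fun a' b' c' => ?_
  simp (disch := fun_prop) only [sw3_pure, sw_pure]
  generalize Q.Δ c = s
  revert s
  refine tensor_ext (by fun_prop) (by fun_prop) fun p q => ?_
  simp (disch := fun_prop) only [sw_pure, TensorProduct.map_tmul, mul_assoc]

theorem map_repLin_comulH₀ (h : H) :
    TensorProduct.map (repLin V D) (repLin W E) (𝓡.comulH₀ h) =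
      (endTensor V W D E).lin (TensorProduct.map LinearMap.id
        (dualComparison (V ⊗ W) T (E ⊗ D)).lin (repLin (V ⊗ W) T h)) := by
  rw [rep_tensor_comparison]
  rw [sw_map (E := fun x => (endTensor V W D E).lin x) (LinearMap.isLinear _)]
  simp only [sw_map (E := fun x => (endTensor V W D E).lin x) (LinearMap.isLinear _)]
  simp only [endTensor_lin, map_repLin, tact_Δ_repLin]
  exact map_repLin_comul_aux V W D E _ _ _ _ _ _

end EndTensor

end QMod

/-! ### Antipode and counit of $H_0$ in terms of the action on modules -/

section Collapse

variable {k H : Type*} [Field k] [Ring H] [Algebra k H] {Q : QuasiHopfAlgebra k H}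

/-- The map `a ↦ X¹ a S(X²) α X³`. -/
noncomputable def QuasiHopfAlgebra.collapse (Q : QuasiHopfAlgebra k H) : H →ₗ[k] H :=
  IsLinearMap.mk' (fun a => sw3 Q.Φ.val fun X₁ X₂ X₃ => X₁ * a * Q.S X₂ * Q.α * X₃) (by fun_prop)

theorem QuasiHopfAlgebra.collapse_apply (Q : QuasiHopfAlgebra k H) (a : H) :
    Q.collapse a = sw3 Q.Φ.val fun X₁ X₂ X₃ => X₁ * a * Q.S X₂ * Q.α * X₃ := rfl

/-- The element $q$ occurs in $\underline S$ only through the combination $q^1aS(q^2)$, which is the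
element by which $a\in H_0$ acts on modules. -/
theorem QuasiHopfAlgebra.sw_qR (Q : QuasiHopfAlgebra k H) (a : H) :
    (sw Q.qR fun q₁ q₂ => q₁ * a * Q.S q₂) = Q.collapse a := by
  rw [Q.collapse_apply, QuasiHopfAlgebra.qR]
  rw [sw3_map (k := k) (E := fun t : H ⊗[k] H => sw t fun q₁ q₂ => q₁ * a * Q.S q₂) (by fun_prop)]
  simp (disch := fun_prop) [sw_pure, Q.S_mul, mul_assoc]

theorem RMatrix.antipodeH₀_eq (𝓡 : RMatrix Q) (h : H) : 𝓡.antipodeH₀ h =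
    sw3 Q.Φ.val fun X₁ X₂ X₃ => sw 𝓡.R.val fun R₁ R₂ => sw3 Q.Φ⁻¹.val fun x₁ x₂ x₃ =>
      X₁ * R₂ * x₂ * Q.β * Q.S (Q.collapse (Q.adj (X₂ * R₁ * x₁) h) * X₃ * x₃) := by
  change (sw3 Q.Φ.val fun X₁ X₂ X₃ => sw 𝓡.R.val fun R₁ R₂ => sw Q.pR fun p₁ p₂ =>
    sw Q.qR fun q₁ q₂ => X₁ * R₂ * p₂ * Q.S (q₁ * Q.adj (X₂ * R₁ * p₁) h * Q.S q₂ * X₃)) = _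
  have e : ∀ (X₁ X₂ X₃ R₁ R₂ p₁ p₂ : H), (sw Q.qR fun q₁ q₂ =>
      X₁ * R₂ * p₂ * Q.S (q₁ * Q.adj (X₂ * R₁ * p₁) h * Q.S q₂ * X₃)) =
      X₁ * R₂ * p₂ * Q.S (Q.collapse (Q.adj (X₂ * R₁ * p₁) h) * X₃) := by
    intro X₁ X₂ X₃ R₁ R₂ p₁ p₂
    rw [← Q.sw_qR]
    exact (sw_map (k := k) (E := fun t => X₁ * R₂ * p₂ * Q.S (t * X₃)) (by fun_prop) _ _).symm
  have e' : ∀ (X₁ X₂ X₃ R₁ R₂ : H), (sw Q.pR fun p₁ p₂ =>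
      X₁ * R₂ * p₂ * Q.S (Q.collapse (Q.adj (X₂ * R₁ * p₁) h) * X₃)) =
      sw3 Q.Φ⁻¹.val fun x₁ x₂ x₃ =>
        X₁ * R₂ * x₂ * Q.β * Q.S (Q.collapse (Q.adj (X₂ * R₁ * x₁) h) * X₃ * x₃) := by
    intro X₁ X₂ X₃ R₁ R₂
    refine (sw3_map (k := k) (E := fun t : H ⊗[k] H => sw t fun p₁ p₂ =>
      X₁ * R₂ * p₂ * Q.S (Q.collapse (Q.adj (X₂ * R₁ * p₁) h) * X₃)) (by fun_prop) _ _).trans ?_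
    refine congrArg (sw3 _) (funext fun x₁ => funext fun x₂ => funext fun x₃ => ?_)
    refine (sw_pure (fun _ => by fun_prop) (fun _ => by fun_prop) _ _).trans ?_
    simp only [Q.S_mul, mul_assoc]
  simp only [e, e']

/-- $\varepsilon$ applied to all three legs of $\Phi$ gives $1$, as $(id\otimes\varepsilon\otimes
id)(\Phi)=1\otimes1$. Hence the action on the unit object is the ordinary counit. -/
theorem QuasiHopfAlgebra.ε_collapse (Q : QuasiHopfAlgebra k H) (a : H) :
    Q.ε (Q.collapse a) = Q.ε a := by
  rw [Q.collapse_apply, sw3_map (k := k) (E := fun x => Q.ε x) (by fun_prop)]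
  have e := congrArg (fun t => TensorProduct.lid k k (TensorProduct.map Q.ε.toLinearMap
    Q.ε.toLinearMap t)) Q.cocycle_counit
  have := sw3_map (k := k) (E := fun t => TensorProduct.lid k k (TensorProduct.map Q.ε.toLinearMap
    Q.ε.toLinearMap t)) (by fun_prop) Q.Φ.val fun X₁ X₂ X₃ => Q.ε X₂ • (X₁ ⊗ₜ[k] X₃)
  rw [this] at e
  simp only [Algebra.TensorProduct.one_def, map_smul, TensorProduct.map_tmul,
    TensorProduct.lid_tmul, AlgHom.toLinearMap_apply, smul_eq_mul, map_one, mul_one] at e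
  simp only [map_mul, Q.ε_S, Q.ε_α, mul_one]
  have e' := sw3_smul_right (Q.ε a) Q.Φ.val fun X₁ X₂ X₃ => Q.ε X₂ * (Q.ε X₁ * Q.ε X₃)
  rw [e, smul_eq_mul, mul_one] at e'
  refine Eq.trans (congrArg (sw3 _) (funext fun x₁ => funext fun x₂ => funext fun x₃ => ?_)) e'
  rw [smul_eq_mul]; ring

end Collapse

namespace QMod

variable {k : Type u} {H : Type v} [Field k] [Ring H] [Algebra k H] {Q : QuasiHopfAlgebra k H}
  {𝓡 : RMatrix Q} [FiniteDimensional k H]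

section Structure

variable (V D : QMod 𝓡) [DualPair V D]

theorem adjAction_lin' (h : H) (w : V.carrier) :
    (adjAction V).lin (adjEquiv 𝓡 h ⊗ₜ w) = V.act (Q.collapse h) w :=
  adjAction_lin V h w

theorem antipode_aux (L : (adjMod 𝓡).carrier ⊗[k] D.carrier →ₗ[k] D.carrier)
    (hL : ∀ a φ, L (adjEquiv 𝓡 a ⊗ₜ φ) = D.act (Q.collapse a) φ)
    (x X : H ⊗[k] (H ⊗[k] H)) (r : H ⊗[k] H) (h : H) (y : V.carrier ⊗[k] D.carrier) :
    TensorProduct.map LinearMap.id L (tact₃ V (adjMod 𝓡) D X (TensorProduct.assoc k _ _ _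
      (TensorProduct.map ((TensorProduct.comm k _ _).toLinearMap ∘ₗ
        tact (adjMod 𝓡).act V.act r) LinearMap.id ((TensorProduct.assoc k _ _ _).symm
          (tact₃ (adjMod 𝓡) V D x (adjEquiv 𝓡 h ⊗ₜ y)))))) =
    sw3 X fun X₁ X₂ X₃ => sw r fun R₁ R₂ => sw3 x fun x₁ x₂ x₃ =>
      TensorProduct.map (V.act (X₁ * R₂ * x₂))
        (D.act (Q.collapse (Q.adj (X₂ * R₁ * x₁) h) * X₃ * x₃)) y := by
  revert x
  refine tensor_ext₃ (by fun_prop) (by fun_prop) fun x₁ x₂ x₃ => ?_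
  revert X
  refine tensor_ext₃ (by fun_prop) (by fun_prop) fun a b c => ?_
  revert r
  refine tensor_ext (by fun_prop) (by fun_prop) fun r₁ r₂ => ?_
  simp (disch := fun_prop) only [sw3_pure, sw_pure]
  revert y
  refine tensor_ext (by fun_prop) (by fun_prop) fun v φ => ?_
  have e : ∀ a b, Q.adj (a * b) = Q.adj a * Q.adj b := (adjHom Q).map_mul
  simp [hL, e]

/-- The antipode acts on $V$ as the transpose of the action on $V^*$: braid $H_0$ past $V$ in the
coevaluation and let it act on the dual leg. Here $p$ comes from the inverse associator together
with $\beta$. -/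
theorem repLin_antipodeH₀ (h : H) [Fact 𝓡.IsTriangular] : repLin V D (𝓡.antipodeH₀ h) =
    ((ρ_ (adjMod 𝓡)).inv ≫ adjMod 𝓡 ◁ η_ V D ≫ (α_ (adjMod 𝓡) V D).inv ≫
      (β_ (adjMod 𝓡) V).hom ▷ D ≫ (α_ V (adjMod 𝓡) D).hom ≫ V ◁ adjAction D).lin
        (adjEquiv 𝓡 h) := by
  refine Eq.trans ?_ (antipode_aux V D (adjAction D).lin (adjAction_lin' D) Q.Φ⁻¹.val Q.Φ.val
    𝓡.R.val h (coevElt V D)).symm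
  rw [coevElt_eq]
  change _ = sw3 _ fun _ _ _ => sw _ fun _ _ => sw3 _ fun _ _ _ =>
    TensorProduct.map _ _ (repLin V D Q.β)
  simp only [map_repLin, 𝓡.antipodeH₀_eq]
  have := sw3_map (E := fun h => repLin V D h) (by fun_prop) Q.Φ.val
    (fun X₁ X₂ X₃ => sw 𝓡.R.val fun R₁ R₂ => sw3 Q.Φ⁻¹.val fun x₁ x₂ x₃ =>
      X₁ * R₂ * x₂ * Q.β * Q.S (Q.collapse (Q.adj (X₂ * R₁ * x₁) h) * X₃ * x₃))
  refine this.trans ?_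
  simp only [sw_map (k := k) (E := fun h => repLin V D h) (by fun_prop),
    sw3_map (k := k) (E := fun h => repLin V D h) (by fun_prop)]

theorem rep_circ (a b : H) [Fact 𝓡.IsTriangular] :
    repLin V D (Q.circ a b) = (endMul V D).lin (repLin V D a ⊗ₜ repLin V D b) := by
  apply endo_ext
  rw [endMul_lin, endo_repLin]
  change V.act (sw3 Q.Φ.val fun X₁ X₂ X₃ => sw3 Q.Φ⁻¹.val fun x₁ x₂ x₃ =>
      sw (Q.Δ X₃) fun X₃₁ X₃₂ =>
        X₁ * a * Q.S (x₁ * X₂) * Q.α * x₂ * X₃₁ * b * Q.S (x₃ * X₃₂)) = _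
  simp only [sw_map (k := k) (E := fun h => V.act h) (by fun_prop),
    sw3_map (k := k) (E := fun h => V.act h) (by fun_prop), map_mul, endo_repLin]

end Structure

end QMod

/-! ### $H_0$ is a Hopf monoid in the category of modules -/

namespace QMod

variable {k : Type u} {H : Type v} [Field k] [Ring H] [Algebra k H] {Q : QuasiHopfAlgebra k H}
  {𝓡 : RMatrix Q} [FiniteDimensional k H]

theorem reg_act_injective {a b : H} (h : (reg 𝓡).act a = (reg 𝓡).act b) : a = b := by
  have := LinearMap.congr_fun h (regEquiv 𝓡 1)
  simpa using this

theorem repLin_reg_injective (D : QMod 𝓡) [DualPair (reg 𝓡) D] :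
    Function.Injective (repLin (reg 𝓡) D) := fun a b h => by
  apply reg_act_injective (𝓡 := 𝓡)
  rw [← endo_repLin (reg 𝓡) D, h, endo_repLin]

/-- The action of `H₀` on the regular module. -/
noncomputable abbrev regRep (𝓡 : RMatrix Q) : adjMod 𝓡 ⟶ reg 𝓡 ⊗ dual (reg 𝓡) :=
  rep (reg 𝓡) (dual (reg 𝓡))

theorem regRep_injective : Function.Injective (regRep 𝓡).lin := fun a b h => by
  obtain ⟨a, rfl⟩ := (adjEquiv 𝓡).surjective a
  obtain ⟨b, rfl⟩ := (adjEquiv 𝓡).surjective b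
  rw [rep_lin, rep_lin] at h
  rw [repLin_reg_injective _ h]

theorem tensorHom_injective {U V W X : QMod 𝓡} {f : U ⟶ V} {g : W ⟶ X}
    (hf : Function.Injective f.lin) (hg : Function.Injective g.lin) :
    Function.Injective (f ⊗ₘ g).lin :=
  TensorProduct.map_injective_of_flat_flat _ _ hf hg

theorem cancel_of_injective {X U V : QMod 𝓡} {f g : X ⟶ U} (ι : U ⟶ V)
    (hι : Function.Injective ι.lin) (h : f ≫ ι = g ≫ ι) : f = g :=
  hom_ext fun x => hι (by rw [← comp_lin, h, comp_lin])

section Hopf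

variable (𝓡)

/-- The multiplication of `H₀` as a linear map. -/
noncomputable def circLin :
    (adjMod 𝓡).carrier ⊗[k] (adjMod 𝓡).carrier →ₗ[k] (adjMod 𝓡).carrier :=
  (adjEquiv 𝓡).toLinearMap ∘ₗ TensorProduct.lift Q.circ ∘ₗ
    TensorProduct.map (adjEquiv 𝓡).symm.toLinearMap (adjEquiv 𝓡).symm.toLinearMap

theorem circLin_tmul (a b : H) :
    circLin 𝓡 (adjEquiv 𝓡 a ⊗ₜ adjEquiv 𝓡 b) = adjEquiv 𝓡 (Q.circ a b) := by
  simp [circLin]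

/-- The comultiplication of `H₀` as a linear map. -/
noncomputable def comulLin :
    (adjMod 𝓡).carrier →ₗ[k] (adjMod 𝓡).carrier ⊗[k] (adjMod 𝓡).carrier :=
  TensorProduct.map (adjEquiv 𝓡).toLinearMap (adjEquiv 𝓡).toLinearMap ∘ₗ 𝓡.comulH₀ ∘ₗ
    (adjEquiv 𝓡).symm.toLinearMap

theorem comulLin_apply (a : H) : comulLin 𝓡 (adjEquiv 𝓡 a) =
    TensorProduct.map (adjEquiv 𝓡).toLinearMap (adjEquiv 𝓡).toLinearMap (𝓡.comulH₀ a) := by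
  simp [comulLin]

theorem map_rep_map (V W D E : QMod 𝓡) [DualPair V D] [DualPair W E] (y : H ⊗[k] H) :
    TensorProduct.map (rep V D).lin (rep W E).lin
      (TensorProduct.map (adjEquiv 𝓡).toLinearMap (adjEquiv 𝓡).toLinearMap y) =
    TensorProduct.map (repLin V D) (repLin W E) y := by
  revert y
  refine tensor_ext (isLinearMap_comp (LinearMap.isLinear _) (LinearMap.isLinear _))
    (LinearMap.isLinear _) fun a b => ?_
  rw [TensorProduct.map_tmul, TensorProduct.map_tmul]
  exact congrArg₂ _ (rep_lin V D a) (rep_lin W E b)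

/-- The antipode of `H₀` as a linear map. -/
noncomputable def antipodeLin : (adjMod 𝓡).carrier →ₗ[k] (adjMod 𝓡).carrier :=
  (adjEquiv 𝓡).toLinearMap ∘ₗ 𝓡.antipodeH₀ ∘ₗ (adjEquiv 𝓡).symm.toLinearMap

theorem antipodeLin_apply (a : H) : antipodeLin 𝓡 (adjEquiv 𝓡 a) =
    adjEquiv 𝓡 (𝓡.antipodeH₀ a) := by
  simp [antipodeLin]

variable [h𝓡 : Fact 𝓡.IsTriangular]

/-- The multiplication of `H₀`. -/
noncomputable def mulHom : adjMod 𝓡 ⊗ adjMod 𝓡 ⟶ adjMod 𝓡 :=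
  -- The linearity of $\circ$ needs no computation: the regular representation is injective and
  -- linear, and it carries $\circ$ to the linear map `endMul`. The other structure maps defined by
  -- `liftHom` are handled in the same way.
  liftHom (regRep 𝓡) regRep_injective ((regRep 𝓡 ⊗ₘ regRep 𝓡) ≫ endMul _ _) (circLin 𝓡)
    (tensor_ext (isLinearMap_comp (Hom.lin _).isLinear (LinearMap.isLinear _))
      (Hom.lin _).isLinear fun a b => by
      obtain ⟨a, rfl⟩ := (adjEquiv 𝓡).surjective a
      obtain ⟨b, rfl⟩ := (adjEquiv 𝓡).surjective b
      rw [circLin_tmul, rep_lin, comp_lin, tensorHom_lin, TensorProduct.map_tmul, rep_lin, rep_lin,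
        rep_circ])

theorem mulHom_lin (a b : H) : (mulHom 𝓡).lin (adjEquiv 𝓡 a ⊗ₜ adjEquiv 𝓡 b) =
    adjEquiv 𝓡 (Q.circ a b) := circLin_tmul 𝓡 a b

theorem mulHom_rep (V D : QMod 𝓡) [DualPair V D] :
    mulHom 𝓡 ≫ rep V D = (rep V D ⊗ₘ rep V D) ≫ endMul V D :=
  adjMod_tensor_ext fun a b => by
    obtain ⟨b, rfl⟩ := (adjEquiv 𝓡).surjective b
    rw [comp_lin, mulHom_lin, comp_lin, tensorHom_lin, TensorProduct.map_tmul, rep_lin, rep_lin,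
      rep_lin, rep_circ]

/-- The unit of `H₀`. -/
noncomputable def unitHom : 𝟙_ (QMod 𝓡) ⟶ adjMod 𝓡 :=
  liftHom (regRep 𝓡) regRep_injective (η_ (reg 𝓡) (dual (reg 𝓡)))
    (LinearMap.toSpanSingleton k _ (adjEquiv 𝓡 Q.β) ∘ₗ ULift.moduleEquiv.toLinearMap) fun c => by
      change (regRep 𝓡).lin (c.down • adjEquiv 𝓡 Q.β) = _
      rw [map_smul, rep_lin, coevaluation_lin]
      rfl

theorem unitHom_lin (c : ULift.{v} k) : (unitHom 𝓡).lin c = c.down • adjEquiv 𝓡 Q.β := rfl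

theorem unitHom_rep (V D : QMod 𝓡) [DualPair V D] : unitHom 𝓡 ≫ rep V D = η_ V D :=
  hom_ext fun c => by
    rw [comp_lin, unitHom_lin, map_smul, rep_lin, coevaluation_lin]
    rfl

/-- The comultiplication of `H₀`. -/
noncomputable def comulHom : adjMod 𝓡 ⟶ adjMod 𝓡 ⊗ adjMod 𝓡 :=
  liftHom (regRep 𝓡 ⊗ₘ regRep 𝓡) (tensorHom_injective regRep_injective regRep_injective)
    (rep (reg 𝓡 ⊗ reg 𝓡) (dual (reg 𝓡 ⊗ reg 𝓡)) ≫ (reg 𝓡 ⊗ reg 𝓡) ◁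
      dualComparison (reg 𝓡 ⊗ reg 𝓡) (dual (reg 𝓡 ⊗ reg 𝓡)) (dual (reg 𝓡) ⊗ dual (reg 𝓡)) ≫
        endTensor (reg 𝓡) (reg 𝓡) (dual (reg 𝓡)) (dual (reg 𝓡)))
    (comulLin 𝓡) fun a => by
    obtain ⟨a, rfl⟩ := (adjEquiv 𝓡).surjective a
    rw [comulLin_apply, tensorHom_lin, comp_lin, comp_lin, rep_lin, whiskerLeft_lin]
    exact (map_rep_map 𝓡 _ _ _ _ _).trans (map_repLin_comulH₀ _ _ _ _ _ a)

theorem comulHom_lin (a : H) : (comulHom 𝓡).lin (adjEquiv 𝓡 a) =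
    TensorProduct.map (adjEquiv 𝓡).toLinearMap (adjEquiv 𝓡).toLinearMap (𝓡.comulH₀ a) :=
  comulLin_apply 𝓡 a

theorem adjMod_ext {W : QMod 𝓡} {f g : adjMod 𝓡 ⟶ W}
    (h : ∀ a : H, f.lin (adjEquiv 𝓡 a) = g.lin (adjEquiv 𝓡 a)) : f = g :=
  hom_ext fun u => by
    obtain ⟨a, rfl⟩ := (adjEquiv 𝓡).surjective u
    exact h a

theorem comulHom_rep (V W D E T : QMod 𝓡) [DualPair V D] [DualPair W E] [DualPair (V ⊗ W) T] :
    comulHom 𝓡 ≫ (rep V D ⊗ₘ rep W E) =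
      rep (V ⊗ W) T ≫ (V ⊗ W) ◁ dualComparison (V ⊗ W) T (E ⊗ D) ≫ endTensor V W D E :=
  adjMod_ext 𝓡 fun a => by
    rw [comp_lin, comulHom_lin, tensorHom_lin, comp_lin, comp_lin, rep_lin, whiskerLeft_lin]
    exact (map_rep_map 𝓡 _ _ _ _ _).trans (map_repLin_comulH₀ _ _ _ _ _ a)

/-- The counit of `H₀`. -/
noncomputable def counitHom : adjMod 𝓡 ⟶ 𝟙_ (QMod 𝓡) := (ρ_ _).inv ≫ adjAction (𝟙_ (QMod 𝓡))

theorem counitHom_lin (a : H) : (counitHom 𝓡).lin (adjEquiv 𝓡 a) = ULift.up (Q.ε a) := by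
  rw [counitHom, comp_lin, rightUnitor_inv_lin, adjAction_lin']
  change Q.ε (Q.collapse a) • (1 : ULift.{v} k) = _
  rw [Q.ε_collapse]
  ext
  simp

/-- The antipode of `H₀`. -/
noncomputable def antipodeHom : adjMod 𝓡 ⟶ adjMod 𝓡 :=
  liftHom (regRep 𝓡) regRep_injective
    ((ρ_ (adjMod 𝓡)).inv ≫ adjMod 𝓡 ◁ η_ (reg 𝓡) (dual (reg 𝓡)) ≫ (α_ (adjMod 𝓡) _ _).inv ≫
      (β_ (adjMod 𝓡) (reg 𝓡)).hom ▷ dual (reg 𝓡) ≫ (α_ _ (adjMod 𝓡) _).hom ≫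
        reg 𝓡 ◁ adjAction (dual (reg 𝓡))) (antipodeLin 𝓡) fun a => by
    obtain ⟨a, rfl⟩ := (adjEquiv 𝓡).surjective a
    rw [antipodeLin_apply, rep_lin]
    exact repLin_antipodeH₀ _ _ a

theorem antipodeHom_lin (a : H) : (antipodeHom 𝓡).lin (adjEquiv 𝓡 a) =
    adjEquiv 𝓡 (𝓡.antipodeH₀ a) := antipodeLin_apply 𝓡 a

theorem antipodeHom_rep (V D : QMod 𝓡) [DualPair V D] : antipodeHom 𝓡 ≫ rep V D =
    (ρ_ (adjMod 𝓡)).inv ≫ adjMod 𝓡 ◁ η_ V D ≫ (α_ (adjMod 𝓡) V D).inv ≫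
      (β_ (adjMod 𝓡) V).hom ▷ D ≫ (α_ V (adjMod 𝓡) D).hom ≫ V ◁ adjAction D :=
  adjMod_ext 𝓡 fun a => by
    rw [comp_lin, antipodeHom_lin, rep_lin]
    exact repLin_antipodeH₀ _ _ a

theorem mateAlong_adjAction :
    mateAlong (η_ (reg 𝓡) (dual (reg 𝓡))) (adjAction (reg 𝓡)) = regRep 𝓡 :=
  mate_adjAction _ _

/-- `H₀` is a Hopf algebra in the category of modules. -/
theorem isHopf_adjMod :
    IsHopf (mulHom 𝓡) (unitHom 𝓡) (comulHom 𝓡) (counitHom 𝓡) (antipodeHom 𝓡) := by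
  refine isHopf_of_action (D := dual) adjAction (fun f => adjAction_naturality f)
    (fun V => action_mul_of_mate (D := dual V) _ _ ?_) (fun V => ?_)
    (fun V W => action_comul_of_mate (D := dual V) (E := dual W) (T := dual (V ⊗ W)) _ _ _ _
      (dualComparison _ _ _) (dualComparison_evaluation _ _ _) ?_) (by simp [counitHom])
    (fun V => ?_) (fun f g h => ?_) (fun f g h => ?_) (fun f g h => ?_)
  · rw [mate_adjAction, mulHom_rep]
  · rw [adjAction_eq V (dual V), ← comp_whiskerRight_assoc, unitHom_rep, unmate_coevaluation]
  · rw [mate_adjAction V (dual V), mate_adjAction W (dual W),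
      mate_adjAction (V ⊗ W) (dual (V ⊗ W)),
      comulHom_rep 𝓡 V W _ _ (dual (V ⊗ W))]
  · rw [mate_adjAction, antipodeHom_rep]
  -- Universality: the mate of the action on the regular module is injective, and so are its tensor
  -- powers over the field $k$; testing on regular modules suffices.
  · apply cancel_of_injective (regRep 𝓡) regRep_injective
    rw [← mateAlong_adjAction, ← mateAlong_comp, h, mateAlong_comp]
  · apply cancel_of_injective (regRep 𝓡 ⊗ₘ regRep 𝓡)
      (tensorHom_injective regRep_injective regRep_injective)
    rw [← mateAlong_adjAction]
    exact tensor_cancel _ _ _ _ f g (h _ _)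
  · apply cancel_of_injective (regRep 𝓡 ⊗ₘ (regRep 𝓡 ⊗ₘ regRep 𝓡))
      (tensorHom_injective regRep_injective (tensorHom_injective regRep_injective regRep_injective))
    rw [← mateAlong_adjAction]
    exact tensor_cancel₃ _ _ _ _ _ _ f g (h _ _ _)

end Hopf

end QMod

/-! ### Formulas for the dual structure and linearity of the maps of $H_0$ -/

section Raw

variable {k H : Type*} [Field k] [Ring H] [Algebra k H] {Q : QuasiHopfAlgebra k H}

theorem TensorProduct.comm_mul (s t : H ⊗[k] H) : TensorProduct.comm k H H (s * t) =
    TensorProduct.comm k H H s * TensorProduct.comm k H H t :=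
  map_mul (Algebra.TensorProduct.comm k H H) s t

theorem comm_comm_apply (t : H ⊗[k] H) :
    TensorProduct.comm k H H (TensorProduct.comm k H H t) = t := by
  revert t
  exact tensor_ext (by fun_prop) (by fun_prop) fun m n => by simp

theorem TensorProduct.comm_one : TensorProduct.comm k H H 1 = 1 :=
  map_one (Algebra.TensorProduct.comm k H H)

end Raw

section

variable {k : Type u} {H : Type v} [Field k] [Ring H] [Algebra k H] {Q : QuasiHopfAlgebra k H}
  [FiniteDimensional k H]

open QMod

/-- The convolution product pairs $t^2$ with the first factor, so it is the parallel pairing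
precomposed with $t_{21}$. -/
theorem RMatrix.dualMul_apply (𝓡 : RMatrix Q) (T : H →ₗ[k] H) (t : H ⊗[k] H)
    (φ ψ : Module.Dual k H) (h : H) : 𝓡.dualMul T t φ ψ h =
      TensorProduct.dualDistrib k H H (φ ⊗ₜ ψ) (tact (adjHom Q) (adjHom Q)
        (TensorProduct.comm k H H (TensorProduct.map T T t)) (𝓡.comulH₀ h)) := by
  change (sw t fun t₁ t₂ => LinearMap.mul' k k ∘ₗ
      TensorProduct.map (φ ∘ₗ Q.adj (T t₂)) (ψ ∘ₗ Q.adj (T t₁)) ∘ₗ 𝓡.comulH₀) h = _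
  generalize 𝓡.comulH₀ = D
  revert t
  refine tensor_ext (by fun_prop) (by fun_prop) fun a b => ?_
  simp (disch := fun_prop) only [sw_pure]
  simp only [LinearMap.comp_apply]
  generalize D h = y
  revert y
  exact tensor_ext (by fun_prop) (by fun_prop) fun c d => by simp [adjHom]

theorem dualDistrib_injective {x y : Module.Dual k H ⊗[k] Module.Dual k H}
    (h : ∀ z, TensorProduct.dualDistrib k H H x z = TensorProduct.dualDistrib k H H y z) :
    x = y := by
  refine (TensorProduct.dualDistribEquiv k H H).injective (LinearMap.ext fun z => ?_)
  exact h z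

theorem QuasiHopfAlgebra.dualComul_apply (Q : QuasiHopfAlgebra k H) (T : H →ₗ[k] H) (t : H ⊗[k] H)
    (φ : Module.Dual k H) (y : H ⊗[k] H) :
    TensorProduct.dualDistrib k H H (Q.dualComul T t φ) y = φ (TensorProduct.lift Q.circ
      (tact (adjHom Q) (adjHom Q) (TensorProduct.comm k H H (TensorProduct.map T T t)) y)) := by
  change TensorProduct.dualDistrib k H H (∑ i, ∑ j,
    (sw t fun t₁ t₂ => φ (Q.circ (Q.adj (T t₂) (Module.finBasis k H i))
      (Q.adj (T t₁) (Module.finBasis k H j)))) •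
    ((Module.finBasis k H).coord i ⊗ₜ[k] (Module.finBasis k H).coord j)) y = _
  revert t
  refine tensor_ext (by fun_prop) (by fun_prop) fun a b => ?_
  simp (disch := fun_prop) only [sw_pure]
  refine LinearMap.congr_fun (f := TensorProduct.dualDistrib k H H _) (g := φ ∘ₗ
    TensorProduct.lift Q.circ ∘ₗ tact (adjHom Q) (adjHom Q) (TensorProduct.comm k H H
      (TensorProduct.map T T (a ⊗ₜ b)))) ?_ y
  refine ((Module.finBasis k H).tensorProduct (Module.finBasis k H)).ext fun ij => ?_
  obtain ⟨i, j⟩ := ij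
  rw [Module.Basis.tensorProduct_apply]
  simp [adjHom, Finsupp.single_apply]

theorem dualDistrib_tact (s : H ⊗[k] H) (θ : Module.Dual k H ⊗[k] Module.Dual k H) (y : H ⊗[k] H)
    (ρ : H →ₐ[k] Module.End k (Module.Dual k H)) (T : H →ₗ[k] H)
    (hρ : ∀ a φ h, ρ a φ h = φ (Q.adj (T a) h)) :
    TensorProduct.dualDistrib k H H (tact ρ ρ s θ) y = TensorProduct.dualDistrib k H H θ
      (tact (adjHom Q) (adjHom Q) (TensorProduct.map T T s) y) := by
  revert s
  refine tensor_ext (by fun_prop) (by fun_prop) fun a b => ?_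
  revert θ
  refine tensor_ext (by fun_prop) (by fun_prop) fun φ ψ => ?_
  revert y
  exact tensor_ext (by fun_prop) (by fun_prop) fun c d => by simp [hρ, adjHom]

variable (𝓡 : RMatrix Q)

theorem map_adjEquiv_tact (s y : H ⊗[k] H) :
    TensorProduct.map (adjEquiv 𝓡).toLinearMap (adjEquiv 𝓡).toLinearMap
      (tact (adjHom Q) (adjHom Q) s y) = tact (adjMod 𝓡).act (adjMod 𝓡).act s
    (TensorProduct.map (adjEquiv 𝓡).toLinearMap (adjEquiv 𝓡).toLinearMap y) := by
  revert s
  refine tensor_ext (by fun_prop) (by fun_prop) fun a b => ?_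
  revert y
  exact tensor_ext (by fun_prop) (by fun_prop) fun c d => by simp [adjHom]

variable [h𝓡 : Fact 𝓡.IsTriangular]

theorem RMatrix.comulH₀_adj (a h : H) :
    𝓡.comulH₀ (Q.adj a h) = tact (adjHom Q) (adjHom Q) (Q.Δ a) (𝓡.comulH₀ h) := by
  have := (comulHom 𝓡).comm a (adjEquiv 𝓡 h)
  rw [adjMod_act, comulHom_lin, comulHom_lin] at this
  apply (TensorProduct.congr (adjEquiv 𝓡) (adjEquiv 𝓡)).injective
  exact this.trans (map_adjEquiv_tact 𝓡 _ _).symm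

include 𝓡 in
theorem QuasiHopfAlgebra.circ_adj (a : H) (y : H ⊗[k] H) :
    TensorProduct.lift Q.circ (tact (adjHom Q) (adjHom Q) (Q.Δ a) y) =
      Q.adj a (TensorProduct.lift Q.circ y) := by
  have e : ∀ y : H ⊗[k] H, (mulHom 𝓡).lin
      (TensorProduct.map (adjEquiv 𝓡).toLinearMap (adjEquiv 𝓡).toLinearMap y) =
      adjEquiv 𝓡 (TensorProduct.lift Q.circ y) :=
    tensor_ext (isLinearMap_comp (Hom.lin _).isLinear (LinearMap.isLinear _)) (by fun_prop)
      fun c d => by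
        rw [TensorProduct.map_tmul]
        exact mulHom_lin 𝓡 c d
  have := (mulHom 𝓡).comm a (TensorProduct.map (adjEquiv 𝓡).toLinearMap
    (adjEquiv 𝓡).toLinearMap y)
  apply (adjEquiv 𝓡).injective
  rw [← adjMod_act, ← e, ← e, map_adjEquiv_tact]
  exact this

theorem RMatrix.antipodeH₀_adj (a h : H) :
    𝓡.antipodeH₀ (Q.adj a h) = Q.adj a (𝓡.antipodeH₀ h) := by
  have := (antipodeHom 𝓡).comm a (adjEquiv 𝓡 h)
  rw [adjMod_act, antipodeHom_lin, antipodeHom_lin, adjMod_act] at this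
  exact (adjEquiv 𝓡).injective this

include 𝓡 in
theorem QuasiHopfAlgebra.ε_adj (a h : H) : Q.ε (Q.adj a h) = Q.ε a * Q.ε h := by
  have := congrArg ULift.down ((counitHom 𝓡).comm a (adjEquiv 𝓡 h))
  rw [adjMod_act, counitHom_lin, counitHom_lin] at this
  exact this

theorem QuasiHopfAlgebra.adj_β (Q : QuasiHopfAlgebra k H) (a : H) :
    Q.adj a Q.β = Q.ε a • Q.β := Q.S_β a

end

/-! ### The twist $(fR^{-1})_{21}$ and its identities -/

section Twist

variable {k : Type u} {H : Type v} [Field k] [Ring H] [Algebra k H] {Q : QuasiHopfAlgebra k H}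
  [FiniteDimensional k H] (𝓡 : RMatrix Q) [h𝓡 : Fact 𝓡.IsTriangular]

/-- The element `(f R⁻¹)₂₁`. -/
noncomputable def RMatrix.twist : H ⊗[k] H := TensorProduct.comm k H H (Q.f * 𝓡.R⁻¹.val)

/-- The element `(R f⁻¹)₂₁`. -/
noncomputable def RMatrix.twistInv : H ⊗[k] H := TensorProduct.comm k H H (𝓡.R.val * Q.g)

omit [Fact 𝓡.IsTriangular] in
theorem RMatrix.twistInv_mul_twist : 𝓡.twistInv * 𝓡.twist = 1 := by
  rw [twistInv, twist, ← TensorProduct.comm_mul, mul_assoc, ← mul_assoc Q.g, Q.g_mul_f 𝓡, one_mul,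
    Units.mul_inv, TensorProduct.comm_one]

omit [Fact 𝓡.IsTriangular] in
theorem RMatrix.twist_mul_twistInv : 𝓡.twist * 𝓡.twistInv = 1 :=
  mul_eq_one_symm_of_finite (k := k) 𝓡.twistInv_mul_twist

/-- $R_{21}\,(g\gamma)_{21}R=R_{21}\Delta^{op}(\alpha)R=R_{21}R\,\Delta(\alpha)=\Delta(\alpha)$;
triangularity enters as $R_{21}=R^{-1}$. -/
theorem RMatrix.twistInv_mul_γ :
    𝓡.twistInv * (TensorProduct.comm k H H Q.γ * 𝓡.R.val) = Q.Δ Q.α := by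
  rw [twistInv, TensorProduct.comm_mul, mul_assoc, ← mul_assoc _ _ 𝓡.R.val,
    ← TensorProduct.comm_mul, Q.g_mul_γ 𝓡, 𝓡.Δ_op, ← h𝓡.out, Units.inv_mul_cancel_left]

theorem RMatrix.twist_mul_Δ_α :
    𝓡.twist * Q.Δ Q.α = TensorProduct.comm k H H Q.γ * 𝓡.R.val := by
  rw [← twistInv_mul_γ 𝓡, ← mul_assoc, 𝓡.twist_mul_twistInv, one_mul]

omit [FiniteDimensional k H] in
theorem QuasiHopfAlgebra.comm_SSΔop (h : H) : TensorProduct.comm k H H (Q.SSΔop h) =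
    TensorProduct.map Q.S.toLinearMap Q.S.toLinearMap (Q.Δ h) := by
  unfold QuasiHopfAlgebra.SSΔop
  generalize Q.Δ h = s
  revert s
  exact tensor_ext (by fun_prop) (by fun_prop) fun a b => by simp (disch := fun_prop) [sw_pure]

/-- The twist $g$ reverses the coproduct under $S$, and flipping legs together with $R$ restores the
order. So the twisted dual product and coproduct are linear without interchanging factors. -/
theorem RMatrix.Δ_S_mul_twistInv (h : H) : Q.Δ (Q.S h) * 𝓡.twistInv =
    𝓡.twistInv * TensorProduct.map Q.S.toLinearMap Q.S.toLinearMap (Q.Δ h) := by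
  have e : ∀ h, Q.Δ h * TensorProduct.comm k H H 𝓡.R.val = TensorProduct.comm k H H 𝓡.R.val *
      TensorProduct.comm k H H (Q.Δ h) := by
    intro h
    rw [← TensorProduct.comm_mul, ← 𝓡.Δ_op, TensorProduct.comm_mul, comm_comm_apply]
  rw [twistInv, TensorProduct.comm_mul, ← mul_assoc, e, mul_assoc, ← TensorProduct.comm_mul,
    Q.Δ_S_mul_g 𝓡, TensorProduct.comm_mul, Q.comm_SSΔop, mul_assoc]

theorem RMatrix.twist_mul_Δ_S (h : H) : 𝓡.twist * Q.Δ (Q.S h) =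
    TensorProduct.map Q.S.toLinearMap Q.S.toLinearMap (Q.Δ h) * 𝓡.twist := by
  have := congrArg (fun x => 𝓡.twist * x * 𝓡.twist) (𝓡.Δ_S_mul_twistInv h)
  simp only [mul_assoc, 𝓡.twistInv_mul_twist, mul_one] at this
  rw [this, ← mul_assoc, ← mul_assoc, 𝓡.twist_mul_twistInv, one_mul]

end Twist

/-! ### The left dual of $H_0$ as a Hopf monoid in modules -/

namespace QMod

section PairTensor

variable {k : Type u} {H : Type v} [Field k] [Ring H] [Algebra k H] {Q : QuasiHopfAlgebra k H}
  {𝓡 : RMatrix Q} [Fact 𝓡.IsTriangular] (V W D E : QMod 𝓡) [DualPair V D] [DualPair W E]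

/-- The parallel pairing is the nested one after a braiding, so its correcting element is
$\gamma_{21}R$. -/
theorem pairTensor_lin (θ : D.carrier ⊗[k] E.carrier) (y : V.carrier ⊗[k] W.carrier) :
    (pairTensor (ε_ V D) (ε_ W E)).lin (θ ⊗ₜ y) = ULift.up (nestedForm W V E D θ
      (TensorProduct.comm k _ _ (tact V.act W.act (TensorProduct.comm k H H Q.γ * 𝓡.R.val) y))) := by
  rw [pairTensor, ← braid_nested_evaluation, comp_lin, whiskerLeft_lin]
  refine (nested_evaluation_lin W V E D _ _).trans ?_
  rw [map_mul, Module.End.mul_apply, tact_comm, comm_comm_apply]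
  rfl

end PairTensor

variable {k : Type u} {H : Type v} [Field k] [Ring H] [Algebra k H] {Q : QuasiHopfAlgebra k H}
  [FiniteDimensional k H]

/-- The action on the left dual of `H₀`. -/
noncomputable def leftDualHom (Q : QuasiHopfAlgebra k H) :
    H →ₐ[k] Module.End k (Module.Dual k H) where
  toFun := Q.leftDualAct
  map_one' := by
    ext φ h
    change φ (adjHom Q (Q.S 1) h) = φ h
    rw [Q.S_one, map_one]; rfl
  map_mul' a b := by
    ext φ h
    change φ (adjHom Q (Q.S (a * b)) h) = φ (adjHom Q (Q.S b) (adjHom Q (Q.S a) h))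
    rw [Q.S_mul, map_mul]; rfl
  map_zero' := map_zero _
  map_add' := map_add _
  commutes' c := by
    ext φ h
    change φ (adjHom Q (Q.S _) h) = _
    simp [Algebra.algebraMap_eq_smul_one, Q.S_one]

theorem leftDualHom_apply (a : H) (φ : Module.Dual k H) (h : H) :
    leftDualHom Q a φ h = φ (Q.adj (Q.S a) h) := rfl

variable (𝓡 : RMatrix Q)

/-- The left dual of `H₀` as a module. -/
noncomputable abbrev leftDualMod : QMod 𝓡 where
  carrier := Module.Dual k H
  act := leftDualHom Q

/-- $H_0^*$ lives on $\mathrm{Hom}_k(H,k)$ itself, while the adjoint module is a universe lift of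
$H$. Declaring a dual pair makes the abstract theory apply to the given carrier. -/
noncomputable instance : DualPair (adjMod 𝓡) (leftDualMod 𝓡) where
  pair := (adjEquiv 𝓡).dualMap.symm
  pair_act a φ h := by
    obtain ⟨h, rfl⟩ := (adjEquiv 𝓡).surjective h
    rw [adjMod_act]
    change leftDualHom Q a φ ((adjEquiv 𝓡).symm _) = φ ((adjEquiv 𝓡).symm _)
    simp [leftDualHom_apply]

theorem pairing_leftDual (φ : Module.Dual k H) (h : H) :
    pairing (adjMod 𝓡) (leftDualMod 𝓡) φ (adjEquiv 𝓡 h) = φ h := by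
  change φ ((adjEquiv 𝓡).symm _) = _
  simp

theorem evaluation_leftDual (φ : Module.Dual k H) (h : H) :
    (ε_ (adjMod 𝓡) (leftDualMod 𝓡)).lin (φ ⊗ₜ adjEquiv 𝓡 h) = ULift.up (φ (Q.adj Q.α h)) := by
  refine (evaluation_lin (adjMod 𝓡) (leftDualMod 𝓡) φ (adjEquiv 𝓡 h)).trans ?_
  rw [adjMod_act, pairing_leftDual]

theorem nestedForm_leftDual (θ : Module.Dual k H ⊗[k] Module.Dual k H) (y : H ⊗[k] H) :
    nestedForm (adjMod 𝓡) (adjMod 𝓡) (leftDualMod 𝓡) (leftDualMod 𝓡) θ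
      (TensorProduct.comm k _ _
        (TensorProduct.map (adjEquiv 𝓡).toLinearMap (adjEquiv 𝓡).toLinearMap y)) =
      TensorProduct.dualDistrib k H H θ y := by
  revert θ
  refine tensor_ext (by fun_prop) (by fun_prop) fun φ ψ => ?_
  revert y
  refine tensor_ext (by fun_prop) (by fun_prop) fun a b => ?_
  simp only [TensorProduct.map_tmul, TensorProduct.comm_tmul, LinearEquiv.coe_coe,
    TensorProduct.dualDistrib_apply]
  refine (nestedForm_tmul _ _ _ _ _ _ _ _).trans ?_
  rw [pairing_leftDual, pairing_leftDual, mul_comm]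

section Hopf

variable [h𝓡 : Fact 𝓡.IsTriangular]

theorem pairTensor_leftDual (θ : Module.Dual k H ⊗[k] Module.Dual k H) (y : H ⊗[k] H) :
    (pairTensor (ε_ (adjMod 𝓡) (leftDualMod 𝓡)) (ε_ (adjMod 𝓡) (leftDualMod 𝓡))).lin (θ ⊗ₜ
      TensorProduct.map (adjEquiv 𝓡).toLinearMap (adjEquiv 𝓡).toLinearMap y) =
    ULift.up (TensorProduct.dualDistrib k H H θ
      (tact (adjHom Q) (adjHom Q) (TensorProduct.comm k H H Q.γ * 𝓡.R.val) y)) := by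
  refine (pairTensor_lin _ _ _ _ _ _).trans ?_
  rw [← map_adjEquiv_tact, nestedForm_leftDual]

omit h𝓡 in
theorem dualMul_apply_twist (φ ψ : Module.Dual k H) (h : H) :
    𝓡.leftDualH₀.mul φ ψ h = TensorProduct.dualDistrib k H H (φ ⊗ₜ ψ)
      (tact (adjHom Q) (adjHom Q) 𝓡.twist (𝓡.comulH₀ h)) := by
  refine (𝓡.dualMul_apply _ _ φ ψ h).trans ?_
  rw [TensorProduct.map_id]; rfl

omit h𝓡 in
theorem lift_dualMul_apply (θ : Module.Dual k H ⊗[k] Module.Dual k H) (h : H) :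
    TensorProduct.lift 𝓡.leftDualH₀.mul θ h = TensorProduct.dualDistrib k H H θ
      (tact (adjHom Q) (adjHom Q) 𝓡.twist (𝓡.comulH₀ h)) := by
  revert θ
  exact tensor_ext (by fun_prop) (by fun_prop) fun φ ψ => dualMul_apply_twist 𝓡 φ ψ h

omit h𝓡 in
theorem dualComul_apply_twist (φ : Module.Dual k H) (y : H ⊗[k] H) :
    TensorProduct.dualDistrib k H H (𝓡.leftDualH₀.comul φ) y =
      φ (TensorProduct.lift Q.circ (tact (adjHom Q) (adjHom Q) 𝓡.twistInv y)) := by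
  refine (Q.dualComul_apply _ _ φ y).trans ?_
  rw [TensorProduct.map_id]; rfl

/-- The multiplication of the left dual of `H₀`. -/
noncomputable def leftMulHom : leftDualMod 𝓡 ⊗ leftDualMod 𝓡 ⟶ leftDualMod 𝓡 where
  lin := TensorProduct.lift 𝓡.leftDualH₀.mul
  comm a θ := by
    refine LinearMap.ext fun h => ?_
    refine (lift_dualMul_apply 𝓡 _ h).trans ?_
    rw [leftDualHom_apply]
    refine Eq.trans ?_ (lift_dualMul_apply 𝓡 θ _).symm
    refine (dualDistrib_tact (Q.Δ a) θ _ (leftDualHom Q) Q.S.toLinearMap fun _ _ _ => rfl).trans ?_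
    rw [𝓡.comulH₀_adj, ← Module.End.mul_apply, ← Module.End.mul_apply, ← map_mul, ← map_mul,
      𝓡.twist_mul_Δ_S]

/-- The comultiplication of the left dual of `H₀`. -/
noncomputable def leftComulHom : leftDualMod 𝓡 ⟶ leftDualMod 𝓡 ⊗ leftDualMod 𝓡 where
  lin := 𝓡.leftDualH₀.comul
  comm a φ := by
    refine dualDistrib_injective fun y => ?_
    refine (dualComul_apply_twist 𝓡 _ y).trans ?_
    refine Eq.trans ?_ (dualDistrib_tact (Q.Δ a) _ y (leftDualHom Q) Q.S.toLinearMap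
      fun _ _ _ => rfl).symm
    rw [dualComul_apply_twist, ← Module.End.mul_apply, ← map_mul, ← 𝓡.Δ_S_mul_twistInv, map_mul,
      Module.End.mul_apply, Q.circ_adj 𝓡]
    rfl

/-- The unit of the left dual of `H₀`. -/
noncomputable def leftUnitHom : 𝟙_ (QMod 𝓡) ⟶ leftDualMod 𝓡 where
  lin := LinearMap.toSpanSingleton k _ Q.ε.toLinearMap ∘ₗ ULift.moduleEquiv.toLinearMap
  comm a c := by
    refine LinearMap.ext fun h => ?_
    change (Q.ε a • c.down) * Q.ε h = (c.down • Q.ε (Q.adj (Q.S a) h))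
    rw [Q.ε_adj 𝓡, Q.ε_S]
    simp only [smul_eq_mul]; ring

/-- The counit of the left dual of `H₀`. -/
noncomputable def leftCounitHom : leftDualMod 𝓡 ⟶ 𝟙_ (QMod 𝓡) where
  lin := ULift.moduleEquiv.symm.toLinearMap ∘ₗ LinearMap.applyₗ Q.β
  comm a φ := by
    refine ULift.ext _ _ ?_
    change φ (Q.adj (Q.S a) Q.β) = Q.ε a • φ Q.β
    rw [Q.adj_β, Q.ε_S, map_smul]

/-- The antipode of the left dual of `H₀`. -/
noncomputable def leftAntipodeHom : leftDualMod 𝓡 ⟶ leftDualMod 𝓡 where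
  lin := Module.Dual.transpose 𝓡.antipodeH₀
  comm a φ := by
    refine LinearMap.ext fun h => ?_
    change φ (Q.adj (Q.S a) (𝓡.antipodeH₀ h)) = φ (𝓡.antipodeH₀ (Q.adj (Q.S a) h))
    rw [𝓡.antipodeH₀_adj]

theorem hom_ext_adj {X W : QMod 𝓡} {f g : X ⊗ adjMod 𝓡 ⟶ W}
    (h : ∀ (x : X.carrier) (a : H), f.lin (x ⊗ₜ adjEquiv 𝓡 a) = g.lin (x ⊗ₜ adjEquiv 𝓡 a)) :
    f = g :=
  tensor_hom_ext fun x a => by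
    obtain ⟨a, rfl⟩ := (adjEquiv 𝓡).surjective a
    exact h x a

/-- The left dual of `H₀` is a Hopf algebra in the category of modules. -/
theorem isHopf_leftDual : IsHopf (leftMulHom 𝓡) (leftUnitHom 𝓡) (leftComulHom 𝓡)
    (leftCounitHom 𝓡) (leftAntipodeHom 𝓡) := by
  refine (isHopf_adjMod 𝓡).dual ?_ ?_ ?_ ?_ ?_
  · refine hom_ext_adj 𝓡 fun θ h => ?_
    rw [comp_lin, comp_lin, whiskerRight_lin, whiskerLeft_lin, TensorProduct.map_tmul,
      TensorProduct.map_tmul, comulHom_lin]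
    refine (evaluation_leftDual 𝓡 _ h).trans ?_
    refine Eq.trans ?_ (pairTensor_leftDual 𝓡 θ _).symm
    refine congrArg ULift.up ?_
    refine (lift_dualMul_apply 𝓡 θ _).trans ?_
    -- The evaluation contains $\alpha$, which acts on $\underline\Delta(h)$ through
    -- $\Delta(\alpha)$; the twist turns it into the element $\gamma_{21}R$ of the parallel pairing.
    rw [𝓡.comulH₀_adj, ← Module.End.mul_apply, ← map_mul, 𝓡.twist_mul_Δ_α]
  · refine hom_ext_adj 𝓡 fun c h => ?_
    rw [comp_lin, comp_lin, whiskerRight_lin, TensorProduct.map_tmul]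
    refine (evaluation_leftDual 𝓡 _ h).trans ?_
    rw [leftUnitor_hom_lin, map_smul, counitHom_lin]
    refine congrArg ULift.up ?_
    change c.down * Q.ε (Q.adj Q.α h) = c.down * Q.ε h
    rw [Q.ε_adj 𝓡, Q.ε_α, one_mul]
  · refine tensor_hom_ext fun φ y => ?_
    obtain ⟨y, rfl⟩ := (TensorProduct.congr (adjEquiv 𝓡) (adjEquiv 𝓡)).surjective y
    rw [comp_lin, comp_lin, whiskerRight_lin, whiskerLeft_lin, TensorProduct.map_tmul]
    refine (pairTensor_leftDual 𝓡 _ y).trans ?_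
    have e : ∀ y : H ⊗[k] H, (mulHom 𝓡).lin (TensorProduct.congr (adjEquiv 𝓡) (adjEquiv 𝓡) y) =
        adjEquiv 𝓡 (TensorProduct.lift Q.circ y) :=
      tensor_ext (isLinearMap_comp (Hom.lin _).isLinear
        (TensorProduct.congr (adjEquiv 𝓡) (adjEquiv 𝓡)).toLinearMap.isLinear) (by fun_prop)
        fun c d => by
          rw [TensorProduct.congr_tmul]
          exact mulHom_lin 𝓡 c d
    refine Eq.trans ?_ (congrArg (fun z => (ε_ (adjMod 𝓡) (leftDualMod 𝓡)).lin (φ ⊗ₜ z)) (e y)).symm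
    refine Eq.trans ?_ (evaluation_leftDual 𝓡 _ _).symm
    refine congrArg ULift.up ?_
    refine (dualComul_apply_twist 𝓡 φ _).trans ?_
    rw [← Module.End.mul_apply, ← map_mul, 𝓡.twistInv_mul_γ, Q.circ_adj 𝓡]
  · refine hom_ext fun φ => ?_
    rw [comp_lin, comp_lin, rightUnitor_inv_lin, whiskerLeft_lin, TensorProduct.map_tmul,
      unitHom_lin]
    refine Eq.trans ?_ (congrArg (fun z => (ε_ (adjMod 𝓡) (leftDualMod 𝓡)).lin (φ ⊗ₜ z))
      (one_smul k (adjEquiv 𝓡 Q.β))).symm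
    refine Eq.trans ?_ (evaluation_leftDual 𝓡 _ _).symm
    rw [Q.adj_β, Q.ε_α, one_smul]
    rfl
  · refine hom_ext_adj 𝓡 fun φ h => ?_
    rw [comp_lin, comp_lin, whiskerRight_lin, whiskerLeft_lin, TensorProduct.map_tmul,
      TensorProduct.map_tmul, antipodeHom_lin]
    refine (evaluation_leftDual 𝓡 _ _).trans ?_
    refine Eq.trans ?_ (evaluation_leftDual 𝓡 _ _).symm
    refine congrArg ULift.up ?_
    change φ (𝓡.antipodeH₀ _) = _
    rw [𝓡.antipodeH₀_adj]
    rfl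

end Hopf

end QMod

/-! ### Modules as Yetter–Drinfeld modules -/

section YetterDrinfeld

variable {k H : Type*} [Field k] [Ring H] [Algebra k H] {Q : QuasiHopfAlgebra k H}
  (𝓡 : RMatrix Q) {V W : Type*} [AddCommGroup V] [Module k V] [AddCommGroup W] [Module k W]

theorem RMatrix.coact_apply (act : H →ₗ[k] V →ₗ[k] V) (v : V) :
    𝓡.coact act v = sw 𝓡.R.val fun R₁ R₂ => R₂ ⊗ₜ[k] act R₁ v :=
  sw_map (E := fun t : V →ₗ[k] H ⊗[k] V => t v) (by fun_prop) _ _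

/-- The two sides of `hexagon_element` with their legs written out; applied to $m$ in the last leg,
this is the coassociativity axiom for the coaction. -/
theorem RMatrix.coact_coassoc_element :
    (sw3 Q.Φ.val fun X₁ X₂ X₃ => sw 𝓡.R.val fun R₁ R₂ => sw 𝓡.R.val fun R'₁ R'₂ =>
      (X₁ * R₂) ⊗ₜ[k] ((R'₂ * X₃) ⊗ₜ[k] (R'₁ * X₂ * R₁))) =
    (sw3 Q.Φ.val fun X₁ X₂ X₃ => sw3 Q.Φ.val fun Y₁ Y₂ Y₃ => sw 𝓡.R.val fun R₁ R₂ =>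
      sw (Q.Δ R₂) fun a₁ a₂ => (X₁ * a₁ * Y₂) ⊗ₜ[k] ((X₂ * a₂ * Y₃) ⊗ₜ[k] (X₃ * R₁ * Y₁))) := by
  have l : ∀ (t : H ⊗[k] (H ⊗[k] H)) (r r' : H ⊗[k] H),
      (sw3 t fun X₁ X₂ X₃ => sw r fun R₁ R₂ => sw r' fun R'₁ R'₂ =>
        (X₁ * R₂) ⊗ₜ[k] ((R'₂ * X₃) ⊗ₜ[k] (R'₁ * X₂ * R₁))) =
      QMod.swap₂₃ ((1 ⊗ₜ r') * t * sw r fun R₁ R₂ => R₂ ⊗ₜ[k] (R₁ ⊗ₜ[k] (1 : H))) := by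
    intro t r r'
    revert t
    refine tensor_ext₃ (by fun_prop) (by fun_prop) fun a b c => ?_
    revert r
    refine tensor_ext (by fun_prop) (by fun_prop) fun p q => ?_
    revert r'
    refine tensor_ext (by fun_prop) (by fun_prop) fun p' q' => ?_
    simp (disch := fun_prop) [sw_pure, sw3_pure]
  have r : ∀ (t s : H ⊗[k] (H ⊗[k] H)) (r : H ⊗[k] H),
      (sw3 t fun X₁ X₂ X₃ => sw3 s fun Y₁ Y₂ Y₃ => sw r fun R₁ R₂ =>
      sw (Q.Δ R₂) fun a₁ a₂ => (X₁ * a₁ * Y₂) ⊗ₜ[k] ((X₂ * a₂ * Y₃) ⊗ₜ[k] (X₃ * R₁ * Y₁))) =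
      t * QMod.cyc ((sw r fun R₁ R₂ => R₁ ⊗ₜ[k] Q.Δ R₂) * s) := by
    intro t s r
    revert t
    refine tensor_ext₃ (by fun_prop) (by fun_prop) fun a b c => ?_
    revert s
    refine tensor_ext₃ (by fun_prop) (by fun_prop) fun a' b' c' => ?_
    revert r
    refine tensor_ext (by fun_prop) (by fun_prop) fun p q => ?_
    simp (disch := fun_prop) only [sw_pure, sw3_pure]
    generalize Q.Δ q = s
    revert s
    refine tensor_ext (by fun_prop) (by fun_prop) fun p q => ?_
    simp (disch := fun_prop) [sw_pure, mul_assoc]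
  rw [l, r, QMod.hexagon_element (𝓡 := 𝓡)]

variable (ρ : H →ₐ[k] Module.End k V) (σ : H →ₐ[k] Module.End k W)

/-- A module over a quasi-Hopf algebra with an `R`-matrix is a Yetter-Drinfeld module. -/
theorem RMatrix.isYetterDrinfeld (M : YDData k H V) (hact : ∀ a v, M.act a v = ρ a v)
    (hcoact : M.coact = 𝓡.coact M.act) : IsYetterDrinfeld Q M where
  one_act v := by rw [hact, map_one]; rfl
  mul_act a b v := by rw [hact, hact, hact, map_mul]; rfl
  coact_coassoc m := by
    obtain ⟨E, hE⟩ : ∃ E : H ⊗[k] (H ⊗[k] H) →ₗ[k] H ⊗[k] (H ⊗[k] V),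
        ∀ a b c, E (a ⊗ₜ (b ⊗ₜ c)) = a ⊗ₜ (b ⊗ₜ ρ c m) :=
      ⟨TensorProduct.map LinearMap.id (TensorProduct.map LinearMap.id
        (LinearMap.applyₗ m ∘ₗ ρ.toLinearMap)), fun a b c => by simp⟩
    have := congrArg E 𝓡.coact_coassoc_element
    simp only [sw_map (k := k) (E := fun t => E t) (by fun_prop),
      sw3_map (k := k) (E := fun t => E t) (by fun_prop), hE] at this
    rw [hcoact]
    simp only [𝓡.coact_apply, hact]
    generalize 𝓡.R.val = r at this ⊢
    have e : ∀ (X₁ X₂ X₃ : H), (sw (sw r fun R₁ R₂ => R₂ ⊗ₜ[k] ρ R₁ m) fun a m₀ =>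
        sw (sw r fun R₁ R₂ => R₂ ⊗ₜ[k] ρ R₁ (ρ X₂ m₀)) fun b n₀ =>
          (X₁ * a) ⊗ₜ[k] ((b * X₃) ⊗ₜ[k] n₀)) = sw r fun R₁ R₂ => sw r fun R'₁ R'₂ =>
      (X₁ * R₂) ⊗ₜ[k] ((R'₂ * X₃) ⊗ₜ[k] (ρ (R'₁ * X₂ * R₁) m)) := by
      intro X₁ X₂ X₃
      generalize hr : r = r'
      nth_rewrite 1 [← hr]
      nth_rewrite 2 [← hr]
      clear hr this
      revert r
      refine tensor_ext (by fun_prop) (by fun_prop) fun p q => ?_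
      revert r'
      refine tensor_ext (by fun_prop) (by fun_prop) fun p' q' => ?_
      simp (disch := fun_prop) [sw_pure]
    have e' : ∀ (X₁ X₂ X₃ Y₁ Y₂ Y₃ : H), (sw (sw r fun R₁ R₂ => R₂ ⊗ₜ[k] ρ R₁ (ρ Y₁ m)) fun a m₀ =>
        sw (Q.Δ a) fun a₁ a₂ => (X₁ * a₁ * Y₂) ⊗ₜ[k] ((X₂ * a₂ * Y₃) ⊗ₜ[k] ρ X₃ m₀)) =
        sw r fun R₁ R₂ => sw (Q.Δ R₂) fun a₁ a₂ =>
          (X₁ * a₁ * Y₂) ⊗ₜ[k] ((X₂ * a₂ * Y₃) ⊗ₜ[k] ρ (X₃ * R₁ * Y₁) m) := by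
      intro X₁ X₂ X₃ Y₁ Y₂ Y₃
      clear this e
      revert r
      refine tensor_ext (by fun_prop) (by fun_prop) fun p q => ?_
      simp (disch := fun_prop) [sw_pure]
    simp only [e, e']
    exact this
  coact_counit m := by
    have := congrArg (fun h => ρ h m) 𝓡.ε_right
    rw [sw_map (k := k) (E := fun h => ρ h m) (by fun_prop)] at this
    rw [hcoact, 𝓡.coact_apply]
    simp only [map_smul, map_one] at this
    refine Eq.trans ?_ this
    simp only [hact]
    generalize 𝓡.R.val = r
    revert r
    refine tensor_ext (by fun_prop) (by fun_prop) fun p q => ?_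
    simp (disch := fun_prop) [sw_pure]
  act_coact h m := by
    have := congrArg (fun t => TensorProduct.map LinearMap.id (LinearMap.applyₗ m ∘ₗ ρ.toLinearMap)
      (TensorProduct.comm k H H t)) (𝓡.Δ_op h)
    rw [hcoact]
    simp only [𝓡.coact_apply, hact]
    have e : ∀ s r : H ⊗[k] H, (sw s fun h₁ h₂ => sw (sw r fun R₁ R₂ => R₂ ⊗ₜ[k] ρ R₁ m)
      fun a m₀ => (h₁ * a) ⊗ₜ[k] ρ h₂ m₀) = TensorProduct.map LinearMap.id
        (LinearMap.applyₗ m ∘ₗ ρ.toLinearMap) (TensorProduct.comm k H H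
          (TensorProduct.comm k H H s * r)) := by
      intro s r
      revert s
      refine tensor_ext (by fun_prop) (by fun_prop) fun p q => ?_
      revert r
      refine tensor_ext (by fun_prop) (by fun_prop) fun p' q' => ?_
      simp (disch := fun_prop) [sw_pure]
    have e' : ∀ s r : H ⊗[k] H, (sw s fun h₁ h₂ => sw (sw r fun R₁ R₂ => R₂ ⊗ₜ[k] ρ R₁ (ρ h₁ m))
      fun a m₀ => (a * h₂) ⊗ₜ[k] m₀) = TensorProduct.map LinearMap.id
        (LinearMap.applyₗ m ∘ₗ ρ.toLinearMap) (TensorProduct.comm k H H (r * s)) := by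
      intro s r
      revert s
      refine tensor_ext (by fun_prop) (by fun_prop) fun p q => ?_
      revert r
      refine tensor_ext (by fun_prop) (by fun_prop) fun p' q' => ?_
      simp (disch := fun_prop) [sw_pure]
    rw [e, e']
    exact this

/-- Expanded, the coaction on a tensor product is the right side of the formula for $(\Delta\otimes
id)(R)$, so it is again $R^2\otimes R^1\cdot(m\otimes n)$. Colinearity of the structure maps thereby
reduces to $H$-linearity. -/
theorem RMatrix.tensorCoact_eq (M : YDData k H V) (N : YDData k H W)
    (hM : ∀ a v, M.act a v = ρ a v) (hN : ∀ a v, N.act a v = σ a v)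
    (hM' : M.coact = 𝓡.coact M.act) (hN' : N.coact = 𝓡.coact N.act) (m : V) (n : W) :
    tensorCoact Q M N m n = sw 𝓡.R.val fun R₁ R₂ => R₂ ⊗ₜ[k] tact ρ σ (Q.Δ R₁) (m ⊗ₜ n) := by
  have e : ∀ (X x Y : H ⊗[k] (H ⊗[k] H)) (r r' : H ⊗[k] H),
      (sw3 X fun X₁ X₂ X₃ => sw3 x fun x₁ x₂ x₃ => sw3 Y fun Y₁ Y₂ Y₃ =>
        sw (sw r fun R₁ R₂ => R₂ ⊗ₜ[k] ρ R₁ (ρ (x₁ * Y₁) m)) fun a m₀ =>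
        sw (sw r' fun R₁ R₂ => R₂ ⊗ₜ[k] σ R₁ (σ Y₂ n)) fun b n₀ =>
          (X₁ * a * x₂ * b * Y₃) ⊗ₜ[k] (ρ X₂ m₀ ⊗ₜ[k] σ (X₃ * x₃) n₀)) =
      sw3 (sw3 X (fun X₁ X₂ X₃ => X₂ ⊗ₜ[k] (X₃ ⊗ₜ[k] X₁)) *
        sw r (fun R₁ R₂ => R₁ ⊗ₜ[k] ((1 : H) ⊗ₜ[k] R₂)) *
        sw3 x (fun x₁ x₂ x₃ => x₁ ⊗ₜ[k] (x₃ ⊗ₜ[k] x₂)) * ((1 : H) ⊗ₜ[k] r') * Y)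
        fun a b c => c ⊗ₜ[k] (ρ a m ⊗ₜ[k] σ b n) := by
    intro X x Y r r'
    revert X
    refine tensor_ext₃ (by fun_prop) (by fun_prop) fun a b c => ?_
    revert x
    refine tensor_ext₃ (by fun_prop) (by fun_prop) fun a' b' c' => ?_
    revert Y
    refine tensor_ext₃ (by fun_prop) (by fun_prop) fun a'' b'' c'' => ?_
    revert r
    refine tensor_ext (by fun_prop) (by fun_prop) fun p q => ?_
    revert r'
    refine tensor_ext (by fun_prop) (by fun_prop) fun p' q' => ?_
    simp (disch := fun_prop) [sw_pure, sw3_pure]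
  unfold tensorCoact
  rw [hM', hN']
  simp only [𝓡.coact_apply, hM, hN]
  rw [e, ← 𝓡.Δ_left]
  generalize 𝓡.R.val = r
  revert r
  refine tensor_ext (by fun_prop) (by fun_prop) fun p q => ?_
  simp (disch := fun_prop) only [sw_pure]
  generalize Q.Δ p = s
  revert s
  refine tensor_ext (by fun_prop) (by fun_prop) fun p' q' => ?_
  simp (disch := fun_prop) [sw3_pure]

end YetterDrinfeld

/-! ### From Hopf monoids in modules to braided Hopf algebras -/

namespace QMod

variable {k : Type u} {H : Type v} [Field k] [Ring H] [Algebra k H] {Q : QuasiHopfAlgebra k H}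
  {𝓡 : RMatrix Q}

theorem map_id_comp₃ {M N₁ N₂ N₃ N₄ : Type*} [AddCommGroup M] [Module k M] [AddCommGroup N₁]
    [Module k N₁] [AddCommGroup N₂] [Module k N₂] [AddCommGroup N₃] [Module k N₃] [AddCommGroup N₄]
    [Module k N₄] (f : N₃ →ₗ[k] N₄) (g : N₂ →ₗ[k] N₃) (h : N₁ →ₗ[k] N₂) (z : M ⊗[k] N₁) :
    TensorProduct.map LinearMap.id f (TensorProduct.map LinearMap.id g
      (TensorProduct.map LinearMap.id h z)) = TensorProduct.map LinearMap.id (f ∘ₗ g ∘ₗ h) z := by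
  revert z
  exact tensor_ext (by fun_prop) (by fun_prop) fun a b => by simp

section TensorMu

variable (V W V' W' : QMod 𝓡)

/-- The interchange written out leg by leg, with $\Phi^{\pm1}$ and $R$ generalized to independent
tensors. With $P$ the product in both factors it becomes the right side of the bialgebra axiom. -/
theorem tensorμ_aux {M : Type*} [AddCommGroup M] [Module k M]
    (P : (V.carrier ⊗[k] V'.carrier) ⊗[k] (W.carrier ⊗[k] W'.carrier) →ₗ[k] M)
    (x y X Y : H ⊗[k] (H ⊗[k] H)) (r : H ⊗[k] H)
    (v : V.carrier) (w : W.carrier) (v' : V'.carrier) (w' : W'.carrier) :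
    P ((TensorProduct.assoc k _ _ _).symm (tact₃ V V' (tensor W W') y
      (TensorProduct.map LinearMap.id (tact₃ V' W W' Y ∘ₗ (TensorProduct.assoc k _ _ _).toLinearMap ∘ₗ
        TensorProduct.map ((TensorProduct.comm k _ _).toLinearMap ∘ₗ tact W.act V'.act r)
          LinearMap.id ∘ₗ (TensorProduct.assoc k _ _ _).symm.toLinearMap ∘ₗ tact₃ W V' W' x)
        (tact₃ V W (tensor V' W') X (v ⊗ₜ (w ⊗ₜ (v' ⊗ₜ w'))))))) =
    sw3 y fun y₁ y₂ y₃ => sw3 X fun X₁ X₂ X₃ => sw3 Y fun Y₁ Y₂ Y₃ => sw3 x fun x₁ x₂ x₃ =>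
    sw (sw r fun R₁ R₂ => R₂ ⊗ₜ[k] W.act R₁ (W.act (x₁ * X₂) w)) fun a c₀ =>
    sw (Q.Δ X₃) fun X₃₁ X₃₂ => sw (Q.Δ y₃) fun y₃₁ y₃₂ =>
      P ((V.act (y₁ * X₁) v ⊗ₜ[k] V'.act (y₂ * Y₁ * a * x₂ * X₃₁) v') ⊗ₜ[k]
        (W.act (y₃₁ * Y₂) c₀ ⊗ₜ[k] W'.act (y₃₂ * Y₃ * x₃ * X₃₂) w')) := by
  revert x
  refine tensor_ext₃ (by fun_prop) (by fun_prop) fun x₁ x₂ x₃ => ?_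
  revert y
  refine tensor_ext₃ (by fun_prop) (by fun_prop) fun y₁ y₂ y₃ => ?_
  revert X
  refine tensor_ext₃ (by fun_prop) (by fun_prop) fun X₁ X₂ X₃ => ?_
  revert Y
  refine tensor_ext₃ (by fun_prop) (by fun_prop) fun Y₁ Y₂ Y₃ => ?_
  revert r
  refine tensor_ext (by fun_prop) (by fun_prop) fun r₁ r₂ => ?_
  simp (disch := fun_prop) only [sw3_pure, sw_pure, tact_tmul, tensorAct_apply]
  generalize Q.Δ X₃ = s
  revert s
  refine tensor_ext (by fun_prop) (by fun_prop) fun p q => ?_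
  generalize Q.Δ y₃ = s
  revert s
  refine tensor_ext (by fun_prop) (by fun_prop) fun p' q' => ?_
  simp (disch := fun_prop) [sw_pure]

variable [h𝓡 : Fact 𝓡.IsTriangular]

theorem tensorμ_lin (z : (V.carrier ⊗[k] W.carrier) ⊗[k] (V'.carrier ⊗[k] W'.carrier)) :
    (tensorμ V W V' W').lin z =
      (TensorProduct.assoc k _ _ _).symm (tact₃ V V' (tensor W W') Q.Φ⁻¹.val
      (TensorProduct.map LinearMap.id (tact₃ V' W W' Q.Φ.val ∘ₗ (TensorProduct.assoc k _ _ _).toLinearMap ∘ₗ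
        TensorProduct.map ((TensorProduct.comm k _ _).toLinearMap ∘ₗ tact W.act V'.act 𝓡.R.val)
          LinearMap.id ∘ₗ (TensorProduct.assoc k _ _ _).symm.toLinearMap ∘ₗ tact₃ W V' W' Q.Φ⁻¹.val)
        (tact₃ V W (tensor V' W') Q.Φ.val (TensorProduct.assoc k _ _ _ z)))) := by
  exact congrArg (fun z => (TensorProduct.assoc k _ _ _).symm (tact₃ V V' (tensor W W') Q.Φ⁻¹.val z))
    (map_id_comp₃ _ _ _ _)

end TensorMu

section BraidedHopf

variable (X : QMod 𝓡) (B : BraidedHopfData k H X.carrier) [h𝓡 : Fact 𝓡.IsTriangular]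
  {m : X ⊗ X ⟶ X} {η : 𝟙_ (QMod 𝓡) ⟶ X} {Δ : X ⟶ X ⊗ X} {ε : X ⟶ 𝟙_ (QMod 𝓡)} {S : X ⟶ X}

/-- A Hopf algebra in the category of modules is a braided Hopf algebra. -/
theorem isBraidedHopfAlgebra (h : IsHopf m η Δ ε S) (hact : ∀ a x, B.act a x = X.act a x)
    (hcoact : B.coact = 𝓡.coact B.act) (hm : ∀ a b, m.lin (a ⊗ₜ b) = B.mul a b)
    (hη : η.lin (1 : ULift.{v} k) = B.one) (hΔ : ∀ b, Δ.lin b = B.comul b)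
    (hε : ∀ b, ε.lin b = ULift.up (B.counit b)) (hS : ∀ b, S.lin b = B.antipode b) :
    IsBraidedHopfAlgebra Q B := by
  obtain ⟨L, hL⟩ : ∃ L : X.carrier ⊗[k] X.carrier →ₗ[k] X.carrier, L = TensorProduct.lift B.mul :=
    ⟨_, rfl⟩
  have hLm : ∀ a b, L (a ⊗ₜ b) = B.mul a b := fun a b => by rw [hL, TensorProduct.lift.tmul]
  have hmL : ∀ z, m.lin z = L z := by
    refine tensor_ext (Hom.lin _).isLinear (by fun_prop) fun a b => ?_
    rw [hm, hLm]
  have hmul : ∀ a b, m.lin (a ⊗ₜ b) = L (a ⊗ₜ b) := fun a b => hmL _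
  have tc : ∀ a b, tensorCoact Q B.toYDData B.toYDData a b = _ :=
    𝓡.tensorCoact_eq X.act X.act _ _ hact hact hcoact hcoact
  have co : ∀ b, B.coact b = sw 𝓡.R.val fun R₁ R₂ => R₂ ⊗ₜ[k] X.act R₁ b := fun b => by
    rw [hcoact, 𝓡.coact_apply]; simp only [hact]
  have tens : ∀ (t : H ⊗[k] H) (y : X.carrier ⊗[k] X.carrier),
      (sw t fun h₁ h₂ => TensorProduct.map (B.act h₁) (B.act h₂) y) = tact X.act X.act t y := by
    have e : ∀ a, B.act a = X.act a := fun a => LinearMap.ext (hact a)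
    simp only [e]
    intro t y
    exact sw_eq (E := fun t => tact X.act X.act t y) (by fun_prop) (fun a b => by rw [tact_tmul]) t
  have tens' : ∀ (t : H ⊗[k] H) (x y : X.carrier),
      (sw t fun h₁ h₂ => B.mul (B.act h₁ x) (B.act h₂ y)) = L (tact X.act X.act t (x ⊗ₜ y)) := by
    intro t x y
    exact sw_eq (E := fun t => L (tact X.act X.act t (x ⊗ₜ y))) (by fun_prop)
      (fun a b => by simp [hact, hLm]) t
  have act_lin : ∀ {Y Z : QMod 𝓡} (f : Y ⟶ Z) (a : H) (y : Y.carrier),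
      Z.act a (f.lin y) = f.lin (Y.act a y) := fun f a y => (f.comm a y).symm
  have hηε : ∀ b, (ε ≫ η).lin b = B.counit b • B.one := fun b => by
    rw [comp_lin, hε, ← hη, ← map_smul]
    exact congrArg η.lin (ULift.ext _ _ (mul_one _).symm)
  exact {
    yetterDrinfeld := 𝓡.isYetterDrinfeld X.act _ hact hcoact
    mul_assoc := fun a b c => by
      have e : ∀ t : H ⊗[k] (H ⊗[k] H), (sw3 t fun X₁ X₂ X₃ =>
          B.mul (B.act X₁ a) (B.mul (B.act X₂ b) (B.act X₃ c))) =
          L (TensorProduct.map LinearMap.id L (tact₃ X X X t (a ⊗ₜ (b ⊗ₜ c)))) :=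
        sw3_eq (by fun_prop) fun p q r => by simp [hact, hLm]
      rw [e, ← hLm, ← hLm, ← hmul, ← hmul, ← hmL]
      rw [show L = m.lin from LinearMap.ext fun z => (hmL z).symm]
      exact congrArg (fun f => f.lin ((a ⊗ₜ b) ⊗ₜ c)) h.mul_assoc
    one_mul := fun a => by
      rw [← hm, ← hη]
      exact (congrArg (fun f => f.lin ((1 : ULift.{v} k) ⊗ₜ a)) h.one_mul).trans (one_smul k a)
    mul_one := fun a => by
      rw [← hm, ← hη]
      exact (congrArg (fun f => f.lin (a ⊗ₜ (1 : ULift.{v} k))) h.mul_one).trans (one_smul k a)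
    act_mul := fun a x y => by
      rw [hact, ← hm, act_lin, tens', ← hmL]
      rfl
    act_one := fun a => by
      have := η.comm a (1 : ULift.{v} k)
      rw [hη] at this
      rw [hact, ← this]
      change η.lin (Q.ε a • (1 : ULift.{v} k)) = _
      rw [map_smul, hη]
    coact_mul := fun a b => by
      rw [tc, co, ← hL, sw_map (k := k) (E := fun t => TensorProduct.map LinearMap.id L t)
        (by fun_prop)]
      simp only [TensorProduct.map_tmul, ← hm, act_lin, ← hmL]
      rfl
    coact_one := by
      have e : ∀ a, X.act a B.one = Q.ε a • B.one := fun a => by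
        rw [← hη, act_lin]
        exact η.lin.map_smul _ _
      rw [co]
      simp only [e, TensorProduct.tmul_smul, TensorProduct.smul_tmul']
      rw [← sw_map (k := k) (E := fun t => t ⊗ₜ[k] B.one) (by fun_prop), 𝓡.ε_left]
    comul_coassoc := fun b => by
      have e : ∀ (t : H ⊗[k] (H ⊗[k] H)) (y : X.carrier ⊗[k] X.carrier),
          (sw3 t fun X₁ X₂ X₃ => sw y fun b₁ b₂ => sw (B.comul b₁) fun b₁₁ b₁₂ =>
            B.act X₁ b₁₁ ⊗ₜ[k] (B.act X₂ b₁₂ ⊗ₜ[k] B.act X₃ b₂)) =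
          tact₃ X X X t (TensorProduct.assoc k _ _ _ (TensorProduct.map B.comul LinearMap.id y)) := by
        intro t y
        revert t
        refine tensor_ext₃ (by fun_prop) (by fun_prop) fun p q r => ?_
        revert y
        refine tensor_ext (by fun_prop) (by fun_prop) fun x y => ?_
        simp (disch := fun_prop) only [sw_pure, sw3_pure, TensorProduct.map_tmul]
        generalize B.comul x = z
        revert z
        refine tensor_ext (by fun_prop) (by fun_prop) fun x y => ?_
        simp (disch := fun_prop) [sw_pure, hact]
      have e' : ∀ y : X.carrier ⊗[k] X.carrier, (sw y fun b₁ b₂ => b₁ ⊗ₜ[k] B.comul b₂) =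
          TensorProduct.map LinearMap.id B.comul y :=
        sw_eq (E := fun y => TensorProduct.map LinearMap.id B.comul y) (by fun_prop)
          fun a b => by simp
      rw [e, e', show B.comul = Δ.lin from LinearMap.ext fun z => (hΔ z).symm]
      exact congrArg (fun f => f.lin b) h.comul_assoc
    counit_left := fun b => by
      have e := sw_eq (E := fun y => (λ_ X).hom.lin ((ε ▷ X).lin y))
        (isLinearMap_comp (Hom.lin _).isLinear (Hom.lin _).isLinear)
        (F := fun b₁ b₂ => B.counit b₁ • b₂) (fun x y => by
          rw [whiskerRight_lin, TensorProduct.map_tmul, hε]; rfl) (B.comul b)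
      rw [e, ← hΔ]
      exact congrArg (fun f => f.lin b) h.counit_left
    counit_right := fun b => by
      have e := sw_eq (E := fun y => (ρ_ X).hom.lin ((X ◁ ε).lin y))
        (isLinearMap_comp (Hom.lin _).isLinear (Hom.lin _).isLinear)
        (F := fun b₁ b₂ => B.counit b₂ • b₁) (fun x y => by
          rw [whiskerLeft_lin, TensorProduct.map_tmul, hε]; rfl) (B.comul b)
      rw [e, ← hΔ]
      exact congrArg (fun f => f.lin b) h.counit_right
    comul_act := fun a b => by
      rw [tens, hact, ← hΔ, ← hΔ]
      exact Δ.comm a b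
    counit_act := fun a b => by
      have := congrArg ULift.down (ε.comm a b)
      rw [hε, hε, ← hact] at this
      exact this
    comul_coact := fun b => by
      simp only [tc]
      rw [co, sw_map (k := k) (E := fun t => TensorProduct.map LinearMap.id B.comul t)
        (by fun_prop), sw_eq (E := fun y => sw 𝓡.R.val fun R₁ R₂ =>
          R₂ ⊗ₜ[k] tact X.act X.act (Q.Δ R₁) y) (by fun_prop) (fun _ _ => rfl)]
      simp only [TensorProduct.map_tmul, ← hΔ, Δ.comm]
      rfl
    counit_coact := fun b => by
      have e : ∀ a, B.counit (X.act a b) = Q.ε a * B.counit b := fun a => by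
        have := congrArg ULift.down (ε.comm a b)
        rw [hε, hε] at this
        exact this
      rw [co, sw_eq (E := fun t => TensorProduct.lid k H (TensorProduct.comm k _ _
        (TensorProduct.map LinearMap.id B.counit t))) (by fun_prop) (fun _ _ => by simp),
        sw_map (k := k) (E := fun t => TensorProduct.lid k H (TensorProduct.comm k _ _
        (TensorProduct.map LinearMap.id B.counit t))) (by fun_prop)]
      simp only [TensorProduct.map_tmul, e, TensorProduct.comm_tmul, TensorProduct.lid_tmul,
        LinearMap.id_apply, mul_comm _ (B.counit b), mul_smul]
      rw [sw_smul_right, 𝓡.ε_left]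
    comul_mul := fun a b => by
      have key : ∀ z z' : X.carrier ⊗[k] X.carrier,
          TensorProduct.map L L ((tensorμ X X X X).lin (z ⊗ₜ z')) =
          sw3 Q.Φ⁻¹.val fun y₁ y₂ y₃ => sw3 Q.Φ.val fun X₁ X₂ X₃ => sw3 Q.Φ.val fun Y₁ Y₂ Y₃ =>
          sw3 Q.Φ⁻¹.val fun x₁ x₂ x₃ => sw z fun b₁ b₂ => sw z' fun b'₁ b'₂ =>
          sw (B.coact (B.act (x₁ * X₂) b₂)) fun a c₀ => sw (Q.Δ X₃) fun X₃₁ X₃₂ =>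
          sw (Q.Δ y₃) fun y₃₁ y₃₂ =>
            B.mul (B.act (y₁ * X₁) b₁) (B.act (y₂ * Y₁ * a * x₂ * X₃₁) b'₁) ⊗ₜ[k]
            B.mul (B.act (y₃₁ * Y₂) c₀) (B.act (y₃₂ * Y₃ * x₃ * X₃₂) b'₂) := by
        intro z z'
        revert z
        refine tensor_ext (isLinearMap_comp (TensorProduct.map L L).isLinear (isLinearMap_comp
          (Hom.lin _).isLinear (isLinearMap_tmul_left isLinearMap_id _))) (by fun_prop)
          fun v w => ?_
        revert z'
        refine tensor_ext (isLinearMap_comp (TensorProduct.map L L).isLinear (isLinearMap_comp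
          (Hom.lin _).isLinear (isLinearMap_tmul_right isLinearMap_id _))) (by fun_prop)
          fun v' w' => ?_
        rw [tensorμ_lin]
        refine (tensorμ_aux X X X X (TensorProduct.map L L) Q.Φ⁻¹.val Q.Φ⁻¹.val Q.Φ.val Q.Φ.val 𝓡.R.val
          v w v' w').trans ?_
        simp (disch := fun_prop) only [sw_pure]
        simp only [co, hact, TensorProduct.map_tmul, hLm]
      rw [← key, ← hΔ, ← hΔ, ← hΔ, ← hm]
      rw [show L = m.lin from LinearMap.ext fun z => (hmL z).symm]
      exact congrArg (fun f => f.lin (a ⊗ₜ b)) h.comul_mul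
    comul_one := by
      rw [← hη, ← hΔ]
      exact congrArg (fun f => f.lin (1 : ULift.{v} k)) h.comul_one
    counit_mul := fun a b => by
      have := congrArg (fun f => ULift.down (f.lin (a ⊗ₜ b))) h.counit_mul
      simp only [comp_lin] at this
      rw [hm, hε, tensorHom_lin, TensorProduct.map_tmul, hε, hε] at this
      exact this
    counit_one := by
      have := congrArg (fun f => ULift.down (f.lin (1 : ULift.{v} k))) h.counit_one
      rw [comp_lin, hη, hε] at this
      exact this
    antipode_act := fun a b => by
      rw [hact, hact, ← hS, ← hS, act_lin]
    antipode_coact := fun b => by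
      rw [co, co, sw_map (k := k) (E := fun t => TensorProduct.map LinearMap.id B.antipode t)
        (by fun_prop)]
      simp only [TensorProduct.map_tmul, ← hS, act_lin]
      rfl
    antipode_left := fun b => by
      rw [sw_eq (E := fun y => L (TensorProduct.map B.antipode LinearMap.id y)) (by fun_prop)
        (fun _ _ => by simp [hLm]), ← hmL, ← hΔ, ← hηε]
      rw [show B.antipode = S.lin from LinearMap.ext fun z => (hS z).symm]
      exact congrArg (fun f => f.lin b) h.antipode_left
    antipode_right := fun b => by
      rw [sw_eq (E := fun y => L (TensorProduct.map LinearMap.id B.antipode y)) (by fun_prop)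
        (fun _ _ => by simp [hLm]), ← hmL, ← hΔ, ← hηε]
      rw [show B.antipode = S.lin from LinearMap.ext fun z => (hS z).symm]
      exact congrArg (fun f => f.lin b) h.antipode_right }

end BraidedHopf

end QMod

/-! ### The element $u$ and the double dual -/

section Element

variable {k H : Type*} [Field k] [Ring H] [Algebra k H] {Q : QuasiHopfAlgebra k H}

theorem RMatrix.u_eq (𝓡 : RMatrix Q) : 𝓡.u = sw3 Q.Φ⁻¹.val fun x₁ x₂ x₃ =>
    sw 𝓡.R.val fun R₁ R₂ => Q.S (R₂ * x₂ * Q.β * Q.S x₃) * Q.α * R₁ * x₁ := by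
  unfold RMatrix.u QuasiHopfAlgebra.pR
  generalize Q.Φ⁻¹.val = t
  generalize 𝓡.R.val = r
  revert r
  refine tensor_ext (by fun_prop) (by fun_prop) fun a b => ?_
  revert t
  refine tensor_ext₃ (by fun_prop) (by fun_prop) fun p q r => ?_
  simp (disch := fun_prop) [sw_pure, sw3_pure, mul_assoc]

/-- The element `X¹R²x²β S(S(X²R¹x¹)αX³x³)`, the inverse of `u`. -/
noncomputable def RMatrix.uInv (𝓡 : RMatrix Q) : H :=
  sw3 Q.Φ.val fun X₁ X₂ X₃ => sw 𝓡.R.val fun R₁ R₂ => sw3 Q.Φ⁻¹.val fun x₁ x₂ x₃ =>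
    X₁ * R₂ * x₂ * Q.β * Q.S (Q.S (X₂ * R₁ * x₁) * Q.α * X₃ * x₃)

end Element

namespace QMod

variable {k : Type u} {H : Type v} [Field k] [Ring H] [Algebra k H] {Q : QuasiHopfAlgebra k H}
  {𝓡 : RMatrix Q}

section DoubleDual

variable (V D DD : QMod 𝓡) [DualPair V D] [DualPair D DD]

theorem toDoubleDual_aux (t : H ⊗[k] (H ⊗[k] H)) (r : H ⊗[k] H) (z : D.carrier ⊗[k] DD.carrier)
    (v : V.carrier) (φ : D.carrier) :
    pairing D DD (TensorProduct.lid k _ (TensorProduct.map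
      (evLin V D ∘ₗ (TensorProduct.comm k _ _).toLinearMap ∘ₗ tact V.act D.act r) LinearMap.id
      ((TensorProduct.assoc k _ _ _).symm (tact₃ V D DD t (v ⊗ₜ z))))) φ =
    sw3 t fun x₁ x₂ x₃ => sw r fun R₁ R₂ =>
      pairing V D ((D.act (R₂ * x₂) * endo D DD z * D.act (Q.S x₃)) φ)
        (V.act (Q.α * R₁ * x₁) v) := by
  revert t
  refine tensor_ext₃ (by fun_prop) (by fun_prop) fun a b c => ?_
  revert r
  refine tensor_ext (by fun_prop) (by fun_prop) fun p q => ?_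
  simp (disch := fun_prop) only [sw_pure, sw3_pure]
  revert z
  refine tensor_ext (by fun_prop) (by fun_prop) fun ψ ξ => ?_
  simp [mul_comm]

theorem ofDoubleDual_aux (t t' : H ⊗[k] (H ⊗[k] H)) (r : H ⊗[k] H)
    (z : V.carrier ⊗[k] D.carrier) (ξ : DD.carrier) (v : V.carrier)
    (hξ : ∀ φ, pairing D DD ξ φ = pairing V D φ v) :
    TensorProduct.rid k _ (TensorProduct.map LinearMap.id (evLin D DD)
      (tact₃ V DD D t' (TensorProduct.assoc k _ _ _ (TensorProduct.map
        ((TensorProduct.comm k _ _).toLinearMap ∘ₗ tact DD.act V.act r) LinearMap.id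
          ((TensorProduct.assoc k _ _ _).symm (tact₃ DD V D t (ξ ⊗ₜ z))))))) =
    sw3 t' fun X₁ X₂ X₃ => sw r fun R₁ R₂ => sw3 t fun x₁ x₂ x₃ =>
      (V.act (X₁ * R₂ * x₂) * endo V D z *
        V.act (Q.S (Q.S (X₂ * R₁ * x₁) * Q.α * X₃ * x₃))) v := by
  revert t
  refine tensor_ext₃ (by fun_prop) (by fun_prop) fun a b c => ?_
  revert t'
  refine tensor_ext₃ (by fun_prop) (by fun_prop) fun a' b' c' => ?_
  revert r
  refine tensor_ext (by fun_prop) (by fun_prop) fun p q => ?_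
  simp (disch := fun_prop) only [sw_pure, sw3_pure]
  revert z
  refine tensor_ext (by fun_prop) (by fun_prop) fun v φ => ?_
  simp [hξ, Q.S_mul]

variable [h𝓡 : Fact 𝓡.IsTriangular]

/-- In the canonical map $V\to V^{**}$ the inverse associator and the coevaluation give $p$, the
braiding gives $R$ and the evaluation gives $\alpha$; together they form $u$. -/
theorem toDoubleDual_lin (v : V.carrier) (φ : D.carrier) :
    pairing D DD ((toDoubleDual V D DD).lin v) φ = pairing V D φ (V.act 𝓡.u v) := by
  have := toDoubleDual_aux V D DD Q.Φ⁻¹.val 𝓡.R.val (coevElt D DD) v φ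
  simp only [coevElt_eq, LinearEquiv.apply_symm_apply, ← map_mul, pairing_act] at this
  refine Eq.trans ?_ (this.trans ?_)
  · have e : ∀ z : (V.carrier ⊗[k] D.carrier) ⊗[k] DD.carrier,
        (λ_ DD).hom.lin ((((β_ V D).hom ≫ ε_ V D) ▷ DD).lin z) =
        TensorProduct.lid k _ (TensorProduct.map (evLin V D ∘ₗ
          (TensorProduct.comm k _ _).toLinearMap ∘ₗ tact V.act D.act 𝓡.R.val) LinearMap.id z) := by
      intro z
      rw [comp_whiskerRight, comp_lin]
      refine (whiskerRight_evHom V D DD _).trans ?_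
      rw [whiskerRight_lin]
      refine congrArg _ ?_
      revert z
      exact tensor_ext (isLinearMap_comp (LinearMap.isLinear _) (LinearMap.isLinear
        (TensorProduct.map (β_ V D).hom.lin LinearMap.id))) (by fun_prop) fun z x => rfl
    rw [← coevElt_eq]
    refine congrArg (fun x => pairing D DD x φ) ?_
    exact e _
  · rw [𝓡.u_eq]
    have e := sw3_map (k := k) (E := fun h => pairing V D φ (V.act h v)) (by fun_prop) Q.Φ⁻¹.val
      fun x₁ x₂ x₃ => sw 𝓡.R.val fun R₁ R₂ => Q.S (R₂ * x₂ * Q.β * Q.S x₃) * Q.α * R₁ * x₁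
    refine Eq.trans ?_ e.symm
    simp only [sw_map (k := k) (E := fun h => pairing V D φ (V.act h v)) (by fun_prop)]
    simp only [← Module.End.mul_apply, ← map_mul, mul_assoc]

theorem ofDoubleDual_lin (ξ : DD.carrier) (v : V.carrier)
    (hξ : ∀ φ, pairing D DD ξ φ = pairing V D φ v) :
    (ofDoubleDual V D DD).lin ξ = V.act 𝓡.uInv v := by
  have := ofDoubleDual_aux V D DD Q.Φ⁻¹.val Q.Φ.val 𝓡.R.val (coevElt V D) ξ v hξ
  simp only [coevElt_eq, LinearEquiv.apply_symm_apply, ← map_mul] at this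
  refine Eq.trans ?_ (this.trans ?_)
  · rw [← coevElt_eq]
    exact whiskerLeft_evHom D DD V _
  · have e := sw3_map (k := k) (E := fun h => V.act h v) (by fun_prop) Q.Φ.val
      fun X₁ X₂ X₃ => sw 𝓡.R.val fun R₁ R₂ => sw3 Q.Φ⁻¹.val fun x₁ x₂ x₃ =>
        X₁ * R₂ * x₂ * Q.β * Q.S (Q.S (X₂ * R₁ * x₁) * Q.α * X₃ * x₃)
    refine Eq.trans ?_ e.symm
    simp only [sw_map (k := k) (E := fun h => V.act h v) (by fun_prop),
      sw3_map (k := k) (E := fun h => V.act h v) (by fun_prop)]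

theorem act_uInv_mul_u (D DD : QMod 𝓡) [DualPair V D] [DualPair D DD] (v : V.carrier) :
    V.act (𝓡.uInv * 𝓡.u) v = v := by
  rw [map_mul, Module.End.mul_apply, ← ofDoubleDual_lin V D DD _ _ (toDoubleDual_lin V D DD v),
    ← comp_lin, toDoubleDual_ofDoubleDual, id_lin]

/-- On $V^{**}$ the element $h$ acts through $S^2(h)$, so this is the linearity of the canonical
map. -/
theorem act_u_mul (D DD : QMod 𝓡) [DualPair V D] [DualPair D DD] (h : H) (v : V.carrier) :
    V.act (𝓡.u * h) v = V.act (Q.S (Q.S h) * 𝓡.u) v := by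
  refine eq_of_pairing V D fun φ => ?_
  have := congrArg (fun ξ => pairing D DD ξ φ) ((toDoubleDual V D DD).comm h v)
  simp only [toDoubleDual_lin, pairing_act] at this
  rw [map_mul, map_mul, Module.End.mul_apply, Module.End.mul_apply, this]

end DoubleDual

end QMod

section

variable {k : Type u} {H : Type v} [Field k] [Ring H] [Algebra k H] {Q : QuasiHopfAlgebra k H}
  [FiniteDimensional k H] (𝓡 : RMatrix Q) [h𝓡 : Fact 𝓡.IsTriangular]

open QMod

theorem RMatrix.uInv_mul_u : 𝓡.uInv * 𝓡.u = 1 :=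
  reg_act_injective (𝓡 := 𝓡) <| LinearMap.ext fun v => by
    rw [act_uInv_mul_u (reg 𝓡) (dual (reg 𝓡)) (dual (dual (reg 𝓡))), map_one]; rfl

theorem RMatrix.u_mul_uInv : 𝓡.u * 𝓡.uInv = 1 :=
  mul_eq_one_symm_of_finite (k := k) 𝓡.uInv_mul_u

/-- The square of the antipode is conjugation by `u`. -/
theorem RMatrix.u_mul (h : H) : 𝓡.u * h = Q.S (Q.S h) * 𝓡.u :=
  reg_act_injective (𝓡 := 𝓡) <| LinearMap.ext fun v =>
    act_u_mul (reg 𝓡) (dual (reg 𝓡)) (dual (dual (reg 𝓡))) h v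

end

/-! ### Monoidality of the double dual and the coproduct of $u$ -/

namespace QMod

variable {k : Type u} {H : Type v} [Field k] [Ring H] [Algebra k H] {Q : QuasiHopfAlgebra k H}
  {𝓡 : RMatrix Q}

section CrossForm

variable (V W D E : QMod 𝓡) [DualPair V D] [DualPair W E]

/-- The pairing of `V ⊗ W` with `V* ⊗ W*`, with `(φ ⊗ ψ)(v ⊗ w) = φ(v) ψ(w)`. -/
noncomputable def crossForm :
    D.carrier ⊗[k] E.carrier →ₗ[k] V.carrier ⊗[k] W.carrier →ₗ[k] k :=
  LinearMap.compl₂ (nestedForm W V E D) (TensorProduct.comm k _ _).toLinearMap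

@[simp]
theorem crossForm_tmul (φ : D.carrier) (ψ : E.carrier) (v : V.carrier) (w : W.carrier) :
    crossForm V W D E (φ ⊗ₜ ψ) (v ⊗ₜ w) = pairing V D φ v * pairing W E ψ w := by
  simp [crossForm, mul_comm]

theorem crossForm_ext {y z : V.carrier ⊗[k] W.carrier}
    (h : ∀ θ, crossForm V W D E θ y = crossForm V W D E θ z) : y = z := by
  apply (TensorProduct.comm k V.carrier W.carrier).injective
  rw [← sub_eq_zero, ← Module.forall_dual_apply_eq_zero_iff k]
  intro l
  obtain ⟨θ, rfl⟩ := (nestedPairing W V E D).surjective l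
  rw [map_sub, sub_eq_zero]
  exact h θ

theorem crossForm_tact (t : H ⊗[k] H) (θ : D.carrier ⊗[k] E.carrier)
    (y : V.carrier ⊗[k] W.carrier) : crossForm V W D E (tact D.act E.act t θ) y =
      crossForm V W D E θ
        (tact V.act W.act (TensorProduct.map Q.S.toLinearMap Q.S.toLinearMap t) y) := by
  revert t
  refine tensor_ext (by fun_prop) (by fun_prop) fun a b => ?_
  revert θ
  refine tensor_ext (by fun_prop) (by fun_prop) fun ψ φ => ?_
  revert y
  refine tensor_ext (by fun_prop) (by fun_prop) fun v w => ?_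
  simp

variable [FiniteDimensional k H] [h𝓡 : Fact 𝓡.IsTriangular]

/-- The comparison of the tensor product of duals with the dual of the tensor product. -/
noncomputable def crossDual (T : QMod 𝓡) [DualPair (V ⊗ W) T] : D ⊗ E ⟶ T where
  lin := (DualPair.pair : T.carrier ≃ₗ[k] Module.Dual k (V ⊗ W).carrier).symm.toLinearMap ∘ₗ
    LinearMap.compl₂ (crossForm V W D E) (tact V.act W.act 𝓡.twist)
  comm a θ := by
    refine pairing_ext (V ⊗ W) T fun y => ?_
    rw [pairing_act]
    simp only [pairing, LinearMap.comp_apply, LinearEquiv.coe_coe, LinearEquiv.apply_symm_apply,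
      LinearMap.compl₂_apply]
    refine (crossForm_tact V W D E (Q.Δ a) θ _).trans ?_
    rw [← Module.End.mul_apply, ← map_mul, ← 𝓡.twist_mul_Δ_S, map_mul]
    rfl

theorem pairing_crossDual (T : QMod 𝓡) [DualPair (V ⊗ W) T] (θ : D.carrier ⊗[k] E.carrier)
    (y : V.carrier ⊗[k] W.carrier) : pairing (V ⊗ W) T ((crossDual V W D E T).lin θ) y =
      crossForm V W D E θ (tact V.act W.act 𝓡.twist y) :=
  congrArg (fun l : Module.Dual k (V ⊗ W).carrier => l y) (LinearEquiv.apply_symm_apply _ _)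

/-- The identity $t\,\Delta(\alpha)=\gamma_{21}R$ for the twist $t$ is exactly the compatibility
with evaluations. -/
theorem crossDual_evaluation (T : QMod 𝓡) [DualPair (V ⊗ W) T] :
    crossDual V W D E T ▷ (V ⊗ W) ≫ ε_ (V ⊗ W) T = pairTensor (ε_ V D) (ε_ W E) :=
  tensor_hom_ext fun θ y => by
    rw [pairTensor_lin, ← 𝓡.twist_mul_Δ_α, comp_lin, whiskerRight_lin, TensorProduct.map_tmul]
    refine (evaluation_lin _ _ _ _).trans (congrArg ULift.up ?_)
    refine (pairing_crossDual V W D E T θ _).trans ?_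
    rw [map_mul]
    rfl

/-- The transpose of a morphism. -/
noncomputable def transposeHom {X Y : QMod 𝓡} (f : X ⟶ Y) (X' Y' : QMod 𝓡) [DualPair X X']
    [DualPair Y Y'] : Y' ⟶ X' where
  lin := (DualPair.pair : X'.carrier ≃ₗ[k] Module.Dual k X.carrier).symm.toLinearMap ∘ₗ
    Module.Dual.transpose f.lin ∘ₗ pairing Y Y'
  comm a ξ := by
    refine pairing_ext X X' fun x => ?_
    rw [pairing_act]
    simp only [pairing, LinearMap.comp_apply, LinearEquiv.coe_coe, LinearEquiv.apply_symm_apply]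
    refine (DualPair.pair_act a ξ (f.lin x)).trans ?_
    rw [← f.comm]
    rfl

omit [FiniteDimensional k H] h𝓡 in
theorem pairing_transposeHom {X Y : QMod 𝓡} (f : X ⟶ Y) (X' Y' : QMod 𝓡) [DualPair X X']
    [DualPair Y Y'] (ξ : Y'.carrier) (x : X.carrier) :
    pairing X X' ((transposeHom f X' Y').lin ξ) x = pairing Y Y' ξ (f.lin x) :=
  congrArg (fun l : Module.Dual k X.carrier => l x) (LinearEquiv.apply_symm_apply _ _)

omit [FiniteDimensional k H] h𝓡 in
theorem transposeHom_evaluation {X Y : QMod 𝓡} (f : X ⟶ Y) (X' Y' : QMod 𝓡) [DualPair X X']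
    [DualPair Y Y'] : transposeHom f X' Y' ▷ X ≫ ε_ X X' = Y' ◁ f ≫ ε_ Y Y' :=
  tensor_hom_ext fun ξ x => by
    rw [comp_lin, comp_lin, whiskerRight_lin, whiskerLeft_lin, TensorProduct.map_tmul,
      TensorProduct.map_tmul]
    refine (evaluation_lin _ _ _ _).trans (Eq.trans (congrArg ULift.up ?_)
      (evaluation_lin _ _ _ _).symm)
    rw [pairing_transposeHom, f.comm]
    rfl

theorem crossForm_double (DD EE : QMod 𝓡) [DualPair D DD] [DualPair E EE]
    (y : V.carrier ⊗[k] W.carrier) (θ : D.carrier ⊗[k] E.carrier) :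
    crossForm D E DD EE ((toDoubleDual V D DD ⊗ₘ toDoubleDual W E EE).lin y) θ =
      crossForm V W D E θ (tact V.act W.act (𝓡.u ⊗ₜ 𝓡.u) y) := by
  rw [tensorHom_lin]
  revert y
  refine tensor_ext (isLinearMap_apply (isLinearMap_comp (LinearMap.isLinear _)
    (LinearMap.isLinear _)) _) (by fun_prop) fun v w => ?_
  revert θ
  refine tensor_ext (LinearMap.isLinear _) (by fun_prop) fun φ ψ => ?_
  rw [TensorProduct.map_tmul, crossForm_tmul, toDoubleDual_lin, toDoubleDual_lin]
  simp

/-- Monoidality of $V\to V^{**}$ in coordinates: the twist enters once through $V^*\otimes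
W^*\to(V\otimes W)^*$ and once, transported by $S\otimes S$, through the same map for the dual
modules. -/
theorem tact_twist_mul_Δ_u (y : V.carrier ⊗[k] W.carrier) :
    tact V.act W.act (𝓡.twist * Q.Δ 𝓡.u) y = tact V.act W.act
      (TensorProduct.map Q.S.toLinearMap Q.S.toLinearMap 𝓡.twist * (𝓡.u ⊗ₜ 𝓡.u)) y := by
  refine crossForm_ext V W (dual V) (dual W) fun θ => ?_
  have := toDoubleDual_tensor V (dual V) (dual (dual V)) W (dual W) (dual (dual W)) (dual (V ⊗ W))
    (dual (dual (V ⊗ W))) (dual (dual V ⊗ dual W)) _ _ _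
    (crossDual_evaluation V W (dual V) (dual W) (dual (V ⊗ W)))
    (crossDual_evaluation (dual V) (dual W) (dual (dual V)) (dual (dual W)) (dual (dual V ⊗ dual W)))
    (transposeHom_evaluation (crossDual V W (dual V) (dual W) (dual (V ⊗ W)))
      (dual (dual V ⊗ dual W)) (dual (dual (V ⊗ W))))
  have := congrArg (fun f => pairing (dual V ⊗ dual W) (dual (dual V ⊗ dual W)) (f.lin y) θ) this
  simp only [comp_lin] at this
  rw [pairing_transposeHom, toDoubleDual_lin, pairing_crossDual] at this
  rw [map_mul, map_mul]
  refine Eq.trans ?_ (this.symm.trans ?_)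
  · exact (pairing_crossDual V W (dual V) (dual W) (dual (V ⊗ W)) θ _).symm
  · rw [crossForm_double, crossForm_tact]
    rfl

end CrossForm
end QMod

section

variable {k : Type u} {H : Type v} [Field k] [Ring H] [Algebra k H] {Q : QuasiHopfAlgebra k H}
  [FiniteDimensional k H] (𝓡 : RMatrix Q) [h𝓡 : Fact 𝓡.IsTriangular]

open QMod

theorem RMatrix.twist_mul_Δ_u : 𝓡.twist * Q.Δ 𝓡.u =
    TensorProduct.map Q.S.toLinearMap Q.S.toLinearMap 𝓡.twist * (𝓡.u ⊗ₜ 𝓡.u) :=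
  reg_tact_injective (𝓡 := 𝓡) fun y => tact_twist_mul_Δ_u (reg 𝓡) (reg 𝓡) y

end

/-! ### The element $w=S^{-1}(u^{-1})$ and the computation of $\Theta$ -/

section Element

variable {k H : Type*} [Field k] [Ring H] [Algebra k H] {Q : QuasiHopfAlgebra k H}

theorem map_S_mul (Q : QuasiHopfAlgebra k H) (s t : H ⊗[k] H) :
    TensorProduct.map Q.S.toLinearMap Q.S.toLinearMap (s * t) =
      TensorProduct.map Q.S.toLinearMap Q.S.toLinearMap t *
        TensorProduct.map Q.S.toLinearMap Q.S.toLinearMap s := by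
  revert s
  refine tensor_ext (by fun_prop) (by fun_prop) fun a b => ?_
  revert t
  exact tensor_ext (by fun_prop) (by fun_prop) fun c d => by simp [Q.S_mul]

theorem map_S_map_S_symm (Q : QuasiHopfAlgebra k H) (t : H ⊗[k] H) :
    TensorProduct.map Q.S.toLinearMap Q.S.toLinearMap
      (TensorProduct.map Q.S.symm.toLinearMap Q.S.symm.toLinearMap t) = t := by
  revert t
  exact tensor_ext (by fun_prop) (by fun_prop) fun c d => by simp

theorem map_S_injective (Q : QuasiHopfAlgebra k H) :
    Function.Injective (TensorProduct.map Q.S.toLinearMap Q.S.toLinearMap) :=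
  (TensorProduct.congr Q.S Q.S).injective

theorem QuasiHopfAlgebra.S_symm_mul (Q : QuasiHopfAlgebra k H) (a b : H) :
    Q.S.symm (a * b) = Q.S.symm b * Q.S.symm a :=
  Q.S.injective (by simp [Q.S_mul])

theorem RMatrix.ε_u (𝓡 : RMatrix Q) : Q.ε 𝓡.u = 1 := by
  have e := congrArg Q.ε 𝓡.ε_right
  have e' := congrArg Q.ε Q.Φ_α_β
  rw [sw_map (k := k) (E := fun x => Q.ε x) (by fun_prop)] at e
  rw [sw3_map (k := k) (E := fun x => Q.ε x) (by fun_prop)] at e'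
  rw [𝓡.u_eq, sw3_map (k := k) (E := fun x => Q.ε x) (by fun_prop)]
  simp only [sw_map (k := k) (E := fun x => Q.ε x) (by fun_prop), map_mul, map_smul, Q.ε_S, Q.ε_α,
    Q.ε_β, mul_one, map_one, smul_eq_mul] at e e' ⊢
  have : ∀ x₁ x₂ x₃ : H, (sw 𝓡.R.val fun R₁ R₂ => Q.ε R₂ * Q.ε x₂ * Q.ε x₃ * Q.ε R₁ * Q.ε x₁) =
      Q.ε x₁ * Q.ε x₂ * Q.ε x₃ := fun x₁ x₂ x₃ => by
    have := sw_smul_right (Q.ε x₁ * Q.ε x₂ * Q.ε x₃) 𝓡.R.val fun R₁ R₂ => Q.ε R₂ * Q.ε R₁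
    rw [e, smul_eq_mul, mul_one] at this
    rw [← this]
    refine congrArg (sw _) (funext fun a => funext fun b => ?_)
    rw [smul_eq_mul]; ring
  simp only [this, e']

/-- The element `S⁻¹(u⁻¹)`. -/
noncomputable def RMatrix.w (𝓡 : RMatrix Q) : H := Q.S.symm 𝓡.uInv

theorem RMatrix.w_eq (𝓡 : RMatrix Q) : 𝓡.w =
    sw3 Q.Φ.val fun X₁ X₂ X₃ => sw 𝓡.R.val fun R₁ R₂ => sw3 Q.Φ⁻¹.val fun x₁ x₂ x₃ =>
      Q.S (X₂ * R₁ * x₁) * Q.α * X₃ * x₃ * Q.S.symm (X₁ * R₂ * x₂ * Q.β) := by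
  rw [RMatrix.w, RMatrix.uInv]
  simp only [sw_map (k := k) (E := fun x => Q.S.symm x) (by fun_prop),
    sw3_map (k := k) (E := fun x => Q.S.symm x) (by fun_prop)]
  simp only [Q.S_symm_mul _ (Q.S _), LinearEquiv.symm_apply_apply]

end Element

section

variable {k : Type u} {H : Type v} [Field k] [Ring H] [Algebra k H] {Q : QuasiHopfAlgebra k H}
  [FiniteDimensional k H] (𝓡 : RMatrix Q)

open QMod

theorem braiding_apply {V W : Type*} [AddCommGroup V] [Module k V] [AddCommGroup W] [Module k W]
    (M : YDData k H V) (N : YDData k H W) (hM : M.coact = 𝓡.coact M.act) (v : V) (w : W) :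
    braiding M N (v ⊗ₜ w) = sw 𝓡.R.val fun R₁ R₂ => N.act R₂ w ⊗ₜ[k] M.act R₁ v := by
  change (sw (M.coact v) fun a m₀ => N.act a w ⊗ₜ m₀) = _
  rw [hM, 𝓡.coact_apply]
  generalize 𝓡.R.val = r
  revert r
  exact tensor_ext (by fun_prop) (by fun_prop) fun a b => by simp (disch := fun_prop) [sw_pure]

/-- Expansion of $B(h)$ in the basis; this eliminates the dual bases that come from
$\mathrm{coev}'$. -/
theorem coev'_contract (A B : Module.End k H) (c : H) (φ : Module.Dual k H) (h : H) :
    (∑ i, φ (A (Q.adj c (Module.finBasis k H i))) * (Module.finBasis k H).coord i (B h)) =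
      φ (A (Q.adj c (B h))) := by
  have := congrArg (fun x => φ (A (Q.adj c x))) ((Module.finBasis k H).sum_repr (B h))
  rw [← this]
  simp only [map_sum, map_smul, Module.Basis.coord_apply, smul_eq_mul, mul_comm]

/-- The action on the right dual of `H₀`. -/
noncomputable def rightDualHom (Q : QuasiHopfAlgebra k H) :
    H →ₐ[k] Module.End k (Module.Dual k H) where
  toFun := Q.rightDualAct
  map_one' := by
    ext φ h
    change φ (adjHom Q (Q.S.symm 1) h) = φ h
    rw [show Q.S.symm 1 = 1 from Q.S.injective (by rw [Q.S.apply_symm_apply, Q.S_one]), map_one]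
    rfl
  map_mul' a b := by
    ext φ h
    change φ (adjHom Q (Q.S.symm (a * b)) h) =
      φ (adjHom Q (Q.S.symm b) (adjHom Q (Q.S.symm a) h))
    rw [Q.S_symm_mul, map_mul]; rfl
  map_zero' := map_zero _
  map_add' := map_add _
  commutes' c := by
    ext φ h
    change φ (adjHom Q (Q.S.symm _) h) = _
    rw [Algebra.algebraMap_eq_smul_one, map_smul, show Q.S.symm 1 = 1 from
      Q.S.injective (by rw [Q.S.apply_symm_apply, Q.S_one]), map_smul, map_one]
    simp

theorem map_associator_tmul {U V W P : Type*} [AddCommGroup U] [Module k U] [AddCommGroup V]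
    [Module k V] [AddCommGroup W] [Module k W] [AddCommGroup P] [Module k P] (L : YDData k H U)
    (M : YDData k H V) (N : YDData k H W) (T : U ⊗[k] (V ⊗[k] W) →ₗ[k] P) (a : U) (b : V) (c : W) :
    T (associator Q L M N ((a ⊗ₜ b) ⊗ₜ c)) =
      sw3 Q.Φ.val fun X₁ X₂ X₃ => T (L.act X₁ a ⊗ₜ[k] (M.act X₂ b ⊗ₜ[k] N.act X₃ c)) :=
  sw3_map (k := k) (E := fun F : U ⊗[k] (V ⊗[k] W) →ₗ[k] U ⊗[k] (V ⊗[k] W) =>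
    T (F (a ⊗ₜ (b ⊗ₜ c)))) (by fun_prop) _ _

theorem map_associatorInv_tmul {U V W P : Type*} [AddCommGroup U] [Module k U] [AddCommGroup V]
    [Module k V] [AddCommGroup W] [Module k W] [AddCommGroup P] [Module k P] (L : YDData k H U)
    (M : YDData k H V) (N : YDData k H W) (T : (U ⊗[k] V) ⊗[k] W →ₗ[k] P) (a : U) (b : V) (c : W) :
    T (associatorInv Q L M N (a ⊗ₜ (b ⊗ₜ c))) =
      sw3 Q.Φ⁻¹.val fun x₁ x₂ x₃ => T ((L.act x₁ a ⊗ₜ[k] M.act x₂ b) ⊗ₜ[k] N.act x₃ c) :=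
  sw3_map (k := k) (E := fun F : (U ⊗[k] V) ⊗[k] W →ₗ[k] (U ⊗[k] V) ⊗[k] W =>
    T (F ((a ⊗ₜ b) ⊗ₜ c))) (by fun_prop) _ _

theorem Θ_apply {V : Type*} [AddCommGroup V] [Module k V] [FiniteDimensional k V]
    (M : YDData k H V) (L N : YDData k H (Module.Dual k V)) (hL : L.coact = 𝓡.coact L.act)
    (φ : Module.Dual k V) : Θ Q M L N φ =
      ∑ i, sw3 Q.Φ⁻¹.val fun x₁ x₂ x₃ => sw 𝓡.R.val fun R₁ R₂ => sw3 Q.Φ.val fun X₁ X₂ X₃ =>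
        (L.act X₂ (L.act R₁ (L.act x₁ φ))) (M.act Q.α (M.act X₃ (M.act x₃ (M.act (Q.S.symm Q.β)
          (Module.finBasis k V i))))) •
          N.act X₁ (N.act R₂ (N.act x₂ ((Module.finBasis k V).coord i))) := by
  let T := (TensorProduct.rid k (Module.Dual k V)).toLinearMap ∘ₗ
    TensorProduct.map LinearMap.id (ev Q M)
  let A := T ∘ₗ associator Q N L M
  let B := A ∘ₗ TensorProduct.map (braiding L N) LinearMap.id
  change B (associatorInv Q L N M (φ ⊗ₜ coev' Q M)) = _
  have hA : ∀ a b c, A ((a ⊗ₜ b) ⊗ₜ c) = sw3 Q.Φ.val fun X₁ X₂ X₃ =>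
      (L.act X₂ b) (M.act Q.α (M.act X₃ c)) • N.act X₁ a := fun a b c => by
    exact map_associator_tmul N L M T a b c
  have hB : ∀ a b c, B ((a ⊗ₜ b) ⊗ₜ c) = sw 𝓡.R.val fun R₁ R₂ => sw3 Q.Φ.val fun X₁ X₂ X₃ =>
      (L.act X₂ (L.act R₁ a)) (M.act Q.α (M.act X₃ c)) • N.act X₁ (N.act R₂ b) := fun a b c => by
    change A (braiding L N (a ⊗ₜ b) ⊗ₜ c) = _
    rw [braiding_apply 𝓡 L N hL, sw_map (k := k) (E := fun x => A (x ⊗ₜ c)) (by fun_prop)]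
    simp only [hA]
  rw [coev', TensorProduct.tmul_sum, map_sum, map_sum]
  refine Finset.sum_congr rfl fun i _ => ?_
  rw [map_associatorInv_tmul]
  simp only [hB]

/-- After contraction of the dual bases, the actions on $H_0^*$ contribute factors $S(\cdot)$ and
those on ${}^*H_0$ factors $S^{-1}(\cdot)$. Their product is the expansion of $S^{-1}(u^{-1})$ in
`RMatrix.w_eq`. -/
theorem RMatrix.ΘH₀_apply (φ : Module.Dual k H) (h : H) : 𝓡.ΘH₀ φ h = φ (Q.adj 𝓡.w h) := by
  have m : ∀ a b, Q.adj (a * b) = Q.adj a * Q.adj b := (adjHom Q).map_mul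
  have key : ∀ (t t' : H ⊗[k] (H ⊗[k] H)) (r : H ⊗[k] H),
      (∑ i, sw3 t fun x₁ x₂ x₃ => sw r fun R₁ R₂ => sw3 t' fun X₁ X₂ X₃ =>
        φ (Q.adj (Q.S x₁) (Q.adj (Q.S R₁) (Q.adj (Q.S X₂) (Q.adj Q.α (Q.adj X₃ (Q.adj x₃
          (Q.adj (Q.S.symm Q.β) (Module.finBasis k H i)))))))) •
          (Module.finBasis k H).coord i (Q.adj (Q.S.symm x₂) (Q.adj (Q.S.symm R₂)
            (Q.adj (Q.S.symm X₁) h)))) =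
      φ (Q.adj (sw3 t' fun X₁ X₂ X₃ => sw r fun R₁ R₂ => sw3 t fun x₁ x₂ x₃ =>
        Q.S (X₂ * R₁ * x₁) * Q.α * X₃ * x₃ * Q.S.symm (X₁ * R₂ * x₂ * Q.β)) h) := by
    intro t t' r
    revert t
    refine tensor_ext₃ (isLinearMap_sum _ fun i => by fun_prop) (by fun_prop) fun a b c => ?_
    revert t'
    refine tensor_ext₃ (isLinearMap_sum _ fun i => by fun_prop) (by fun_prop) fun a' b' c' => ?_
    revert r
    refine tensor_ext (isLinearMap_sum _ fun i => by fun_prop) (by fun_prop) fun p q => ?_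
    simp (disch := fun_prop) only [sw_pure, sw3_pure]
    have := coev'_contract (Q := Q) (Q.adj (Q.S (b' * p * a) * Q.α * c' * c))
      (Q.adj (Q.S.symm (a' * q * b))) (Q.S.symm Q.β) φ h
    rw [Q.S_symm_mul _ Q.β, m _ (_ * _), m (Q.S.symm Q.β)]
    refine Eq.trans ?_ this
    simp only [Q.S_mul, Q.S_symm_mul, m, Module.End.mul_apply, smul_eq_mul]
  rw [𝓡.w_eq, ← key]
  have := congrArg (fun ψ : Module.Dual k H => ψ h) (Θ_apply 𝓡 𝓡.H₀.toYDData 𝓡.leftDualH₀.toYDData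
    𝓡.rightDualH₀.toYDData rfl φ)
  refine this.trans ?_
  simp only [LinearMap.sum_apply]
  refine Finset.sum_congr rfl fun i _ => ?_
  rw [sw3_map (k := k) (E := fun ψ : Module.Dual k H => ψ h) (by fun_prop)]
  simp only [sw_map (k := k) (E := fun ψ : Module.Dual k H => ψ h) (by fun_prop),
    sw3_map (k := k) (E := fun ψ : Module.Dual k H => ψ h) (by fun_prop)]
  rfl

end

/-! ### $\Theta_{H_0}$ is an isomorphism of braided Hopf algebras -/

section

variable {k : Type u} {H : Type v} [Field k] [Ring H] [Algebra k H] {Q : QuasiHopfAlgebra k H}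
  [FiniteDimensional k H] (𝓡 : RMatrix Q) [h𝓡 : Fact 𝓡.IsTriangular]

open QMod

theorem RMatrix.S_w : Q.S 𝓡.w = 𝓡.uInv := Q.S.apply_symm_apply _

theorem RMatrix.w_mul_S_symm_u : 𝓡.w * Q.S.symm 𝓡.u = 1 := by
  rw [RMatrix.w, ← Q.S_symm_mul, 𝓡.u_mul_uInv]
  exact Q.S.injective (by rw [Q.S.apply_symm_apply, Q.S_one])

theorem RMatrix.S_symm_u_mul_w : Q.S.symm 𝓡.u * 𝓡.w = 1 := by
  rw [RMatrix.w, ← Q.S_symm_mul, 𝓡.uInv_mul_u]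
  exact Q.S.injective (by rw [Q.S.apply_symm_apply, Q.S_one])

/-- Applying $S$ turns this into $u^{-1}S^2(h)=hu^{-1}$. It intertwines the two dual actions, one
defined through $S$ and the other through $S^{-1}$. -/
theorem RMatrix.S_mul_w (h : H) : Q.S h * 𝓡.w = 𝓡.w * Q.S.symm h := by
  refine Q.S.injective ?_
  rw [Q.S_mul, Q.S_mul, 𝓡.S_w, Q.S.apply_symm_apply, ← mul_one (_ * _), ← 𝓡.u_mul_uInv,
    mul_assoc, ← mul_assoc _ 𝓡.u, ← 𝓡.u_mul, ← mul_assoc, ← mul_assoc, 𝓡.uInv_mul_u, one_mul]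

theorem RMatrix.ε_w : Q.ε 𝓡.w = 1 := by
  have := congrArg Q.ε 𝓡.uInv_mul_u
  rw [map_mul, 𝓡.ε_u, mul_one, map_one, ← 𝓡.S_w, Q.ε_S] at this
  exact this

theorem RMatrix.twist_mul_Δ_w : 𝓡.twist * Q.Δ 𝓡.w = (𝓡.w ⊗ₜ 𝓡.w) *
    TensorProduct.map Q.S.symm.toLinearMap Q.S.symm.toLinearMap 𝓡.twist := by
  have hu : (𝓡.u ⊗ₜ[k] 𝓡.u) * (𝓡.uInv ⊗ₜ[k] 𝓡.uInv) = 1 := by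
    rw [Algebra.TensorProduct.tmul_mul_tmul, 𝓡.u_mul_uInv]; rfl
  have e : Q.Δ 𝓡.uInv * (𝓡.twistInv * TensorProduct.map Q.S.toLinearMap Q.S.toLinearMap 𝓡.twist) =
      𝓡.uInv ⊗ₜ 𝓡.uInv := by
    have := congrArg (fun x => Q.Δ 𝓡.uInv * (𝓡.twistInv * (x * (𝓡.uInv ⊗ₜ[k] 𝓡.uInv))))
      𝓡.twist_mul_Δ_u
    simp only [mul_assoc, hu, mul_one] at this
    rw [← this, ← mul_assoc 𝓡.twistInv, 𝓡.twistInv_mul_twist, one_mul, ← mul_assoc, ← map_mul,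
      𝓡.uInv_mul_u, map_one, one_mul]
  -- Under the antimultiplicative map $S\otimes S$ the claim becomes a statement about $u^{-1}$,
  -- which follows from the coproduct formula for $u$ and from moving the twist past $\Delta(S(w))$.
  refine map_S_injective Q ?_
  rw [map_S_mul, map_S_mul, map_S_map_S_symm, TensorProduct.map_tmul]
  simp only [LinearEquiv.coe_coe]
  have := congrArg (· * 𝓡.twistInv) (𝓡.twist_mul_Δ_S 𝓡.w)
  simp only [mul_assoc, 𝓡.twist_mul_twistInv, mul_one] at this
  rw [← this, 𝓡.S_w, mul_assoc, mul_assoc, e]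

theorem map_S_symm_mul_eq_one {s t : H ⊗[k] H} (h : t * s = 1) :
    TensorProduct.map Q.S.symm.toLinearMap Q.S.symm.toLinearMap s *
      TensorProduct.map Q.S.symm.toLinearMap Q.S.symm.toLinearMap t = 1 := by
  refine map_S_injective Q ?_
  rw [map_S_mul, map_S_map_S_symm, map_S_map_S_symm, h, Algebra.TensorProduct.one_def,
    TensorProduct.map_tmul]
  simp only [LinearEquiv.coe_coe, Q.S_one]

theorem RMatrix.Δ_w_mul_twistInv : Q.Δ 𝓡.w *
    TensorProduct.map Q.S.symm.toLinearMap Q.S.symm.toLinearMap 𝓡.twistInv =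
      𝓡.twistInv * (𝓡.w ⊗ₜ 𝓡.w) := by
  have := congrArg (fun x => 𝓡.twistInv * (x *
    TensorProduct.map Q.S.symm.toLinearMap Q.S.symm.toLinearMap 𝓡.twistInv)) 𝓡.twist_mul_Δ_w
  simp only [mul_assoc, map_S_symm_mul_eq_one (Q := Q) 𝓡.twistInv_mul_twist, mul_one] at this
  rw [← this, ← mul_assoc, 𝓡.twistInv_mul_twist, one_mul]

theorem comm_map_S_symm (t : H ⊗[k] H) : TensorProduct.comm k H H
    (TensorProduct.map Q.S.symm.toLinearMap Q.S.symm.toLinearMap t) =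
      TensorProduct.map Q.S.symm.toLinearMap Q.S.symm.toLinearMap (TensorProduct.comm k H H t) := by
  revert t
  exact tensor_ext (by fun_prop) (by fun_prop) fun a b => by simp

theorem dualDistrib_map_Θ (θ : Module.Dual k H ⊗[k] Module.Dual k H) (y : H ⊗[k] H) :
    TensorProduct.dualDistrib k H H (TensorProduct.map 𝓡.ΘH₀ 𝓡.ΘH₀ θ) y =
      TensorProduct.dualDistrib k H H θ (tact (adjHom Q) (adjHom Q) (𝓡.w ⊗ₜ 𝓡.w) y) := by
  revert θ
  refine tensor_ext (by fun_prop) (by fun_prop) fun φ ψ => ?_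
  revert y
  refine tensor_ext (by fun_prop) (by fun_prop) fun a b => ?_
  rw [tact_tmul]
  simp only [TensorProduct.map_tmul, TensorProduct.dualDistrib_apply, 𝓡.ΘH₀_apply]
  rfl

theorem ΘH₀_act (a : H) (φ : Module.Dual k H) :
    𝓡.ΘH₀ (𝓡.leftDualH₀.act a φ) = 𝓡.rightDualH₀.act a (𝓡.ΘH₀ φ) := by
  refine LinearMap.ext fun h => ?_
  rw [𝓡.ΘH₀_apply]
  refine Eq.trans ?_ (𝓡.ΘH₀_apply φ _).symm
  have m : ∀ a b, Q.adj (a * b) h = Q.adj a (Q.adj b h) := fun a b =>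
    LinearMap.congr_fun ((adjHom Q).map_mul a b) h
  change φ (Q.adj (Q.S a) (Q.adj 𝓡.w h)) = _
  rw [← m, 𝓡.S_mul_w, m]

theorem ΘH₀_bijective : Function.Bijective 𝓡.ΘH₀ := by
  have m : ∀ a b h, Q.adj a (Q.adj b h) = Q.adj (a * b) h := fun a b h =>
    (LinearMap.congr_fun ((adjHom Q).map_mul a b) h).symm
  have o : ∀ h, Q.adj 1 h = h := fun h => LinearMap.congr_fun (adjHom Q).map_one h
  refine Function.bijective_iff_has_inverse.2
    ⟨fun φ => φ ∘ₗ Q.adj (Q.S.symm 𝓡.u), fun φ => ?_, fun φ => ?_⟩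
  · refine LinearMap.ext fun h => ?_
    rw [LinearMap.comp_apply, 𝓡.ΘH₀_apply, m, 𝓡.w_mul_S_symm_u, o]
  · refine LinearMap.ext fun h => ?_
    rw [𝓡.ΘH₀_apply, LinearMap.comp_apply, m, 𝓡.S_symm_u_mul_w, o]

/-- Precomposition with $w\triangleright$ changes the twisting elements by $S^{-1}\otimes S^{-1}$,
which is precisely the difference between the left and right dual structures. Coactions come from
actions, units and counits from $\varepsilon(w)=1$, and the antipode from its $H$-linearity. -/
theorem isBraidedHopfIso_ΘH₀ : IsBraidedHopfIso 𝓡.leftDualH₀ 𝓡.rightDualH₀ 𝓡.ΘH₀ where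
  bijective := ΘH₀_bijective 𝓡
  map_act := ΘH₀_act 𝓡
  map_coact φ := by
    refine (𝓡.coact_apply _ _).trans ?_
    refine Eq.trans ?_ (congrArg _ (𝓡.coact_apply _ _).symm)
    rw [sw_map (k := k) (E := fun x => TensorProduct.map LinearMap.id 𝓡.ΘH₀ x) (by fun_prop)]
    refine congrArg (sw _) (funext fun a => funext fun b => ?_)
    exact congrArg (b ⊗ₜ[k] ·) (ΘH₀_act 𝓡 a φ).symm
  map_mul φ ψ := by
    refine LinearMap.ext fun h => ?_
    rw [𝓡.ΘH₀_apply, dualMul_apply_twist, 𝓡.comulH₀_adj, ← Module.End.mul_apply, ← map_mul,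
      𝓡.twist_mul_Δ_w, map_mul, Module.End.mul_apply, ← dualDistrib_map_Θ, TensorProduct.map_tmul]
    refine Eq.trans ?_ (𝓡.dualMul_apply _ _ _ _ h).symm
    rw [comm_map_S_symm]
    rfl
  map_one := by
    refine LinearMap.ext fun h => (𝓡.ΘH₀_apply _ _).trans ?_
    refine (Q.ε_adj 𝓡 _ _).trans ?_
    rw [𝓡.ε_w, one_mul]
    rfl
  map_comul φ := by
    refine dualDistrib_injective fun y => ?_
    rw [dualDistrib_map_Θ, dualComul_apply_twist, ← Module.End.mul_apply, ← map_mul,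
      ← 𝓡.Δ_w_mul_twistInv, map_mul, Module.End.mul_apply, Q.circ_adj 𝓡, ← 𝓡.ΘH₀_apply]
    refine (Q.dualComul_apply _ _ _ y).trans ?_
    rw [comm_map_S_symm]
    rfl
  map_counit φ := by
    refine (𝓡.ΘH₀_apply _ _).trans ?_
    rw [Q.adj_β, 𝓡.ε_w, one_smul]
    rfl
  map_antipode φ := by
    refine LinearMap.ext fun h => (𝓡.ΘH₀_apply _ _).trans ?_
    refine Eq.trans ?_ (𝓡.ΘH₀_apply φ _).symm
    exact congrArg φ (𝓡.antipodeH₀_adj _ _)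

theorem isBraidedHopfAlgebra_leftDualH₀ : IsBraidedHopfAlgebra Q 𝓡.leftDualH₀ :=
  isBraidedHopfAlgebra (leftDualMod 𝓡) 𝓡.leftDualH₀ (isHopf_leftDual 𝓡) (fun _ _ => rfl) rfl
    (fun _ _ => rfl) (one_smul k (Q.ε.toLinearMap : Module.Dual k H))
    (fun _ => rfl) (fun _ => rfl) fun _ => rfl

/-- The right dual of `H₀` as a module. -/
noncomputable abbrev rightDualMod : QMod 𝓡 where
  carrier := Module.Dual k H
  act := rightDualHom Q

/-- The map `Θ` as an isomorphism of modules. -/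
noncomputable def ΘIso : leftDualMod 𝓡 ≅ rightDualMod 𝓡 :=
  mkIso (LinearEquiv.ofBijective 𝓡.ΘH₀ (ΘH₀_bijective 𝓡)) (ΘH₀_act 𝓡)

/-- Since $\Theta_{H_0}$ is bijective and matches all structure maps, the given structure on
${}^*H_0$ is the one transported from $H_0^*$. -/
theorem isBraidedHopfAlgebra_rightDualH₀ : IsBraidedHopfAlgebra Q 𝓡.rightDualH₀ := by
  have i := isBraidedHopfIso_ΘH₀ 𝓡
  have e : ∀ φ, 𝓡.ΘH₀ ((ΘIso 𝓡).inv.lin φ) = φ :=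
    (LinearEquiv.ofBijective 𝓡.ΘH₀ (ΘH₀_bijective 𝓡)).apply_symm_apply
  refine isBraidedHopfAlgebra (rightDualMod 𝓡) 𝓡.rightDualH₀ ((isHopf_leftDual 𝓡).of_iso (ΘIso 𝓡))
    (fun _ _ => rfl) rfl (fun φ ψ => ?_) ?_ (fun φ => ?_) (fun φ => ?_) fun φ => ?_
  · refine (i.map_mul _ _).trans ?_
    rw [e, e]
  · exact (congrArg 𝓡.ΘH₀ (one_smul k _)).trans i.map_one
  · refine (i.map_comul _).symm.trans ?_
    rw [e]
  · refine congrArg ULift.up ((i.map_counit _).symm.trans ?_)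
    rw [e]
  · refine (i.map_antipode _).trans ?_
    rw [e]

end

end QuasiHopf

theorem proposition5p2 {k H : Type*} [Field k] [Ring H] [Algebra k H] [FiniteDimensional k H]
    (Q : QuasiHopf.QuasiHopfAlgebra k H) (𝓡 : QuasiHopf.RMatrix Q) (h𝓡 : 𝓡.IsTriangular) :
    QuasiHopf.IsBraidedHopfAlgebra Q 𝓡.leftDualH₀ ∧
    QuasiHopf.IsBraidedHopfAlgebra Q 𝓡.rightDualH₀ ∧
    (∃ u : Hˣ, (u : H) = 𝓡.u ∧ ∀ φ : Module.Dual k H,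
      𝓡.ΘH₀ φ = 𝓡.rightDualH₀.act (u⁻¹ : Hˣ) φ) ∧
    QuasiHopf.IsBraidedHopfIso 𝓡.leftDualH₀ 𝓡.rightDualH₀ 𝓡.ΘH₀ := by
  have : Fact 𝓡.IsTriangular := ⟨h𝓡⟩
  exact ⟨QuasiHopf.isBraidedHopfAlgebra_leftDualH₀ 𝓡, QuasiHopf.isBraidedHopfAlgebra_rightDualH₀ 𝓡,
    ⟨⟨𝓡.u, 𝓡.uInv, 𝓡.u_mul_uInv, 𝓡.uInv_mul_u⟩, rfl,
      fun φ => LinearMap.ext fun h => 𝓡.ΘH₀_apply φ h⟩,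
    QuasiHopf.isBraidedHopfIso_ΘH₀ 𝓡⟩
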